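/- **Setting.** For each $n\ge1$ let $X_1^{(n)},\dots,X_n^{(n)}\in\mathbb R$ be deterministic points, $\mu_n=\frac1n\sum_{j=1}^n\delta_{X_j^{(n)}}$, and let $\mu$ be a probability measure on $\mathbb R$, $x^*\in\mathbb R$, $\kappa>2$. Let $F_n,F$ be the distribution functions of $\mu_n,\mu$. Assume: 1. All $X_j^{(n)}$ lie in a fixed bounded set and $\mu_n\to\mu$ weakly as $n\to\infty$; $\mu$ has a Lebesgue density $\psi$ that is continuous as a function on the support of $\mu$, and $\psi(x)\sim c|x-x^*|^{\kappa}$ as $x\to x^*$ for some $c>0$. 2. There are $M_0>0$, $n_0>0$ with $|F_n(x)-F(x)|\le M_0/n$ for all $n\ge n_0$, $x\in\mathbb R$. 3. There are $m>0$, $n_0$ such that for $n\ge n_0$ no $X_j^{(n)}$ lies in $[x^*-mn^{-1/(\kappa+1)},\,x^*+mn^{-1/(\kappa+1)}]$. Write $G_j=(-1)^jj!\int\frac{d\mu(s)}{(x^*-s)^{j+1}}$ for the derivatives $G_\mu^{(j)}(x^*)$ of the Stieltjes transform $G_\mu(z)=\int\frac{d\mu(s)}{z-s}$, and put $$t_{\rm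 cr}=\Big(\int\frac{d\mu(s)}{(x^*-s)^2}\Big)^{-1},\quad c_3=\frac1{t_{\rm cr}}\Big(\frac{6}{-G_3}\Big)^{1/4},\quad t_n(\tau)=t_{\rm cr}+\frac{\tau}{c_3^2n^{1/2}},\quad x_n(\tau)=x^*+t_n(\tau)G_0 .$$ With $g_{\mu_n}(z)=\int\log(z-s)\,d\mu_n(s)$ (principal branch), let for $s,t>0$ $$K_{n,s,t}(x,y)=\frac{n}{(2\pi i)^2\sqrt{st}}\int_{x_0+i\mathbb R}dz\int_\Gamma dw\,\frac{e^{\frac n{2t}[(z-y)^2+2tg_{\mu_n}(z)]-\frac n{2s}[(w-x)^2+2sg_{\mu_n}(w)]}}{z-w}-1(s>t)\frac{\sqrt n}{\sqrt{2\pi(s-t)}}e^{-\frac{n(x-y)^2}{2(s-t)}},$$ where $\Gamma$ is a finite union of piecewise $C^1$ closed curves having total winding number $1$ around every $X_j^{(n)}$, and $x_0\in\mathbb R$ is such that $\Gamma$ does not meet $x_0+i\mathbb R$. Let $$\tilde K_{n,s,t}(x,y)=K_{n,s,t}(x,y)\,e^{f_n(t,y)-f_n(s,x)},\qquad f_n(s,x)=-nG_0x+\tfrac12nG_0^2s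 .$$ The extended Pearcey kernel is $$\mathbb K^{\rm P}_{\tau_1,\tau_2}(u,v)=\frac1{(2\pi i)^2}\int_{i\mathbb R}d\zeta\int_{\Gamma^{\rm P}}d\omega\,\frac{e^{-\frac{\zeta^4}4-\frac{\tau_2\zeta^2}2-v\zeta+\frac{\omega^4}4+\frac{\tau_1\omega^2}2+u\omega}}{\zeta-\omega}-1(\tau_1>\tau_2)\frac{e^{-\frac{(u-v)^2}{2(\tau_1-\tau_2)}}}{\sqrt{2\pi(\tau_1-\tau_2)}},$$ where $\Gamma^{\rm P}$ consists of two rays from the origin to $\pm\infty e^{-i\pi/4}$ and two rays from $\pm\infty e^{i\pi/4}$ to the origin. **Theorem.** Suppose in addition that $G_2=G_\mu''(x^*)=0$ and $\kappa>3$. Then for every $0<\epsilon<\min\big(\frac{\kappa-3}{8(\kappa+1)},\frac1{24}\big)$, as $n\to\infty$, $$\frac1{c_3n^{3/4}}\tilde K_{n,t_n(\tau_1),t_n(\tau_2)}\Big(x_n(\tau_1)+\frac u{c_3n^{3/4}},\,x_n(\tau_2)+\frac v{c_3n^{3/4}}\Big)=\mathbb K^{\rm P}_{\tau_1,\tau_2}(u,v)+\mathcal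 O(n^{-\epsilon}),$$ uniformly for $\tau_1,\tau_2$ in any compact subset of $\mathbb R$ and $u,v\in[-M,M]$, for any $M>0$ (and uniformly over the admissible choices of $x_0$ and $\Gamma$). -/

import Mathlib

open MeasureTheory Filter Topology Set

namespace NIBM

noncomputable section

/-- The empirical measure `(1/n) ∑ δ_{X j}` of the initial points. -/
def empirical {n : ℕ} (X : Fin n → ℝ) : Measure ℝ :=
  (n : ENNReal)⁻¹ • ∑ j, Measure.dirac (X j)

/-- First assumption: the initial points stay in a fixed bounded set, their empirical measures
converge weakly to the probability measure `μ`, which has a density `ψ` that is continuous on the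
support of `μ` and satisfies `ψ(x) ~ c |x - x*|^κ` as `x → x*`, with `c > 0` and `κ > 2`. -/
structure Assumption1 (X : (n : ℕ) → Fin n → ℝ) (μ : Measure ℝ) (ψ : ℝ → ℝ) (xs κ : ℝ) :
    Prop where
  bounded : ∃ B : Set ℝ, Bornology.IsBounded B ∧ ∀ n j, X n j ∈ B
  prob : IsProbabilityMeasure μ
  weak : ∀ f : BoundedContinuousFunction ℝ ℝ,
    Tendsto (fun n : ℕ => ∫ x, f x ∂(empirical (X n))) atTop (𝓝 (∫ x, f x ∂μ))
  meas : Measurable ψ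
  nonneg : ∀ x, 0 ≤ ψ x
  density : μ = volume.withDensity (fun x => ENNReal.ofReal (ψ x))
  cont : ContinuousOn ψ μ.support
  kappa : 2 < κ
  vanish : ∃ c : ℝ, 0 < c ∧
    Asymptotics.IsEquivalent (𝓝[≠] xs) ψ (fun x => c * |x - xs| ^ κ)

/-- Second assumption: the distribution functions satisfy `|F_n - F| ≤ M / n` uniformly. -/
def Assumption2 (X : (n : ℕ) → Fin n → ℝ) (μ : Measure ℝ) : Prop :=
  ∃ M : ℝ, 0 < M ∧ ∃ n₀ : ℕ, 0 < n₀ ∧ ∀ n : ℕ, n₀ ≤ n → ∀ x : ℝ,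
    |(empirical (X n)).real (Iic x) - μ.real (Iic x)| ≤ M / n

/-- Third assumption: there is no initial point within distance `m n^{-1/(κ+1)}` of `x*`. -/
def Assumption3 (X : (n : ℕ) → Fin n → ℝ) (xs κ : ℝ) : Prop :=
  ∃ m : ℝ, 0 < m ∧ ∃ n₀ : ℕ, ∀ n : ℕ, n₀ ≤ n → ∀ j : Fin n,
    X n j ∉ Icc (xs - m * (n : ℝ) ^ (-(1 / (κ + 1)))) (xs + m * (n : ℝ) ^ (-(1 / (κ + 1))))

/-- The derivative `G_μ^{(j)}(x) = (-1)^j j! ∫ dμ(s) / (x - s)^{j+1}` of the Stieltjes transform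
`G_μ(z) = ∫ dμ(s) / (z - s)` at a real point `x`, possibly in the support of `μ`, where it is
given by this integral. For `j = 0` it is `G_μ(x)`. -/
def stieltjesD (μ : Measure ℝ) (j : ℕ) (x : ℝ) : ℝ :=
  (-1) ^ j * (j.factorial : ℝ) * ∫ s, 1 / (x - s) ^ (j + 1) ∂μ

/-- The critical time `t_cr = (∫ dμ(s) / (x - s)^2)⁻¹`. -/
def tcr (μ : Measure ℝ) (x : ℝ) : ℝ := (∫ s, 1 / (x - s) ^ 2 ∂μ)⁻¹

/-- `c₃ = (1 / t_cr) (6 / (-G_μ'''(x*)))^{1/4}`. -/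
def c3 (μ : Measure ℝ) (xs : ℝ) : ℝ :=
  1 / tcr μ xs * (6 / -stieltjesD μ 3 xs) ^ ((1 : ℝ) / 4)

/-- `t_n^P(τ) = t_cr + τ / (c₃² n^{1/2})`. -/
def tP (μ : Measure ℝ) (xs : ℝ) (n : ℕ) (τ : ℝ) : ℝ :=
  tcr μ xs + τ / (c3 μ xs ^ 2 * (n : ℝ) ^ ((1 : ℝ) / 2))

/-- `x_n^P(τ) = x* + t_n^P(τ) G_μ(x*)`. -/
def xP (μ : Measure ℝ) (xs : ℝ) (n : ℕ) (τ : ℝ) : ℝ :=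
  xs + tP μ xs n τ * stieltjesD μ 0 xs

/-- `g_{μ_n}(z) = ∫ log (z - s) dμ_n(s)`, with the principal branch. -/
def logPotential {n : ℕ} (X : Fin n → ℝ) (z : ℂ) : ℂ :=
  ∫ s, Complex.log (z - (s : ℂ)) ∂(empirical X)

/-- A piecewise continuously differentiable curve, parametrized by `[0, 1]`. -/
def IsPiecewiseC1 (γ : ℝ → ℂ) : Prop :=
  ∃ (k : ℕ) (a : ℕ → ℝ), Monotone a ∧ a 0 = 0 ∧ a k = 1 ∧
    ∀ i < k, ContDiffOn ℝ 1 γ (Icc (a i) (a (i + 1)))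

/-- `∫_γ f(w) dw` for a curve `γ` parametrized by `[0, 1]`. -/
def curveInt (γ : ℝ → ℂ) (f : ℂ → ℂ) : ℂ :=
  ∫ r in (0 : ℝ)..1, f (γ r) * deriv γ r

/-- `∫ f(z) dz` over the upward vertical line `x₀ + iℝ`. -/
def lineInt (x₀ : ℝ) (f : ℂ → ℂ) : ℂ :=
  ∫ r : ℝ, f ((x₀ : ℂ) + (r : ℂ) * Complex.I) * Complex.I

/-- `∫ f(w) dw` over the ray from `0` to `∞ · a`. -/
def rayInt (a : ℂ) (f : ℂ → ℂ) : ℂ :=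
  ∫ r in Ioi (0 : ℝ), f ((r : ℂ) * a) * a

/-- The contours allowed in the kernel: `Γ` is a finite union of closed curves
`γ 0, …, γ (m - 1)` with total winding number `1` around every initial point, and `Γ` does not
meet the line `x₀ + iℝ`. -/
structure Admissible {n : ℕ} (X : Fin n → ℝ) (x₀ : ℝ) {m : ℕ} (γ : Fin m → ℝ → ℂ) : Prop where
  piecewise : ∀ i, IsPiecewiseC1 (γ i)
  closed : ∀ i, γ i 0 = γ i 1
  avoids : ∀ i, ∀ r ∈ Icc (0 : ℝ) 1, ∀ j, γ i r ≠ (X j : ℂ)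
  winding : ∀ j, (2 * (Real.pi : ℂ) * Complex.I)⁻¹ *
    ∑ i, curveInt (γ i) (fun w => 1 / (w - (X j : ℂ))) = 1
  offLine : ∀ i, ∀ r ∈ Icc (0 : ℝ) 1, (γ i r).re ≠ x₀

/-- The correlation kernel `K_{n,s,t}(x,y)` of the non-intersecting Brownian motions started at
the points `X`, written with the contours `x₀ + iℝ` and `Γ = γ 0 ∪ … ∪ γ (m - 1)`. -/
def kernel {n : ℕ} (X : Fin n → ℝ) (x₀ : ℝ) {m : ℕ} (γ : Fin m → ℝ → ℂ) (s t x y : ℝ) : ℂ :=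
  (n : ℂ) / ((2 * (Real.pi : ℂ) * Complex.I) ^ 2 * (Real.sqrt (s * t) : ℂ)) *
    lineInt x₀ (fun z => ∑ i, curveInt (γ i) (fun w =>
      Complex.exp
        ((n : ℂ) / (2 * (t : ℂ)) * ((z - (y : ℂ)) ^ 2 + 2 * (t : ℂ) * logPotential X z)
          - (n : ℂ) / (2 * (s : ℂ)) * ((w - (x : ℂ)) ^ 2 + 2 * (s : ℂ) * logPotential X w))
        / (z - w)))
  - (if t < s then
      ((Real.sqrt n / Real.sqrt (2 * Real.pi * (s - t)) *
        Real.exp (-((n : ℝ) / (2 * (s - t)) * (x - y) ^ 2)) : ℝ) : ℂ)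
    else 0)

/-- The gauge factor `f_n(s,x) = -n G_μ(x*) x + n G_μ(x*)² s / 2`. -/
def gauge (μ : Measure ℝ) (xs : ℝ) (n : ℕ) (s x : ℝ) : ℝ :=
  -((n : ℝ) * stieltjesD μ 0 xs * x) + (n : ℝ) * stieltjesD μ 0 xs ^ 2 * s / 2

/-- The conjugated kernel `K_{n,s,t}(x,y) exp (f_n(t,y) - f_n(s,x))`. -/
def conjKernel (μ : Measure ℝ) (xs : ℝ) {n : ℕ} (X : Fin n → ℝ) (x₀ : ℝ) {m : ℕ}
    (γ : Fin m → ℝ → ℂ) (s t x y : ℝ) : ℂ :=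
  kernel X x₀ γ s t x y * (Real.exp (gauge μ xs n t y - gauge μ xs n s x) : ℂ)

/-- `∫ f(ω) dω` over `Γ^P`: two rays from the origin to `±∞ e^{-iπ/4}` and two rays from
`±∞ e^{iπ/4}` to the origin. -/
def pearceyContourInt (f : ℂ → ℂ) : ℂ :=
  rayInt (Complex.exp (-((Real.pi : ℂ) / 4 * Complex.I))) f
    + rayInt (-Complex.exp (-((Real.pi : ℂ) / 4 * Complex.I))) f
    - rayInt (Complex.exp ((Real.pi : ℂ) / 4 * Complex.I)) f
    - rayInt (-Complex.exp ((Real.pi : ℂ) / 4 * Complex.I)) f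

/-- The extended Pearcey kernel. -/
def pearceyKernel (τ₁ τ₂ u v : ℝ) : ℂ :=
  1 / (2 * (Real.pi : ℂ) * Complex.I) ^ 2 *
    lineInt 0 (fun ζ => pearceyContourInt (fun ω =>
      Complex.exp (-(ζ ^ 4 / 4) - (τ₂ : ℂ) * ζ ^ 2 / 2 - (v : ℂ) * ζ
        + ω ^ 4 / 4 + (τ₁ : ℂ) * ω ^ 2 / 2 + (u : ℂ) * ω) / (ζ - ω)))
  - (if τ₂ < τ₁ then
      ((1 / Real.sqrt (2 * Real.pi * (τ₁ - τ₂)) *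
        Real.exp (-((u - v) ^ 2 / (2 * (τ₁ - τ₂)))) : ℝ) : ℂ)
    else 0)

end

end NIBM

/-! The first half replaces all admissible contours by one fixed pair through `x*`. Since `exp (n *
logPotential X w)` is the polynomial `nodal (points X) w`, branches of the logarithm play no role.
For `z` outside `Γ` the residue theorem turns the `w`-integral into `2πi` times the sum of the
principal parts of `E / nodal` at the initial points, taken at `z`, where `E` is the Gaussian in
`w`. That sum is `E / nodal - e` with `e` entire and independent of the contour. Multiplied by the
exponential in `z`, it becomes an entire function of `z` with Gaussian decay in vertical strips, so
the line can be moved to `x* + iℝ`, even across initial points (`exists_doubleIntegral_eq`). For `z`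
on that line and off the real axis, the wedge of four rays from `x*` at angles `±π/6`, `±5π/6` picks
up the same residues (`wedgeInt_resolventGauss`). The two new contours cross at `x*`, where
`1/(z-w)` is still integrable.

Put `z = x* + λζ` with `λ = c₃ t_cr n^{-1/4}`. The exponent becomes a quadratic polynomial plus `∑
log (1 + b_j ζ)`, where `b_j = λ / (x* - X_j)`. The gap around `x*` makes every `b_j` of order
`n^{-rate κ}`, and the discrepancy bound shows that `∑ b_j^k` equals `n λ^k ∫ dμ(s)/(x*-s)^k` up to
the same order for `k ≤ 4`. The first two sums combine with the quadratic polynomial to `-vζ -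
τζ²/2`, the third is negligible because `G₂ = 0`, and the fourth is close to `1` by the choice of
`c₃`: the phase is close to the Pearcey phase (`exists_phaseClose`).

The angle `π/6` makes the domination global. On these lines and on the imaginary axis `u³` is purely
imaginary, so the derivative in `s` of `Re (log (1+su) - su + (su)²/2)` is `s³ |u|² Re (u²) /
|1+su|²`, of constant sign for `s > 0`. Thus every summand descends, whatever the sign of `b_j`, and
for large `n` both exponentials are below one fixed Gaussian along the entire contours
(`PhaseClose.re_le`). No separation into near and far parts is needed: the difference of the two
double integrals is bounded by the difference of the phases (`Descends.norm_saddleInt_sub_le`). The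
Pearcey contour is rotated from `π/4` to `π/6` (`pearceyContourInt_eq_wedgeInt`), the Gaussian
transition terms agree exactly (`exp_gaussian_eq`), and the error is of order `n^{-rate κ}`. -/

namespace NIBM

/-! ### Residue calculus for abstract cycles. -/

noncomputable section

/-- A linear functional `I` on functions that behaves like the integral over a closed contour with
trace `K`: it is linear, depends only on the values on `K`, and kills derivatives. -/
structure IsCycle (I : (ℂ → ℂ) → ℂ) (K : Set ℂ) : Prop where
  add : ∀ f g, ContinuousOn f K → ContinuousOn g K → I (fun w => f w + g w) = I f + I g
  smul : ∀ (c : ℂ) f, I (fun w => c * f w) = c * I f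
  congr : ∀ f g, EqOn f g K → I f = I g
  exact : ∀ G G' : ℂ → ℂ, ContinuousOn G' K → (∀ w ∈ K, HasDerivAt G (G' w) w) → I G' = 0

/-- The monic polynomial function with the given multiset of roots. -/
def nodal (s : Multiset ℂ) (w : ℂ) : ℂ := (s.map fun a => w - a).prod

@[simp] lemma nodal_zero (w : ℂ) : nodal 0 w = 1 := by simp [nodal]

@[simp] lemma nodal_cons (a : ℂ) (s : Multiset ℂ) (w : ℂ) :
    nodal (a ::ₘ s) w = (w - a) * nodal s w := by simp [nodal]

lemma nodal_replicate (k : ℕ) (a w : ℂ) : nodal (Multiset.replicate k a) w = (w - a) ^ k := by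
  simp [nodal]

lemma nodal_ne_zero {s : Multiset ℂ} {w : ℂ} (h : w ∉ s) : nodal s w ≠ 0 := by
  simp only [nodal, ne_eq, Multiset.prod_eq_zero_iff, Multiset.mem_map, not_exists, not_and]
  intro a ha h0
  exact h (by rwa [sub_eq_zero.mp h0])

lemma differentiable_nodal (s : Multiset ℂ) : Differentiable ℂ (nodal s) := by
  induction s using Multiset.induction_on with
  | empty => simp [funext nodal_zero]
  | cons a s ih =>
    rw [funext (nodal_cons a s)]
    fun_prop

lemma continuousOn_one_div_nodal {s : Multiset ℂ} {K : Set ℂ} (h : ∀ a ∈ s, a ∉ K) :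
    ContinuousOn (fun w => 1 / nodal s w) K :=
  continuousOn_const.div (differentiable_nodal s).continuous.continuousOn
    fun _ hw => nodal_ne_zero fun hs => h _ hs hw

variable {I : (ℂ → ℂ) → ℂ} {K : Set ℂ}

lemma IsCycle.sub (hI : IsCycle I K) {f g : ℂ → ℂ} (hf : ContinuousOn f K)
    (hg : ContinuousOn g K) : I (fun w => f w - g w) = I f - I g := by
  have h := hI.add f (fun w => (-1) * g w) hf (by fun_prop)
  rw [hI.smul] at h
  rw [show (fun w => f w - g w) = fun w => f w + (-1) * g w by ext; ring, h]
  ring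

lemma IsCycle.entire (hI : IsCycle I K) {e : ℂ → ℂ} (he : Differentiable ℂ e) : I e = 0 := by
  obtain ⟨G, hG⟩ := he.isExactOn_univ
  exact hI.exact G e he.continuous.continuousOn fun w _ => hG w (mem_univ w)

lemma IsCycle.pow_inv (hI : IsCycle I K) {a : ℂ} (ha : a ∉ K) (k : ℕ) :
    I (fun w => 1 / (w - a) ^ (k + 2)) = 0 := by
  have hne : ∀ w ∈ K, w - a ≠ 0 := fun w hw h => ha (by rwa [← sub_eq_zero.mp h])
  refine hI.exact (fun w => -(1 / (k + 1 : ℂ)) * ((w - a) ^ (k + 1))⁻¹) _ ?_ fun w hw => ?_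
  · exact continuousOn_const.div (by fun_prop) fun w hw => pow_ne_zero _ (hne w hw)
  · have h0 : HasDerivAt (fun w => (w - a) ^ (k + 1)) ((k + 1 : ℕ) * (w - a) ^ k) w := by
      simpa using ((hasDerivAt_id w).sub_const a).fun_pow (k + 1)
    have h1 := (h0.fun_inv (pow_ne_zero _ (hne w hw))).const_mul (-(1 / (k + 1 : ℂ)))
    refine h1.congr_deriv ?_
    have h2 := hne w hw
    have h3 : (k + 1 : ℂ) ≠ 0 := by exact_mod_cast k.succ_ne_zero
    push_cast
    field_simp
    ring

/-- The contour winds once around `a`. -/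
def WindsOnce (I : (ℂ → ℂ) → ℂ) (K : Set ℂ) (a : ℂ) : Prop :=
  a ∉ K ∧ I (fun w => 1 / (w - a)) = 2 * Real.pi * Complex.I

/-- A denominator of degree at least two leaves no residue at infinity, so the residues at the roots
cancel. Two distinct roots are separated by partial fractions, which lowers the degree; if all roots
coincide there is a primitive. -/
lemma IsCycle.one_div_nodal (hI : IsCycle I K) (n : ℕ) : ∀ s : Multiset ℂ,
    (∀ a ∈ s, WindsOnce I K a) → s.card = n + 2 → I (fun w => 1 / nodal s w) = 0 := by
  induction n with
  | zero =>
    intro s hs hc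
    obtain ⟨a, b, rfl⟩ := Multiset.card_eq_two.mp hc
    have ha := hs a (by simp)
    have hb := hs b (by simp)
    by_cases hab : a = b
    · subst hab
      have := hI.pow_inv ha.1 0
      convert this using 3
      simp [nodal, pow_two]
    · have hna : ∀ w ∈ K, w - a ≠ 0 := fun w hw h => ha.1 (by rwa [← sub_eq_zero.mp h])
      have hnb : ∀ w ∈ K, w - b ≠ 0 := fun w hw h => hb.1 (by rwa [← sub_eq_zero.mp h])
      rw [hI.congr _ (fun w => (1 / (a - b)) * (1 / (w - a) - 1 / (w - b))), hI.smul, hI.sub,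
        ha.2, hb.2]
      · simp
      · exact continuousOn_const.div (by fun_prop) hna
      · exact continuousOn_const.div (by fun_prop) hnb
      · intro w hw
        have h1 := hna w hw
        have h2 := hnb w hw
        have h3 := sub_ne_zero.mpr hab
        simp only [nodal, Multiset.insert_eq_cons, Multiset.map_cons, Multiset.map_singleton,
          Multiset.prod_cons, Multiset.prod_singleton]
        field_simp
        ring
  | succ n ih =>
    intro s hs hc
    obtain ⟨a, has⟩ := Multiset.card_pos_iff_exists_mem.mp (by omega : 0 < s.card)
    obtain ⟨t, rfl⟩ := Multiset.exists_cons_of_mem has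
    have ha := hs a (by simp)
    by_cases hall : ∀ b ∈ t, b = a
    · have ht : t = Multiset.replicate (n + 2) a := by
        rw [Multiset.eq_replicate]
        exact ⟨by simpa using hc, hall⟩
      have := hI.pow_inv ha.1 (n + 1)
      convert this using 3 with w
      rw [nodal_cons, ht, nodal_replicate]
      ring
    · push Not at hall
      obtain ⟨b, hbt, hba⟩ := hall
      obtain ⟨q, rfl⟩ := Multiset.exists_cons_of_mem hbt
      have hb := hs b (by simp)
      have hna : ∀ w ∈ K, w - a ≠ 0 := fun w hw h => ha.1 (by rwa [← sub_eq_zero.mp h])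
      have hnb : ∀ w ∈ K, w - b ≠ 0 := fun w hw h => hb.1 (by rwa [← sub_eq_zero.mp h])
      have hqa : ∀ c ∈ a ::ₘ q, WindsOnce I K c := fun c hc => hs c (by
        simp only [Multiset.mem_cons] at hc ⊢; tauto)
      have hqb : ∀ c ∈ b ::ₘ q, WindsOnce I K c := fun c hc => hs c (by
        simp only [Multiset.mem_cons] at hc ⊢; tauto)
      rw [hI.congr _ (fun w => (1 / (a - b)) * (1 / nodal (a ::ₘ q) w - 1 / nodal (b ::ₘ q) w)),
        hI.smul, hI.sub, ih _ hqa (by simpa using hc), ih _ hqb (by simpa using hc)]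
      · simp
      · exact continuousOn_one_div_nodal fun c hc => (hqa c hc).1
      · exact continuousOn_one_div_nodal fun c hc => (hqb c hc).1
      · intro w hw
        have h1 := hna w hw
        have h2 := hnb w hw
        have h3 := sub_ne_zero.mpr (Ne.symm hba)
        have h4 : nodal q w ≠ 0 := nodal_ne_zero fun h => (hqa w (by simp [h])).1 hw
        simp only [nodal_cons]
        field_simp
        ring

/-- As `z` lies outside, only the residues at the roots count, and they add up to minus the residue
at `z`. With no roots there is nothing inside the contour. -/
lemma IsCycle.one_div_nodal_mul (hI : IsCycle I K) {z : ℂ} (hz : z ∉ K)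
    (hz0 : I (fun w => 1 / (w - z)) = 0) (s : Multiset ℂ) (hs : ∀ a ∈ s, WindsOnce I K a)
    (hzs : z ∉ s) :
    I (fun w => 1 / (nodal s w * (z - w)))
      = if s = 0 then 0 else 2 * Real.pi * Complex.I / nodal s z := by
  have hzK : ∀ w ∈ K, z - w ≠ 0 := fun w hw h => hz (by rwa [sub_eq_zero.mp h])
  induction s using Multiset.induction_on with
  | empty =>
    rw [hI.congr _ (fun w => (-1) * (1 / (w - z))), hI.smul, hz0]
    · simp
    · intro w hw
      simp only [nodal_zero, one_mul]
      rw [← neg_sub w z, div_neg, neg_one_mul]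
  | cons a q ih =>
    have hq : ∀ c ∈ q, WindsOnce I K c := fun c hc => hs c (by simp [hc])
    have ha := hs a (by simp)
    have hza : z - a ≠ 0 := sub_ne_zero.mpr (by rintro rfl; simp at hzs)
    have hzq : z ∉ q := fun h => hzs (by simp [h])
    have hna : ∀ w ∈ K, w - a ≠ 0 := fun w hw h => ha.1 (by rwa [← sub_eq_zero.mp h])
    have hnq : ∀ w ∈ K, nodal q w ≠ 0 := fun w hw => nodal_ne_zero fun h => (hq w h).1 hw
    have hnz := nodal_ne_zero hzq
    have hcq := (differentiable_nodal q).continuous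
    have h0 : I (fun w => 1 / nodal (a ::ₘ q) w)
        = if q = 0 then 2 * Real.pi * Complex.I else 0 := by
      split_ifs with h
      · subst h
        simpa only [nodal_cons, nodal_zero, mul_one, if_true] using ha.2
      · obtain ⟨k, hk⟩ : ∃ k, (a ::ₘ q).card = k + 2 := by
          have : 0 < q.card := Multiset.card_pos.mpr h
          exact ⟨q.card - 1, by simp; omega⟩
        exact hI.one_div_nodal k _ hs hk
    rw [hI.congr _ (fun w => (1 / (z - a)) * (1 / nodal (a ::ₘ q) w + 1 / (nodal q w * (z - w)))),
      hI.smul, hI.add, ih hq hzq, h0]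
    · by_cases h : q = 0
      · subst h
        simp only [if_true, nodal_cons, nodal_zero, mul_one, Multiset.cons_ne_zero, if_false]
        ring
      · simp [h]
        field_simp
    · exact continuousOn_one_div_nodal fun c hc => (hs c hc).1
    · exact continuousOn_const.div (by fun_prop) fun w hw => mul_ne_zero (hnq w hw) (hzK w hw)
    · intro w hw
      have h1 := hna w hw
      have h2 := hnq w hw
      have h3 := hzK w hw
      simp only [nodal_cons]
      field_simp
      ring

lemma one_le_norm_nodal {s : Multiset ℂ} (hs : ∀ a ∈ s, a.im = 0) {z : ℂ} (hz : 1 ≤ |z.im|) :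
    1 ≤ ‖nodal s z‖ := by
  induction s using Multiset.induction_on with
  | empty => simp
  | cons a q ih =>
    rw [nodal_cons, norm_mul]
    refine one_le_mul_of_one_le_of_one_le ?_ (ih fun b hb => hs b (by simp [hb]))
    refine hz.trans ?_
    have := Complex.abs_im_le_norm (z - a)
    rwa [Complex.sub_im, hs a (by simp), sub_zero] at this

lemma differentiable_dslope {E : ℂ → ℂ} (hE : Differentiable ℂ E) (a : ℂ) :
    Differentiable ℂ (dslope E a) := by
  rw [← differentiableOn_univ] at hE ⊢
  exact (Complex.differentiableOn_dslope univ_mem).mpr hE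

lemma eq_add_mul_dslope (E : ℂ → ℂ) (a w : ℂ) : E w = E a + (w - a) * dslope E a w := by
  have := sub_smul_dslope E a w
  rw [smul_eq_mul] at this
  rw [this]
  ring

/-- Residue formula for `E / nodal s` with `E` entire, in the form of a decomposition into the
principal parts `E / nodal s - e` and an entire function `e` that does not depend on the cycle. -/
theorem exists_entire_part (s : Multiset ℂ) (hreal : ∀ a ∈ s, a.im = 0) :
    ∀ E : ℂ → ℂ, Differentiable ℂ E →
    ∃ e : ℂ → ℂ, Differentiable ℂ e ∧
      (∃ C : ℝ, ∀ z : ℂ, 1 ≤ |z.im| → ‖E z / nodal s z - e z‖ ≤ C) ∧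
      ∀ (I : (ℂ → ℂ) → ℂ) (K : Set ℂ), IsCycle I K → (∀ a ∈ s, WindsOnce I K a) →
        ∀ z ∉ K, z ∉ s → I (fun w => 1 / (w - z)) = 0 →
          I (fun w => E w / (nodal s w * (z - w)))
            = 2 * Real.pi * Complex.I * (E z / nodal s z - e z) := by
  induction s using Multiset.induction_on with
  | empty =>
    intro E hE
    -- Without roots there is no principal part, so the entire part is all of `E`.
    refine ⟨E, hE, ⟨0, by simp⟩, fun I K hI _ z hzK _ hz0 => ?_⟩
    have hzne : ∀ w ∈ K, w - z ≠ 0 := fun w hw h => hzK (by rwa [← sub_eq_zero.mp h])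
    have hd := differentiable_dslope hE z
    rw [hI.congr _ (fun w => (-1) * dslope E z w - E z * (1 / (w - z))), hI.sub, hI.smul, hI.smul,
      hz0, hI.entire hd]
    · simp
    · exact (continuous_const.mul hd.continuous).continuousOn
    · exact continuousOn_const.mul (continuousOn_const.div (by fun_prop) hzne)
    · intro w hw
      have h := hzne w hw
      have h' : z - w ≠ 0 := by rw [← neg_sub]; exact neg_ne_zero.mpr h
      simp only [nodal_zero, one_mul]
      rw [eq_add_mul_dslope E z w, ← neg_sub w z]
      field_simp
      ring
  | cons a q ih =>
    intro E hE
    have hd := differentiable_dslope hE a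
    obtain ⟨e, he, ⟨C, hC⟩, hcyc⟩ := ih (fun b hb => hreal b (by simp [hb])) (dslope E a) hd
    -- In `E = E a + (w - a) * dslope E a` the constant contributes only a principal part, hence the
    -- entire part is that of `dslope E a` over the remaining roots. The bound grows by `‖E a‖`
    -- since `nodal` has modulus at least `1` when `|Im z| ≥ 1`.
    refine ⟨e, he, ⟨‖E a‖ + C, fun z hz => ?_⟩, fun I K hI hs z hzK hzs hz0 => ?_⟩
    · have hn := one_le_norm_nodal hreal hz
      have hn0 : nodal (a ::ₘ q) z ≠ 0 := fun h => by rw [h] at hn; norm_num at hn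
      have hn1 := hn0
      rw [nodal_cons] at hn1
      have h1 := left_ne_zero_of_mul hn1
      have h2 := right_ne_zero_of_mul hn1
      have : E z / nodal (a ::ₘ q) z - e z
          = E a / nodal (a ::ₘ q) z + (dslope E a z / nodal q z - e z) := by
        rw [eq_add_mul_dslope E a z, nodal_cons]
        field_simp
        ring
      rw [this]
      refine (norm_add_le _ _).trans (add_le_add ?_ (hC z hz))
      rw [norm_div]
      exact div_le_self (norm_nonneg _) hn
    · have hq : ∀ c ∈ q, WindsOnce I K c := fun c hc => hs c (by simp [hc])
      have hzK' : ∀ w ∈ K, z - w ≠ 0 := fun w hw h => hzK (by rwa [sub_eq_zero.mp h])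
      have hnK : ∀ w ∈ K, nodal (a ::ₘ q) w ≠ 0 := fun w hw =>
        nodal_ne_zero fun h => (hs w h).1 hw
      have hnq : ∀ w ∈ K, nodal q w ≠ 0 := fun w hw => nodal_ne_zero fun h => (hq w h).1 hw
      have hc1 := (differentiable_nodal (a ::ₘ q)).continuous
      have hc2 := (differentiable_nodal q).continuous
      have hzq : z ∉ q := fun h => hzs (by simp [h])
      have hza : z - a ≠ 0 := sub_ne_zero.mpr (by rintro rfl; simp at hzs)
      have hnz := nodal_ne_zero hzq
      rw [hI.congr _ (fun w => E a * (1 / (nodal (a ::ₘ q) w * (z - w)))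
          + dslope E a w / (nodal q w * (z - w))), hI.add, hI.smul,
        hI.one_div_nodal_mul hzK hz0 _ hs hzs, hcyc I K hI hq z hzK hzq hz0]
      · rw [eq_add_mul_dslope E a z, if_neg (Multiset.cons_ne_zero), nodal_cons]
        field_simp
        ring
      · exact continuousOn_const.mul (continuousOn_const.div (by fun_prop)
          fun w hw => mul_ne_zero (hnK w hw) (hzK' w hw))
      · exact hd.continuous.continuousOn.div (by fun_prop)
          fun w hw => mul_ne_zero (hnq w hw) (hzK' w hw)
      · intro w hw
        have h1 := hnK w hw
        rw [nodal_cons] at h1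
        have h2 := left_ne_zero_of_mul h1
        have h3 := hnq w hw
        have h4 := hzK' w hw
        simp only [nodal_cons]
        rw [eq_add_mul_dslope E a w]
        field_simp

lemma IsCycle.mono {K' : Set ℂ} (hI : IsCycle I K) (h : K ⊆ K') : IsCycle I K' where
  add f g hf hg := hI.add f g (hf.mono h) (hg.mono h)
  smul := hI.smul
  congr f g hfg := hI.congr f g (hfg.mono h)
  exact G G' hG' hG := hI.exact G G' (hG'.mono h) fun w hw => hG w (h hw)

lemma IsCycle.sum {ι : Type*} (t : Finset ι) {J : ι → (ℂ → ℂ) → ℂ}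
    (hJ : ∀ i ∈ t, IsCycle (J i) K) : IsCycle (fun f => ∑ i ∈ t, J i f) K where
  add f g hf hg := by
    rw [← Finset.sum_add_distrib]
    exact Finset.sum_congr rfl fun i hi => (hJ i hi).add f g hf hg
  smul c f := by
    rw [Finset.mul_sum]
    exact Finset.sum_congr rfl fun i hi => (hJ i hi).smul c f
  congr f g hfg := Finset.sum_congr rfl fun i hi => (hJ i hi).congr f g hfg
  exact G G' hG' hG := Finset.sum_eq_zero fun i hi => (hJ i hi).exact G G' hG' hG

end

/-! ### Closed curves as cycles, and the admissible contours. -/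

noncomputable section

/-- One branch of the logarithm, of `w - z` or of `z - w`, is a primitive along the whole trace. -/
lemma IsCycle.one_div_eq_zero_of_slitPlane {I : (ℂ → ℂ) → ℂ} {K : Set ℂ} (hI : IsCycle I K)
    {z : ℂ} (h : (∀ w ∈ K, w - z ∈ Complex.slitPlane) ∨ ∀ w ∈ K, z - w ∈ Complex.slitPlane) :
    I (fun w => 1 / (w - z)) = 0 := by
  have hne : ∀ w ∈ K, w - z ≠ 0 := by
    intro w hw
    rcases h with h | h
    · exact Complex.slitPlane_ne_zero (h w hw)
    · rw [← neg_sub]; exact neg_ne_zero.mpr (Complex.slitPlane_ne_zero (h w hw))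
  have hc : ContinuousOn (fun w => 1 / (w - z)) K :=
    continuousOn_const.div (by fun_prop) hne
  rcases h with h | h
  · refine hI.exact (fun w => Complex.log (w - z)) _ hc fun w hw => ?_
    exact ((hasDerivAt_id w).sub_const z).clog (h w hw)
  · refine hI.exact (fun w => Complex.log (z - w)) _ hc fun w hw => ?_
    have := ((hasDerivAt_id w).const_sub z).clog (h w hw)
    refine this.congr_deriv ?_
    simp only [id]
    rw [← neg_sub w z, neg_div_neg_eq]

lemma IsCycle.one_div_eq_zero {I : (ℂ → ℂ) → ℂ} {K : Set ℂ} (hI : IsCycle I K) {z : ℂ}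
    (h : (∀ w ∈ K, z.re < w.re) ∨ ∀ w ∈ K, w.re < z.re) : I (fun w => 1 / (w - z)) = 0 :=
  hI.one_div_eq_zero_of_slitPlane <| h.imp
    (fun h w hw => Or.inl (by simpa using h w hw)) fun h w hw => Or.inl (by simpa using h w hw)

section curves

variable {γ : ℝ → ℂ}

/-- At the breakpoints `deriv γ` need not be the one-sided derivative; integrability only sees the
open interval, where it agrees with `derivWithin`. -/
lemma intervalIntegrable_curve_piece {a b : ℝ} (hab : a ≤ b) (hγ : ContDiffOn ℝ 1 γ (Icc a b))
    {f : ℂ → ℂ} (hf : ContinuousOn f (γ '' Icc a b)) :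
    IntervalIntegrable (fun r => f (γ r) * deriv γ r) volume a b := by
  rcases hab.eq_or_lt with rfl | hab'
  · exact IntervalIntegrable.refl
  rw [intervalIntegrable_iff_integrableOn_Ioo_of_le hab]
  have hc : ContinuousOn (fun r => f (γ r) * derivWithin γ (Icc a b) r) (Icc a b) :=
    (hf.comp hγ.continuousOn (mapsTo_image _ _)).mul
      (hγ.continuousOn_derivWithin (uniqueDiffOn_Icc hab') le_rfl)
  refine (hc.integrableOn_Icc.mono_set Ioo_subset_Icc_self).congr_fun (fun r hr => ?_)
    measurableSet_Ioo
  simp only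
  rw [derivWithin_of_mem_nhds (Icc_mem_nhds hr.1 hr.2)]

lemma integral_curve_piece {a b : ℝ} (hab : a ≤ b) (hγ : ContDiffOn ℝ 1 γ (Icc a b))
    {G G' : ℂ → ℂ} (hG' : ContinuousOn G' (γ '' Icc a b))
    (hG : ∀ w ∈ γ '' Icc a b, HasDerivAt G (G' w) w) :
    ∫ r in a..b, G' (γ r) * deriv γ r = G (γ b) - G (γ a) := by
  refine intervalIntegral.integral_eq_sub_of_hasDerivAt_of_le (f := fun r => G (γ r)) hab ?_ ?_
    (intervalIntegrable_curve_piece hab hγ hG')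
  · intro r hr
    exact (hG _ (mem_image_of_mem _ hr)).continuousAt.comp_continuousWithinAt
      (hγ.continuousOn r hr)
  · intro r hr
    have h1 : HasDerivAt γ (deriv γ r) r :=
      ((hγ.differentiableOn one_ne_zero).differentiableAt
        (Icc_mem_nhds hr.1 hr.2)).hasDerivAt
    exact (hG _ (mem_image_of_mem _ (Ioo_subset_Icc_self hr))).comp r h1

lemma IsPiecewiseC1.continuousOn (h : IsPiecewiseC1 γ) : ContinuousOn γ (Icc 0 1) := by
  obtain ⟨k, a, ha, h0, h1, hC⟩ := h
  have : ∀ i ≤ k, ContinuousOn γ (Icc (a 0) (a i)) := by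
    intro i
    induction i with
    | zero => intro _; simp
    | succ i ih =>
      intro hi
      rw [← Icc_union_Icc_eq_Icc (ha (Nat.zero_le i)) (ha (Nat.le_succ i))]
      exact (ih (by omega)).union_of_isClosed (hC i (by omega)).continuousOn isClosed_Icc
        isClosed_Icc
  simpa [h0, h1] using this k le_rfl

lemma isCycle_curveInt (h : IsPiecewiseC1 γ) (hcl : γ 0 = γ 1) :
    IsCycle (curveInt γ) (γ '' Icc 0 1) := by
  obtain ⟨k, a, ha, h0, h1, hC⟩ := h
  have hsub : ∀ i < k, Icc (a i) (a (i + 1)) ⊆ Icc 0 1 := fun i hi =>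
    Icc_subset_Icc (h0 ▸ ha (Nat.zero_le i)) (h1 ▸ ha (by omega))
  have hint : ∀ f, ContinuousOn f (γ '' Icc 0 1) →
      IntervalIntegrable (fun r => f (γ r) * deriv γ r) volume 0 1 := by
    intro f hf
    have := IntervalIntegrable.trans_iterate (a := a) (n := k) (μ := volume)
      (f := fun r => f (γ r) * deriv γ r) fun i hi =>
      intervalIntegrable_curve_piece (ha (Nat.le_succ i)) (hC i hi)
        (hf.mono (image_mono (hsub i hi)))
    rwa [h0, h1] at this
  refine ⟨fun f g hf hg => ?_, fun c f => ?_, fun f g hfg => ?_, fun G G' hG' hG => ?_⟩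
  · simp only [curveInt, add_mul]
    exact intervalIntegral.integral_add (hint f hf) (hint g hg)
  · simp only [curveInt, mul_assoc]
    exact intervalIntegral.integral_const_mul _ _
  · refine intervalIntegral.integral_congr fun r hr => ?_
    rw [uIcc_of_le zero_le_one] at hr
    rw [hfg (mem_image_of_mem _ hr)]
  · have hsum := intervalIntegral.sum_integral_adjacent_intervals (a := a) (n := k) (μ := volume)
      (f := fun r => G' (γ r) * deriv γ r) fun i hi =>
      intervalIntegrable_curve_piece (ha (Nat.le_succ i)) (hC i hi)
        (hG'.mono (image_mono (hsub i hi)))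
    rw [h0, h1] at hsum
    rw [curveInt, ← hsum, Finset.sum_congr rfl fun i hi =>
      integral_curve_piece (ha (Nat.le_succ i)) (hC i (Finset.mem_range.mp hi))
        (hG'.mono (image_mono (hsub i (Finset.mem_range.mp hi))))
        fun w hw => hG w (image_mono (hsub i (Finset.mem_range.mp hi)) hw),
      Finset.sum_range_sub (fun i => G (γ (a i))), h0, h1, hcl, sub_self]

/-- The real parts along a connected curve form an interval that misses `x₀`. This holds curve by
curve; different curves of `Γ` may lie on different sides of the line. -/
lemma curve_one_side (h : IsPiecewiseC1 γ) {x₀ : ℝ} (hx : ∀ r ∈ Icc (0 : ℝ) 1, (γ r).re ≠ x₀) :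
    (∀ w ∈ γ '' Icc 0 1, x₀ < w.re) ∨ ∀ w ∈ γ '' Icc 0 1, w.re < x₀ := by
  have hpre : IsPreconnected (Complex.re '' (γ '' Icc 0 1)) :=
    (isPreconnected_Icc.image _ h.continuousOn).image _ Complex.continuous_re.continuousOn
  have hmem : x₀ ∉ Complex.re '' (γ '' Icc 0 1) := by
    rintro ⟨_, ⟨r, hr, rfl⟩, h⟩
    exact hx r hr h
  by_contra! hcon
  obtain ⟨⟨w, hw, hwx⟩, ⟨w', hw', hwx'⟩⟩ := hcon
  exact hmem (hpre.ordConnected.out (mem_image_of_mem _ hw) (mem_image_of_mem _ hw') ⟨hwx, hwx'⟩)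

end curves

section admissible

variable {n : ℕ} {X : Fin n → ℝ} {x₀ : ℝ} {m : ℕ} {γ : Fin m → ℝ → ℂ}

/-- The multiset of initial points. -/
def points (X : Fin n → ℝ) : Multiset ℂ := Finset.univ.val.map fun j => (X j : ℂ)

lemma mem_points {a : ℂ} : a ∈ points X ↔ ∃ j, (X j : ℂ) = a := by
  simp [points]

lemma nodal_points (w : ℂ) : nodal (points X) w = ∏ j, (w - X j) := by
  simp only [nodal, points, Multiset.map_map]
  rfl

lemma Admissible.isCycle (h : Admissible X x₀ γ) :
    IsCycle (fun f => ∑ i, curveInt (γ i) f) (⋃ i, γ i '' Icc 0 1) :=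
  IsCycle.sum _ fun i _ =>
    (isCycle_curveInt (h.piecewise i) (h.closed i)).mono (subset_iUnion (fun i => γ i '' Icc 0 1) i)

lemma Admissible.one_div_eq_zero (h : Admissible X x₀ γ) {z : ℂ} (hz : z.re = x₀) :
    ∑ i, curveInt (γ i) (fun w => 1 / (w - z)) = 0 := by
  refine Finset.sum_eq_zero fun i _ => ?_
  refine (isCycle_curveInt (h.piecewise i) (h.closed i)).one_div_eq_zero ?_
  rw [hz]
  exact curve_one_side (h.piecewise i) (h.offLine i)

lemma Admissible.windsOnce (h : Admissible X x₀ γ) {a : ℂ} (ha : a ∈ points X) :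
    WindsOnce (fun f => ∑ i, curveInt (γ i) f) (⋃ i, γ i '' Icc 0 1) a := by
  obtain ⟨j, rfl⟩ := mem_points.mp ha
  refine ⟨?_, ?_⟩
  · simp only [mem_iUnion, mem_image, not_exists, not_and]
    exact fun i r hr => h.avoids i r hr j
  · have := h.winding j
    have hp : (2 * (Real.pi : ℂ) * Complex.I) ≠ 0 := Complex.two_pi_I_ne_zero
    rwa [inv_mul_eq_div, div_eq_one_iff_eq hp] at this

/-- `Γ` winds zero times around points of the line and once around initial points. -/
lemma Admissible.notMem_points (h : Admissible X x₀ γ) {z : ℂ} (hz : z.re = x₀) :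
    z ∉ points X := by
  intro ha
  have h1 := (h.windsOnce ha).2
  simp only [h.one_div_eq_zero hz] at h1
  exact Complex.two_pi_I_ne_zero h1.symm

lemma Admissible.notMem_curves (h : Admissible X x₀ γ) {z : ℂ} (hz : z.re = x₀) :
    z ∉ ⋃ i, γ i '' Icc 0 1 := by
  simp only [mem_iUnion, mem_image, not_exists, not_and]
  rintro i r hr rfl
  exact h.offLine i r hr hz

/-- The factor `n` turns the mean of principal logarithms into a plain sum, so exponentiation
removes the branch cuts. -/
lemma exp_logPotential (hn : 0 < n) {w : ℂ} (hw : w ∉ points X) :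
    Complex.exp (n * logPotential X w) = nodal (points X) w := by
  have hne : (n : ℂ) ≠ 0 := by exact_mod_cast hn.ne'
  have : (n : ℂ) * logPotential X w = ∑ j, Complex.log (w - X j) := by
    rw [logPotential, empirical, integral_smul_measure, integral_finsetSum_measure]
    · simp only [integral_dirac, ENNReal.toReal_inv, ENNReal.toReal_natCast, Complex.real_smul]
      push_cast
      rw [mul_inv_cancel_left₀ hne]
    · intro j _
      exact integrable_dirac (by simp)
  rw [this, Complex.exp_sum, nodal_points]
  refine Finset.prod_congr rfl fun j _ => Complex.exp_log ?_
  intro h0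
  exact hw (mem_points.mpr ⟨j, (sub_eq_zero.mp h0).symm⟩)

end admissible

/-! ### Shifting the vertical line. -/

section shift

/-- Cauchy's theorem on rectangles of height `2R`, whose horizontal sides vanish in the limit. -/
lemma lineInt_eq_of_gaussian_bound {L : ℂ → ℂ} (hL : Differentiable ℂ L) {x₀ x₁ C b : ℝ}
    (hb : 0 < b) (hbd : ∀ x ∈ uIcc x₀ x₁, ∀ r : ℝ,
      ‖L (x + r * Complex.I)‖ ≤ C * Real.exp (-b * r ^ 2)) :
    lineInt x₀ L = lineInt x₁ L := by
  have hint : ∀ x ∈ uIcc x₀ x₁, Integrable fun r : ℝ => L (x + r * Complex.I) := by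
    intro x hx
    refine ((integrable_exp_neg_mul_sq hb).const_mul C).mono' ?_ (ae_of_all _ (hbd x hx))
    have := hL.continuous
    exact Continuous.aestronglyMeasurable (by fun_prop)
  have hlim : ∀ x ∈ uIcc x₀ x₁, Tendsto (fun R : ℝ => ∫ r in (-R)..R, L (x + r * Complex.I)) atTop
      (𝓝 (∫ r : ℝ, L (x + r * Complex.I))) := fun x hx =>
    intervalIntegral_tendsto_integral (hint x hx) tendsto_neg_atTop_atBot tendsto_id
  have hhor : ∀ σ : ℝ, |σ| = 1 → Tendsto (fun R : ℝ => ∫ x in x₀..x₁, L (x + (σ * R : ℝ) * Complex.I))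
      atTop (𝓝 0) := by
    intro σ hσ
    have h0 : Tendsto (fun R : ℝ => C * Real.exp (-b * R ^ 2) * |x₁ - x₀|) atTop (𝓝 0) := by
      have h1 : Tendsto (fun R : ℝ => -b * R ^ 2) atTop atBot :=
        (tendsto_pow_atTop two_ne_zero).const_mul_atTop_of_neg (neg_neg_of_pos hb)
      simpa using ((Real.tendsto_exp_atBot.comp h1).const_mul C).mul_const |x₁ - x₀|
    refine squeeze_zero_norm (fun R => ?_) h0
    refine intervalIntegral.norm_integral_le_of_norm_le_const fun x hx => ?_
    have := hbd x (uIoc_subset_uIcc hx) (σ * R)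
    rwa [mul_pow, ← sq_abs σ, hσ, one_pow, one_mul] at this
  have hrect : ∀ R : ℝ, (∫ r in (-R)..R, L (x₁ + r * Complex.I))
      - ∫ r in (-R)..R, L (x₀ + r * Complex.I)
      = Complex.I * ((∫ x in x₀..x₁, L (x + ((-1) * R : ℝ) * Complex.I))
        - ∫ x in x₀..x₁, L (x + (1 * R : ℝ) * Complex.I)) := by
    intro R
    have := Complex.integral_boundary_rect_eq_zero_of_differentiableOn L ⟨x₀, -R⟩ ⟨x₁, R⟩
      hL.differentiableOn
    simp only [smul_eq_mul] at this
    simp only [neg_mul, one_mul]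
    linear_combination (-Complex.I) * this + ((∫ r in (-R)..R, L (x₁ + r * Complex.I))
      - ∫ r in (-R)..R, L (x₀ + r * Complex.I)) * Complex.I_mul_I
  have hl := (hlim x₁ right_mem_uIcc).sub (hlim x₀ left_mem_uIcc)
  simp only [hrect] at hl
  have hr := ((hhor (-1) (by simp)).sub (hhor 1 (by simp))).const_mul Complex.I
  have := tendsto_nhds_unique hl hr
  rw [sub_zero, mul_zero, sub_eq_zero] at this
  rw [lineInt, lineInt, integral_mul_const, integral_mul_const, this]

lemma norm_nodal_le {s : Multiset ℂ} {z : ℂ} {D : ℝ} (h : ∀ a ∈ s, ‖z - a‖ ≤ D) :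
    ‖nodal s z‖ ≤ Real.exp (s.card * D) := by
  induction s using Multiset.induction_on with
  | empty => simp
  | cons a q ih =>
    rw [nodal_cons, norm_mul, Multiset.card_cons, Nat.cast_succ, add_mul, one_mul, add_comm,
      Real.exp_add]
    refine mul_le_mul ((h a (by simp)).trans ?_) (ih fun b hb => h b (by simp [hb]))
      (norm_nonneg _) (Real.exp_pos _).le
    linarith [Real.add_one_le_exp D]

lemma norm_exp_mul_sq (c : ℝ) (x r y : ℝ) :
    ‖Complex.exp (c * ((x : ℂ) + r * Complex.I - y) ^ 2)‖
      = Real.exp (c * ((x - y) ^ 2 - r ^ 2)) := by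
  rw [Complex.norm_exp]
  congr 1
  simp [pow_two]

/-- Gaussian decay in vertical strips of the entire function whose line integral gives the
kernel. -/
lemma exists_gaussian_bound {s : Multiset ℂ} (hreal : ∀ a ∈ s, a.im = 0) {E e : ℂ → ℂ}
    (hE : Differentiable ℂ E) (he : Differentiable ℂ e) {C₀ : ℝ}
    (hC : ∀ z : ℂ, 1 ≤ |z.im| → ‖E z / nodal s z - e z‖ ≤ C₀) {c : ℝ} (hc : 0 < c) (y x₀ x₁ : ℝ) :
    ∃ C, ∀ x ∈ uIcc x₀ x₁, ∀ r : ℝ,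
      ‖Complex.exp (c * ((x : ℂ) + r * Complex.I - y) ^ 2)
        * (E (x + r * Complex.I) - nodal s (x + r * Complex.I) * e (x + r * Complex.I))‖
        ≤ C * Real.exp (-(c / 2) * r ^ 2) := by
  obtain ⟨D, hD⟩ : ∃ D, ∀ a ∈ s, ∀ x ∈ uIcc x₀ x₁, |x - a.re| ≤ D := by
    clear hC hreal
    induction s using Multiset.induction_on with
    | empty => simp
    | cons a q ih =>
      obtain ⟨D, hD⟩ := ih
      refine ⟨max D (|x₀ - a.re| + |x₁ - x₀|), fun b hb x hx => ?_⟩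
      rcases Multiset.mem_cons.mp hb with rfl | hb
      · refine le_trans ?_ (le_max_right _ _)
        have h1 := abs_sub_left_of_mem_uIcc hx
        have h2 := abs_sub_le x x₀ b.re
        have h3 := abs_sub_comm x x₀
        linarith
      · exact (hD b hb x hx).trans (le_max_left _ _)
  have hcont : Continuous fun p : ℝ × ℝ => ‖Complex.exp (c * ((p.1 : ℂ) + p.2 * Complex.I - y) ^ 2)
        * (E (p.1 + p.2 * Complex.I) - nodal s (p.1 + p.2 * Complex.I) *
          e (p.1 + p.2 * Complex.I))‖ := by
    have h1 := hE.continuous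
    have h2 := he.continuous
    have h3 := (differentiable_nodal s).continuous
    fun_prop
  obtain ⟨C₁, hC₁⟩ := ((isCompact_uIcc (a := x₀) (b := x₁)).prod
    (isCompact_Icc (a := (-1 : ℝ)) (b := 1))).bddAbove_image hcont.continuousOn
  obtain ⟨Q, hQ⟩ := (isCompact_uIcc (a := x₀) (b := x₁)).bddAbove_image
    (f := fun x => (x - y) ^ 2) (by fun_prop)
  set N : ℝ := (s.card : ℝ)
  -- For `|r| ≥ 1` the polynomial grows at most like `exp (N (D + |r|))`, and `N|r| ≤ N²/(2c) +
  -- (c/2) r²` spends half of the Gaussian on it. For `|r| ≤ 1`, where `hC` says nothing,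
  -- compactness gives `C₁`.
  set C₂ : ℝ := Real.exp (c * Q + N * D + N ^ 2 / (2 * c)) * max C₀ 0
  refine ⟨max (C₁ * Real.exp (c / 2)) C₂, fun x hx r => ?_⟩
  rcases le_total |r| 1 with hr | hr
  · have h1 : _ ≤ C₁ := hC₁ (mem_image_of_mem _ (show ((x, r) : ℝ × ℝ) ∈ _ from
      ⟨hx, abs_le.mp hr⟩))
    have hr2 : r ^ 2 ≤ 1 := by rw [← sq_abs]; nlinarith [abs_nonneg r]
    have hC0 : 0 ≤ C₁ := (norm_nonneg _).trans h1
    calc _ ≤ C₁ := h1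
      _ = C₁ * Real.exp (c / 2) * Real.exp (-(c / 2)) := by
          rw [mul_assoc, ← Real.exp_add]; simp
      _ ≤ max (C₁ * Real.exp (c / 2)) C₂ * Real.exp (-(c / 2) * r ^ 2) := by
          refine mul_le_mul (le_max_left _ _) (Real.exp_le_exp.mpr ?_) (Real.exp_pos _).le
            ((mul_nonneg hC0 (Real.exp_pos _).le).trans (le_max_left _ _))
          nlinarith
  · set z : ℂ := x + r * Complex.I with hz
    have him : z.im = r := by simp [z]
    have hre : z.re = x := by simp [z]
    have h1 := hC z (by rwa [him])
    have hn := one_le_norm_nodal hreal (z := z) (by rwa [him])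
    have hn0 : nodal s z ≠ 0 := fun h => by rw [h] at hn; norm_num at hn
    have hn2 : ‖nodal s z‖ ≤ Real.exp (N * (D + |r|)) := by
      refine norm_nodal_le fun a ha => ?_
      refine (Complex.norm_le_abs_re_add_abs_im _).trans (add_le_add ?_ ?_)
      · rw [Complex.sub_re, hre]; exact hD a ha x hx
      · rw [Complex.sub_im, him, hreal a ha, sub_zero]
    have hq : (x - y) ^ 2 ≤ Q := hQ (mem_image_of_mem _ hx)
    have heq : E z - nodal s z * e z = nodal s z * (E z / nodal s z - e z) := by
      field_simp
    rw [heq, norm_mul, norm_mul, norm_exp_mul_sq]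
    have hkey : Real.exp (c * ((x - y) ^ 2 - r ^ 2)) * Real.exp (N * (D + |r|))
        ≤ Real.exp (c * Q + N * D + N ^ 2 / (2 * c)) * Real.exp (-(c / 2) * r ^ 2) := by
      rw [← Real.exp_add, ← Real.exp_add]
      refine Real.exp_le_exp.mpr ?_
      have h2 : N * |r| ≤ N ^ 2 / (2 * c) + c / 2 * r ^ 2 := by
        have h3 : 0 ≤ (N - c * |r|) ^ 2 / (2 * c) := by positivity
        have h4 : (N - c * |r|) ^ 2 / (2 * c) = N ^ 2 / (2 * c) + c / 2 * r ^ 2 - N * |r| := by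
          rw [← sq_abs r]; field_simp; ring
        linarith
      nlinarith
    have hmax : ‖E z / nodal s z - e z‖ ≤ max C₀ 0 := h1.trans (le_max_left _ _)
    calc _ ≤ Real.exp (c * ((x - y) ^ 2 - r ^ 2)) * (Real.exp (N * (D + |r|)) * max C₀ 0) := by
          gcongr
      _ = (Real.exp (c * ((x - y) ^ 2 - r ^ 2)) * Real.exp (N * (D + |r|))) * max C₀ 0 := by ring
      _ ≤ (Real.exp (c * Q + N * D + N ^ 2 / (2 * c)) * Real.exp (-(c / 2) * r ^ 2))
            * max C₀ 0 := by gcongr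
      _ = C₂ * Real.exp (-(c / 2) * r ^ 2) := by simp only [C₂]; ring
      _ ≤ _ := by gcongr; exact le_max_right _ _

end shift

/-- The double contour integral of the kernel does not depend on the admissible contours: it is
the integral over any vertical line of an entire function given by residues. -/
theorem exists_doubleIntegral_eq {n : ℕ} (hn : 0 < n) (X : Fin n → ℝ) {s t : ℝ} (hs : 0 < s)
    (ht : 0 < t) (x y : ℝ) :
    ∃ e : ℂ → ℂ,
      (∀ (I : (ℂ → ℂ) → ℂ) (K : Set ℂ), IsCycle I K → (∀ a ∈ points X, WindsOnce I K a) →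
        ∀ z ∉ K, z ∉ points X → I (fun w => 1 / (w - z)) = 0 →
          I (fun w => Complex.exp (-(n / (2 * s) : ℝ) * (w - x) ^ 2)
              / (nodal (points X) w * (z - w)))
            = 2 * Real.pi * Complex.I * (Complex.exp (-(n / (2 * s) : ℝ) * (z - x) ^ 2)
              / nodal (points X) z - e z)) ∧
      ∀ (x₀ : ℝ) (m : ℕ) (γ : Fin m → ℝ → ℂ), Admissible X x₀ γ → ∀ x₁ : ℝ,
        lineInt x₀ (fun z => ∑ i, curveInt (γ i) (fun w =>
          Complex.exp
            ((n : ℂ) / (2 * (t : ℂ)) * ((z - (y : ℂ)) ^ 2 + 2 * (t : ℂ) * logPotential X z)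
              - (n : ℂ) / (2 * (s : ℂ)) * ((w - (x : ℂ)) ^ 2 + 2 * (s : ℂ) * logPotential X w))
            / (z - w)))
        = lineInt x₁ (fun z => 2 * Real.pi * Complex.I *
            (Complex.exp ((n / (2 * t) : ℝ) * (z - y) ^ 2) *
              (Complex.exp (-(n / (2 * s) : ℝ) * (z - x) ^ 2) - nodal (points X) z * e z))) := by
  have hreal : ∀ a ∈ points X, a.im = 0 := by
    intro a ha
    obtain ⟨j, rfl⟩ := mem_points.mp ha
    simp
  set E : ℂ → ℂ := fun w => Complex.exp (-(n / (2 * s) : ℝ) * (w - x) ^ 2) with hE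
  have hEd : Differentiable ℂ E := by fun_prop
  obtain ⟨e, he, ⟨C₀, hC₀⟩, hcyc⟩ := exists_entire_part (points X) hreal E hEd
  refine ⟨e, hcyc, fun x₀ m γ hγ x₁ => ?_⟩
  have hnR : (0 : ℝ) < n := by exact_mod_cast hn
  have hnC : (n : ℂ) ≠ 0 := by exact_mod_cast hn.ne'
  have hsC : (s : ℂ) ≠ 0 := by exact_mod_cast hs.ne'
  have htC : (t : ℂ) ≠ 0 := by exact_mod_cast ht.ne'
  have hc : (0 : ℝ) < n / (2 * t) := by positivity
  -- Multiplying the residue formula by the nodal polynomial clears its poles; this is why the line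
  -- may pass over initial points.
  set L : ℂ → ℂ := fun z => Complex.exp ((n / (2 * t) : ℝ) * (z - y) ^ 2) *
    (E z - nodal (points X) z * e z) with hL
  have hLd : Differentiable ℂ L := by
    have := differentiable_nodal (points X)
    fun_prop
  obtain ⟨C, hC⟩ := exists_gaussian_bound hreal hEd he hC₀ hc y x₀ x₁
  have hshift := lineInt_eq_of_gaussian_bound hLd (half_pos hc) hC
  have hmul : ∀ a, lineInt a (fun z => 2 * Real.pi * Complex.I * L z)
      = 2 * Real.pi * Complex.I * lineInt a L := by
    intro a
    simp only [lineInt, mul_assoc, integral_const_mul]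
  rw [hmul, ← hshift, ← hmul]
  unfold lineInt
  congr 1
  ext r
  congr 1
  set z : ℂ := x₀ + r * Complex.I with hz
  have hzre : z.re = x₀ := by simp [z]
  have hzp := hγ.notMem_points hzre
  have hnz := nodal_ne_zero hzp
  have hcy := hγ.isCycle
  have h1 := hcyc _ _ hcy (fun a ha => hγ.windsOnce ha) z (hγ.notMem_curves hzre) hzp
    (hγ.one_div_eq_zero hzre)
  have h2 := hcy.congr (fun w => Complex.exp
        ((n : ℂ) / (2 * (t : ℂ)) * ((z - (y : ℂ)) ^ 2 + 2 * (t : ℂ) * logPotential X z)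
          - (n : ℂ) / (2 * (s : ℂ)) * ((w - (x : ℂ)) ^ 2 + 2 * (s : ℂ) * logPotential X w))
        / (z - w))
    (fun w => (Complex.exp ((n / (2 * t) : ℝ) * (z - y) ^ 2) * nodal (points X) z) *
      (E w / (nodal (points X) w * (z - w)))) ?_
  · refine h2.trans ?_
    rw [hcy.smul]
    simp only
    rw [h1]
    simp only [hL]
    field_simp
  · intro w hw
    have hwp : w ∉ points X := fun h => (hγ.windsOnce h).1 hw
    simp only [hE]
    rw [← exp_logPotential hn hzp, ← exp_logPotential hn hwp, ← div_div (Complex.exp _),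
      mul_div_assoc', ← Complex.exp_sub, ← Complex.exp_add, ← Complex.exp_add]
    congr 2
    push_cast
    field_simp
    ring

end

/-! ### Triangles: their limits, winding numbers and position. -/

noncomputable section

/-- The segment from `p` to `q`, parametrized by `[0, 1]`. -/
def seg (p q : ℂ) (r : ℝ) : ℂ := p + r * (q - p)

lemma deriv_seg (p q : ℂ) (r : ℝ) : deriv (seg p q) r = q - p := by
  have h : HasDerivAt (seg p q) (1 * (q - p)) r :=
    (((hasDerivAt_id r).ofReal_comp).mul_const (q - p)).const_add p
  rw [h.deriv, one_mul]

lemma contDiff_seg (p q : ℂ) : ContDiff ℝ 1 (seg p q) := by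
  unfold seg
  have : ContDiff ℝ 1 (fun r : ℝ => (r : ℂ)) := Complex.ofRealCLM.contDiff
  fun_prop

lemma curveInt_seg (p q : ℂ) (f : ℂ → ℂ) :
    curveInt (seg p q) f = ∫ r in (0 : ℝ)..1, f (seg p q r) * (q - p) := by
  simp only [curveInt, deriv_seg]

lemma curveInt_seg_exact {p q : ℂ} {G G' : ℂ → ℂ} (hG' : ContinuousOn G' (seg p q '' Icc 0 1))
    (hG : ∀ w ∈ seg p q '' Icc 0 1, HasDerivAt G (G' w) w) :
    curveInt (seg p q) G' = G q - G p := by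
  have := integral_curve_piece zero_le_one (contDiff_seg p q).contDiffOn hG' hG
  simpa [seg, curveInt] using this

lemma curveInt_seg_symm (p q : ℂ) (f : ℂ → ℂ) : curveInt (seg q p) f = -curveInt (seg p q) f := by
  rw [curveInt_seg, curveInt_seg, ← intervalIntegral.integral_neg]
  have h := intervalIntegral.integral_comp_sub_left (a := 0) (b := 1)
    (fun r => f (seg p q r) * (p - q)) (1 : ℝ)
  simp only [sub_self, sub_zero] at h
  rw [← sub_eq_zero] at h ⊢
  rw [← h]
  congr 1
  · refine intervalIntegral.integral_congr fun r _ => ?_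
    simp only [seg]
    congr 2
    push_cast
    ring
  · refine intervalIntegral.integral_congr fun r _ => ?_
    ring

/-- The trace of the triangle with vertices `p, q, r`. -/
def triSet (p q r : ℂ) : Set ℂ := seg p q '' Icc 0 1 ∪ seg q r '' Icc 0 1 ∪ seg r p '' Icc 0 1

/-- The integral over the boundary of the triangle with vertices `p, q, r`. -/
def triInt (p q r : ℂ) (f : ℂ → ℂ) : ℂ :=
  curveInt (seg p q) f + curveInt (seg q r) f + curveInt (seg r p) f

lemma isCycle_triInt (p q r : ℂ) : IsCycle (triInt p q r) (triSet p q r) := by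
  have h1 : seg p q '' Icc 0 1 ⊆ triSet p q r := fun w hw => Or.inl (Or.inl hw)
  have h2 : seg q r '' Icc 0 1 ⊆ triSet p q r := fun w hw => Or.inl (Or.inr hw)
  have h3 : seg r p '' Icc 0 1 ⊆ triSet p q r := fun w hw => Or.inr hw
  have hint : ∀ (a b : ℂ) f, ContinuousOn f (seg a b '' Icc 0 1) →
      IntervalIntegrable (fun r => f (seg a b r) * deriv (seg a b) r) volume 0 1 :=
    fun a b f hf => intervalIntegrable_curve_piece zero_le_one (contDiff_seg a b).contDiffOn hf
  have hadd : ∀ (a b : ℂ) f g, ContinuousOn f (seg a b '' Icc 0 1) →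
      ContinuousOn g (seg a b '' Icc 0 1) →
      curveInt (seg a b) (fun w => f w + g w) = curveInt (seg a b) f + curveInt (seg a b) g := by
    intro a b f g hf hg
    simp only [curveInt, add_mul]
    exact intervalIntegral.integral_add (hint a b f hf) (hint a b g hg)
  have hcongr : ∀ (a b : ℂ) f g, EqOn f g (seg a b '' Icc 0 1) →
      curveInt (seg a b) f = curveInt (seg a b) g := by
    intro a b f g hfg
    refine intervalIntegral.integral_congr fun r hr => ?_
    rw [uIcc_of_le zero_le_one] at hr
    rw [hfg (mem_image_of_mem _ hr)]
  refine ⟨fun f g hf hg => ?_, fun c f => ?_, fun f g hfg => ?_, fun G G' hG' hG => ?_⟩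
  · simp only [triInt]
    rw [hadd _ _ _ _ (hf.mono h1) (hg.mono h1), hadd _ _ _ _ (hf.mono h2) (hg.mono h2),
      hadd _ _ _ _ (hf.mono h3) (hg.mono h3)]
    ring
  · simp only [triInt, curveInt, mul_assoc, intervalIntegral.integral_const_mul]
    ring
  · simp only [triInt]
    rw [hcongr _ _ _ _ (hfg.mono h1), hcongr _ _ _ _ (hfg.mono h2), hcongr _ _ _ _ (hfg.mono h3)]
  · simp only [triInt]
    rw [curveInt_seg_exact (hG'.mono h1) fun w hw => hG w (h1 hw),
      curveInt_seg_exact (hG'.mono h2) fun w hw => hG w (h2 hw),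
      curveInt_seg_exact (hG'.mono h3) fun w hw => hG w (h3 hw)]
    ring

section limit

lemma curveInt_seg_ray (p a : ℂ) (f : ℂ → ℂ) (R : ℝ) :
    curveInt (seg p (p + R * a)) f = ∫ r in (0 : ℝ)..R, f (p + r * a) * a := by
  have h := intervalIntegral.smul_integral_comp_mul_left (a := 0) (b := 1)
    (fun r : ℝ => f (p + r * a) * a) R
  rw [mul_zero, mul_one] at h
  rw [← h, curveInt_seg, ← intervalIntegral.integral_smul]
  refine intervalIntegral.integral_congr fun r _ => ?_
  simp only [seg, Complex.real_smul]
  push_cast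
  ring_nf

lemma integrableOn_ray {f : ℂ → ℂ} {p a : ℂ}
    (hf : ContinuousOn (fun r : ℝ => f (p + r * a)) (Ici 0)) {C β R₀ : ℝ} (hβ : 0 < β)
    (hbd : ∀ R ≥ R₀, ‖f (p + R * a)‖ ≤ C * Real.exp (-β * R ^ 2)) :
    IntegrableOn (fun r : ℝ => f (p + r * a)) (Ioi 0) := by
  have hle : (0 : ℝ) ≤ max R₀ 0 := le_max_right _ _
  rw [← Ioc_union_Ioi_eq_Ioi hle]
  refine IntegrableOn.union ?_ ?_
  · exact ((hf.mono Icc_subset_Ici_self).integrableOn_Icc).mono_set Ioc_subset_Icc_self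
  · have hs : Ioi (max R₀ 0) ⊆ Ici (0 : ℝ) := fun r hr => hle.trans (le_of_lt hr)
    refine ((integrable_exp_neg_mul_sq hβ).const_mul C).integrableOn.mono'
      ((hf.mono hs).aestronglyMeasurable measurableSet_Ioi) ?_
    filter_upwards [ae_restrict_mem measurableSet_Ioi] with r hr
    exact hbd r ((le_max_left _ _).trans (le_of_lt hr))

/-- Triangles with a fixed vertex exhaust the sector between two rays. -/
lemma tendsto_triInt {f : ℂ → ℂ} {p a b : ℂ}
    (hfa : ContinuousOn (fun r : ℝ => f (p + r * a)) (Ici 0))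
    (hfb : ContinuousOn (fun r : ℝ => f (p + r * b)) (Ici 0)) {C β R₀ : ℝ} (hβ : 0 < β)
    (hbd : ∀ R ≥ R₀, ∀ σ ∈ Icc (0 : ℝ) 1,
      ‖f (p + R * (a + σ * (b - a)))‖ ≤ C * Real.exp (-β * R ^ 2)) :
    Tendsto (fun R : ℝ => triInt p (p + R * a) (p + R * b) f) atTop
      (𝓝 (rayInt a (fun w => f (p + w)) - rayInt b (fun w => f (p + w)))) := by
  have hray : ∀ d : ℂ, IntegrableOn (fun r : ℝ => f (p + r * d)) (Ioi 0) →
      Tendsto (fun R : ℝ => curveInt (seg p (p + R * d)) f) atTop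
        (𝓝 (rayInt d fun w => f (p + w))) := by
    intro d hd
    simp only [curveInt_seg_ray, rayInt]
    exact intervalIntegral_tendsto_integral_Ioi 0 (hd.mul_const d) tendsto_id
  have ha := hray a (integrableOn_ray hfa hβ fun R hR => by
    simpa using hbd R hR 0 (by simp))
  have hb := hray b (integrableOn_ray hfb hβ fun R hR => by
    simpa using hbd R hR 1 (by simp))
  -- The far side has length of order `R`, against a Gaussian bound on the integrand.
  have hside : Tendsto (fun R : ℝ => curveInt (seg (p + R * a) (p + R * b)) f) atTop (𝓝 0) := by
    have h0 : Tendsto (fun R : ℝ => C * ‖b - a‖ * (R * Real.exp (-β * R ^ 2))) atTop (𝓝 0) := by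
      have h1 := (rpow_mul_exp_neg_mul_sq_isLittleO_exp_neg hβ 1).trans_tendsto
        (?_ : Tendsto (fun x => Real.exp (-(1 / 2) * x)) atTop (𝓝 0))
      · have h2 := h1.const_mul (C * ‖b - a‖)
        rw [mul_zero] at h2
        refine h2.congr fun R => ?_
        rw [Real.rpow_one]
      · exact Real.tendsto_exp_atBot.comp (tendsto_id.const_mul_atTop_of_neg (by norm_num))
    refine squeeze_zero_norm' ?_ h0
    filter_upwards [eventually_ge_atTop R₀, eventually_ge_atTop 0] with R hR hR0
    rw [curveInt_seg]
    have := intervalIntegral.norm_integral_le_of_norm_le_const (a := 0) (b := 1)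
      (f := fun r => f (seg (p + R * a) (p + R * b) r) * ((p + R * b) - (p + R * a)))
      (C := C * Real.exp (-β * R ^ 2) * (R * ‖b - a‖)) ?_
    · refine this.trans (le_of_eq ?_)
      simp
      ring
    · intro r hr
      rw [uIoc_of_le zero_le_one] at hr
      rw [norm_mul]
      refine mul_le_mul ?_ (le_of_eq ?_) (norm_nonneg _) ?_
      · have := hbd R hR r ⟨hr.1.le, hr.2⟩
        rwa [show p + R * (a + r * (b - a)) = seg (p + R * a) (p + R * b) r by
          simp only [seg]; ring] at this
      · rw [show p + R * b - (p + R * a) = R * (b - a) by ring, norm_mul, Complex.norm_real,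
          Real.norm_of_nonneg hR0]
      · exact (norm_nonneg _).trans (hbd R hR r ⟨hr.1.le, hr.2⟩)
  have := (ha.add hside).sub hb
  rw [add_zero] at this
  refine this.congr fun R => ?_
  rw [triInt, curveInt_seg_symm p (p + R * b)]
  ring

end limit

/-- The direction of the ray at angle `π / 6`. -/
def dirP : ℂ := ⟨Real.sqrt 3 / 2, 1 / 2⟩

/-- The direction of the ray at angle `-π / 6`. -/
def dirM : ℂ := ⟨Real.sqrt 3 / 2, -(1 / 2)⟩

@[simp] lemma dirP_re : dirP.re = Real.sqrt 3 / 2 := rfl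
@[simp] lemma dirP_im : dirP.im = 1 / 2 := rfl
@[simp] lemma dirM_re : dirM.re = Real.sqrt 3 / 2 := rfl
@[simp] lemma dirM_im : dirM.im = -(1 / 2) := rfl

section winding

lemma log_I_mul {w : ℂ} (hw : 0 < w.re) :
    Complex.log (Complex.I * w) = Real.pi / 2 * Complex.I + Complex.log w := by
  have hw0 : w ≠ 0 := by rintro rfl; simp at hw
  have h := abs_lt.mp (Complex.abs_arg_lt_pi_div_two_iff.mpr (Or.inl hw))
  have hpi := Real.pi_pos
  rw [Complex.log_mul Complex.I_ne_zero hw0, Complex.log_I]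
  rw [Complex.arg_I]
  constructor <;> linarith [h.1, h.2]

lemma log_neg_I_mul {w : ℂ} (hw : 0 < w.re) :
    Complex.log (-Complex.I * w) = -(Real.pi / 2) * Complex.I + Complex.log w := by
  have hw0 : w ≠ 0 := by rintro rfl; simp at hw
  have h := abs_lt.mp (Complex.abs_arg_lt_pi_div_two_iff.mpr (Or.inl hw))
  have hpi := Real.pi_pos
  rw [Complex.log_mul (neg_ne_zero.mpr Complex.I_ne_zero) hw0, Complex.log_neg_I, neg_mul]
  rw [Complex.arg_neg_I]
  constructor <;> linarith [h.1, h.2]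

lemma hasDerivAt_log_mul_sub {c w b : ℂ} (hc : c ≠ 0) (h : c * (w - b) ∈ Complex.slitPlane) :
    HasDerivAt (fun w => Complex.log (c * (w - b))) (1 / (w - b)) w := by
  have := (((hasDerivAt_id w).sub_const b).const_mul c).clog h
  refine this.congr_deriv ?_
  simp only [id, mul_one]
  have h1 := right_ne_zero_of_mul (Complex.slitPlane_ne_zero h)
  field_simp

lemma curveInt_seg_log {p q c b : ℂ} (hc : c ≠ 0)
    (h : ∀ r ∈ Icc (0 : ℝ) 1, c * (seg p q r - b) ∈ Complex.slitPlane) :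
    curveInt (seg p q) (fun w => 1 / (w - b)) = Complex.log (c * (q - b))
      - Complex.log (c * (p - b)) := by
  refine curveInt_seg_exact (G := fun w => Complex.log (c * (w - b))) ?_ ?_
  · refine continuousOn_const.div (by fun_prop) ?_
    rintro _ ⟨r, hr, rfl⟩
    exact right_ne_zero_of_mul (Complex.slitPlane_ne_zero (h r hr))
  · rintro _ ⟨r, hr, rfl⟩
    exact hasDerivAt_log_mul_sub hc (h r hr)

/-- The logarithms of `i(w-b)`, `w-b` and `-i(w-b)` are primitives on the three sides; converting
them to the principal branch costs four quarter turns, which add up to `2πi`. -/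
lemma triInt_winding {R b : ℝ} (hR : 0 < R) (hb : 0 < b) (hbR : b < R * (Real.sqrt 3 / 2)) :
    triInt 0 (R * dirM) (R * dirP) (fun w => 1 / (w - b)) = 2 * Real.pi * Complex.I := by
  rw [triInt, curveInt_seg_log Complex.I_ne_zero, curveInt_seg_log one_ne_zero,
    curveInt_seg_log (neg_ne_zero.mpr Complex.I_ne_zero)]
  · have h1 : Complex.log (-Complex.I * (0 - b)) = Real.pi / 2 * Complex.I + Complex.log b := by
      rw [← log_I_mul (by simpa using hb)]
      ring_nf
    have h2 : Complex.log (Complex.I * (0 - b)) = -(Real.pi / 2) * Complex.I + Complex.log b := by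
      rw [← log_neg_I_mul (by simpa using hb)]
      ring_nf
    rw [h1, h2, log_I_mul (w := R * dirM - b) (by simpa using hbR),
      log_neg_I_mul (w := R * dirP - b) (by simpa using hbR), one_mul, one_mul]
    ring
  · intro r hr
    rcases eq_or_lt_of_le hr.2 with rfl | hr1
    · right
      simp [seg, hb.ne']
    · left
      simp [seg]
      nlinarith [hr.1]
  · intro r hr
    left
    simp [seg]
    linarith
  · intro r hr
    rcases eq_or_lt_of_le hr.1 with rfl | hr1
    · right
      simp [seg, hb.ne']
    · left
      simp [seg]
      positivity

/-- The sign `c = ±1` treats the triangles to the right and to the left of `p` together. -/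
lemma curveInt_seg_affine {p a c : ℝ} (hc : c * c = 1) (A B : ℂ) :
    curveInt (seg (p + c * A) (p + c * B)) (fun w => 1 / (w - a))
      = curveInt (seg A B) (fun w => 1 / (w - (c * (a - p) : ℝ))) := by
  rw [curveInt_seg, curveInt_seg]
  refine intervalIntegral.integral_congr fun r _ => ?_
  simp only [seg]
  have hcC : (c : ℂ) * c = 1 := by exact_mod_cast hc
  have hc0 : (c : ℂ) ≠ 0 := left_ne_zero_of_mul (hcC ▸ one_ne_zero)
  have e1 : (p : ℂ) + c * A + r * (p + c * B - (p + c * A)) - a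
      = c * (A + r * (B - A) - (c * (a - p) : ℝ)) := by
    push_cast
    linear_combination ((a : ℂ) - p) * hcC
  rw [e1, show (p : ℂ) + c * B - (p + c * A) = c * (B - A) by ring, one_div_mul_eq_div,
    one_div_mul_eq_div, mul_div_mul_left _ _ hc0]

lemma triInt_winding_affine {p a c R : ℝ} (hc : c * c = 1) (hR : 0 < R) (ha : 0 < c * (a - p))
    (haR : c * (a - p) < R * (Real.sqrt 3 / 2)) :
    triInt p (p + R * (c * dirM)) (p + R * (c * dirP)) (fun w => 1 / (w - a))
      = 2 * Real.pi * Complex.I := by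
  rw [← triInt_winding hR ha haR, triInt, triInt, ← curveInt_seg_affine hc,
    ← curveInt_seg_affine hc, ← curveInt_seg_affine hc]
  simp only [mul_zero, add_zero, mul_left_comm (R : ℂ)]

/-- The first half places `p + iη` and the initial points on the other side of `p` outside the
triangle; the second keeps the trace away from the initial points. -/
lemma mem_triSet {p c R : ℝ} (hc : c * c = 1) (hR : 0 < R) {w : ℂ}
    (hw : w ∈ triSet p (p + R * (c * dirM)) (p + R * (c * dirP))) :
    (w = p ∨ 0 < c * (w.re - p)) ∧ (w.im = 0 → w = p ∨ c * (w.re - p) = R * (Real.sqrt 3 / 2)) := by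
  have h3 : 0 < Real.sqrt 3 := by positivity
  have hcne : c ≠ 0 := left_ne_zero_of_mul (hc ▸ one_ne_zero)
  have key : ∀ r : ℝ, c * (r * (R * (c * (Real.sqrt 3 / 2)))) = r * R * (Real.sqrt 3 / 2) :=
    fun r => by linear_combination r * R * (Real.sqrt 3 / 2) * hc
  have key1 : c * ((R * (c * (Real.sqrt 3 / 2)))) = R * (Real.sqrt 3 / 2) := by
    linear_combination R * (Real.sqrt 3 / 2) * hc
  rcases hw with (⟨r, hr, rfl⟩ | ⟨r, hr, rfl⟩) | ⟨r, hr, rfl⟩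
  · rcases eq_or_lt_of_le hr.1 with rfl | hr0
    · simp [seg]
    · have hre : c * ((seg p (p + R * (c * dirM)) r).re - p) = r * R * (Real.sqrt 3 / 2) := by
        simp [seg, key]
      refine ⟨Or.inr (hre ▸ by positivity), fun him => ?_⟩
      simp [seg, hr0.ne', hR.ne', hcne] at him
  · have hre : c * ((seg (p + R * (c * dirM)) (p + R * (c * dirP)) r).re - p)
        = R * (Real.sqrt 3 / 2) := by
      simp [seg, key1]
    exact ⟨Or.inr (hre ▸ by positivity), fun _ => Or.inr hre⟩
  · rcases eq_or_lt_of_le hr.2 with rfl | hr1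
    · simp [seg]
    · have hr0 : 0 < 1 - r := by linarith
      have hw : seg (p + R * (c * dirP)) p r = p + (1 - r : ℝ) * (R * (c * dirP)) := by
        simp only [seg]; push_cast; ring
      rw [hw]
      have hre : c * ((p + (1 - r : ℝ) * (R * (c * dirP))).re - p)
          = (1 - r) * R * (Real.sqrt 3 / 2) := by
        simp only [Complex.add_re, Complex.ofReal_re, Complex.re_ofReal_mul, dirP_re, add_sub_cancel_left, key]
      refine ⟨Or.inr (hre ▸ by positivity), fun him => ?_⟩
      simp only [Complex.add_im, Complex.ofReal_im, Complex.im_ofReal_mul, dirP_im, zero_add] at him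
      have : (1 - r) * (R * (c * (1 / 2))) ≠ 0 := by positivity
      exact absurd him this

end winding

end

/-! ### The wedge contour. -/

noncomputable section

lemma one_le_norm_nodal_of_forall {s : Multiset ℂ} {z : ℂ} (h : ∀ a ∈ s, 1 ≤ ‖z - a‖) :
    1 ≤ ‖nodal s z‖ := by
  induction s using Multiset.induction_on with
  | empty => simp
  | cons a q ih =>
    rw [nodal_cons, norm_mul]
    exact one_le_mul_of_one_le_of_one_le (h a (by simp)) (ih fun b hb => h b (by simp [hb]))

/-- The integral over the contour made of the four rays at angles `±π / 6` and `±5π / 6`, oriented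
counterclockwise around the two sectors containing the real half-lines. -/
def wedgeInt (f : ℂ → ℂ) : ℂ :=
  rayInt dirM f + rayInt (-dirM) f - rayInt dirP f - rayInt (-dirP) f

section wedge

variable {n : ℕ} {X : Fin n → ℝ} {p x b η : ℝ}

/-- The integrand of the residue formula. -/
def resolventGauss (X : Fin n → ℝ) (x b : ℝ) (z w : ℂ) : ℂ :=
  Complex.exp (-(b : ℂ) * (w - x) ^ 2) / (nodal (points X) w * (z - w))

/-- Relative to `p`, the squared real part is `3R²/4` and the squared imaginary part at most `R²/4`.
Of the remaining `R²/2` one half absorbs the cross term with `p - x`. -/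
lemma norm_gauss_le (hb : 0 < b) {c R σ : ℝ} (hc : c * c = 1) (hσ : σ ∈ Icc (0 : ℝ) 1) :
    ‖Complex.exp (-(b : ℂ) * ((p + R * (c * dirM + σ * (c * dirP - c * dirM)) : ℂ) - x) ^ 2)‖
      ≤ Real.exp (b * (2 * (p - x) ^ 2)) * Real.exp (-(b / 4) * R ^ 2) := by
  rw [Complex.norm_exp, ← Real.exp_add]
  refine Real.exp_le_exp.mpr ?_
  set w : ℂ := (p + R * (c * dirM + σ * (c * dirP - c * dirM)) : ℂ) - x with hw
  have hre : w.re = (p - x) + R * c * (Real.sqrt 3 / 2) := by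
    simp [w]; ring
  have him : w.im = R * c * (σ - 1 / 2) := by
    simp [w]; ring
  have h2 : (-(b : ℂ) * w ^ 2).re = -b * (w.re ^ 2 - w.im ^ 2) := by
    simp [pow_two]
  rw [h2, hre, him]
  have h3 : Real.sqrt 3 ^ 2 = 3 := Real.sq_sqrt (by norm_num)
  have e1 : ((p - x) + R * c * (Real.sqrt 3 / 2)) ^ 2 - (R * c * (σ - 1 / 2)) ^ 2
      = (p - x) ^ 2 + (p - x) * R * c * Real.sqrt 3 + 3 / 4 * R ^ 2 - R ^ 2 * (σ - 1 / 2) ^ 2 := by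
    linear_combination (R ^ 2 * (Real.sqrt 3) ^ 2 / 4 - R ^ 2 * (σ - 1 / 2) ^ 2) * hc
      + R ^ 2 / 4 * h3
  have e2 : 0 ≤ (R / 2 + c * Real.sqrt 3 * (p - x)) ^ 2 := sq_nonneg _
  have e3 : (R / 2 + c * Real.sqrt 3 * (p - x)) ^ 2
      = R ^ 2 / 4 + (p - x) * R * c * Real.sqrt 3 + 3 * (p - x) ^ 2 := by
    linear_combination (Real.sqrt 3 ^ 2 * (p - x) ^ 2) * hc + (p - x) ^ 2 * h3
  have e4 : (σ - 1 / 2) ^ 2 ≤ 1 / 4 := by nlinarith [hσ.1, hσ.2]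
  have e5 : R ^ 2 * (σ - 1 / 2) ^ 2 ≤ R ^ 2 * (1 / 4) := mul_le_mul_of_nonneg_left e4 (sq_nonneg R)
  rw [e1]
  nlinarith

/-- The lower bound on `R` puts `w` at distance at least `1` from `z` and from all initial points,
so the denominator can be dropped. -/
lemma norm_resolventGauss_le (hb : 0 < b) {c R σ : ℝ} (hc : c * c = 1) (hσ : σ ∈ Icc (0 : ℝ) 1)
    (hR : 2 * (∑ j, |X j - p| + 1) ≤ R) :
    ‖resolventGauss X x b (p + η * Complex.I) (p + R * (c * dirM + σ * (c * dirP - c * dirM)))‖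
      ≤ Real.exp (b * (2 * (p - x) ^ 2)) * Real.exp (-(b / 4) * R ^ 2) := by
  set w : ℂ := p + R * (c * dirM + σ * (c * dirP - c * dirM)) with hw
  have hre : w.re - p = R * c * (Real.sqrt 3 / 2) := by
    simp [w]; ring
  have hc1 : |c| = 1 := by
    rcases mul_self_eq_one_iff.mp hc with rfl | rfl <;> simp
  have hsum : 0 ≤ ∑ j, |X j - p| := Finset.sum_nonneg fun j _ => abs_nonneg _
  have hR0 : 0 ≤ R := by linarith
  have h3 : 1 ≤ Real.sqrt 3 := Real.one_le_sqrt.mpr (by norm_num)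
  have habs : ∑ j, |X j - p| + 1 ≤ |w.re - p| := by
    rw [hre, abs_mul, abs_mul, hc1, abs_of_nonneg hR0, abs_of_nonneg (by positivity)]
    nlinarith
  have hnod : 1 ≤ ‖nodal (points X) w‖ := by
    refine one_le_norm_nodal_of_forall fun a ha => ?_
    obtain ⟨j, rfl⟩ := mem_points.mp ha
    have h1 := Complex.abs_re_le_norm (w - X j)
    rw [Complex.sub_re, Complex.ofReal_re] at h1
    have h2 : |X j - p| ≤ ∑ j, |X j - p| :=
      Finset.single_le_sum (f := fun j => |X j - p|) (fun j _ => abs_nonneg _) (Finset.mem_univ j)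
    have h4 := abs_sub_le w.re (X j) p
    linarith
  have hz : 1 ≤ ‖(p + η * Complex.I : ℂ) - w‖ := by
    have h1 := Complex.abs_re_le_norm ((p + η * Complex.I : ℂ) - w)
    have h2 : ((p + η * Complex.I : ℂ) - w).re = -(w.re - p) := by simp
    rw [h2, abs_neg] at h1
    linarith
  rw [resolventGauss, norm_div, norm_mul]
  exact (div_le_self (norm_nonneg _) (one_le_mul_of_one_le_of_one_le hnod hz)).trans
    (norm_gauss_le hb hc hσ)

lemma continuousOn_resolventGauss_ray (hX : ∀ j, X j ≠ p) (hη : η ≠ 0) {d : ℂ} (hd : d.im ≠ 0)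
    (hd' : d.re ≠ 0) :
    ContinuousOn (fun r : ℝ => resolventGauss X x b (p + η * Complex.I) (p + r * d)) (Ici 0) := by
  have hc := (differentiable_nodal (points X)).continuous
  refine ContinuousOn.div (by fun_prop) (by fun_prop) fun r hr => mul_ne_zero ?_ ?_
  · refine nodal_ne_zero fun h => ?_
    obtain ⟨j, hj⟩ := mem_points.mp h
    have him := congrArg Complex.im hj
    have hre := congrArg Complex.re hj
    rcases eq_or_ne r 0 with rfl | hr0
    · simp at hre
      exact hX j hre
    · simp [hr0, hd] at him
  · intro h
    have him := congrArg Complex.im h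
    have hre := congrArg Complex.re h
    rcases eq_or_ne r 0 with rfl | hr0
    · simp [hη] at him
    · simp [hr0, hd'] at hre

lemma tendsto_triInt_resolventGauss (hX : ∀ j, X j ≠ p) (hη : η ≠ 0) (hb : 0 < b) {c : ℝ}
    (hc : c * c = 1) :
    Tendsto (fun R : ℝ => triInt p (p + R * (c * dirM)) (p + R * (c * dirP))
        (resolventGauss X x b (p + η * Complex.I))) atTop
      (𝓝 (rayInt (c * dirM) (fun w => resolventGauss X x b (p + η * Complex.I) (p + w))
        - rayInt (c * dirP) (fun w => resolventGauss X x b (p + η * Complex.I) (p + w)))) := by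
  have hcne : c ≠ 0 := left_ne_zero_of_mul (hc ▸ one_ne_zero)
  exact tendsto_triInt (continuousOn_resolventGauss_ray hX hη (by simp [hcne]) (by simp [hcne]))
    (continuousOn_resolventGauss_ray hX hη (by simp [hcne]) (by simp [hcne])) (by positivity)
    fun R hR σ hσ => norm_resolventGauss_le hb hc hσ hR

lemma sub_mem_slitPlane_of_mem_triSet {c R : ℝ} (hc : c * c = 1) (hR : 0 < R) (hη : η ≠ 0)
    {w : ℂ} (hw : w ∈ triSet p (p + R * (c * dirM)) (p + R * (c * dirP))) :
    (c : ℂ) * (w - (p + η * Complex.I)) ∈ Complex.slitPlane := by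
  have hcne : c ≠ 0 := left_ne_zero_of_mul (hc ▸ one_ne_zero)
  rcases (mem_triSet hc hR hw).1 with rfl | h
  · right
    simp [hη, hcne]
  · left
    simpa using h

lemma triInt_one_div_eq_zero {c R : ℝ} (hc : c * c = 1) {z : ℂ}
    (h : ∀ w ∈ triSet p (p + R * (c * dirM)) (p + R * (c * dirP)),
      (c : ℂ) * (w - z) ∈ Complex.slitPlane) :
    triInt p (p + R * (c * dirM)) (p + R * (c * dirP)) (fun w => 1 / (w - z)) = 0 := by
  refine (isCycle_triInt _ _ _).one_div_eq_zero_of_slitPlane ?_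
  rcases mul_self_eq_one_iff.mp hc with rfl | rfl
  · left
    intro w hw
    simpa using h w hw
  · right
    intro w hw
    simpa using h w hw

lemma notMem_triSet {c R a : ℝ} (hc : c * c = 1) (hR : 0 < R) (ha : a ≠ p)
    (haR : |a - p| < R * (Real.sqrt 3 / 2)) :
    (a : ℂ) ∉ triSet p (p + R * (c * dirM)) (p + R * (c * dirP)) := by
  intro hw
  rcases (mem_triSet hc hR hw).2 (by simp) with h | h
  · exact ha (by exact_mod_cast h)
  · have hc1 : |c| = 1 := by
      rcases mul_self_eq_one_iff.mp hc with rfl | rfl <;> simp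
    have : c * (a - p) ≤ |a - p| := (le_abs_self _).trans (by rw [abs_mul, hc1, one_mul])
    simp only [Complex.ofReal_re] at h
    linarith

lemma triInt_eq_zero_of_neg {c R a : ℝ} (hc : c * c = 1) (hR : 0 < R) (ha : c * (a - p) < 0) :
    triInt p (p + R * (c * dirM)) (p + R * (c * dirP)) (fun w => 1 / (w - a)) = 0 := by
  refine triInt_one_div_eq_zero hc fun w hw => Or.inl ?_
  have h : (((c : ℝ) : ℂ) * (w - (a : ℂ))).re = c * (w.re - p) - c * (a - p) := by
    simp; ring
  rw [h]
  rcases (mem_triSet hc hR hw).1 with rfl | h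
  · simpa using ha
  · linarith

/-- The wedge contour computes the same residues as every admissible contour. -/
theorem wedgeInt_resolventGauss (hX : ∀ j, X j ≠ p) (hb : 0 < b) (hη : η ≠ 0) {e : ℂ → ℂ}
    (hcyc : ∀ (I : (ℂ → ℂ) → ℂ) (K : Set ℂ), IsCycle I K → (∀ a ∈ points X, WindsOnce I K a) →
        ∀ z ∉ K, z ∉ points X → I (fun w => 1 / (w - z)) = 0 →
          I (resolventGauss X x b z) = 2 * Real.pi * Complex.I *
            (Complex.exp (-(b : ℂ) * (z - x) ^ 2) / nodal (points X) z - e z)) :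
    wedgeInt (fun w => resolventGauss X x b (p + η * Complex.I) (p + w))
      = 2 * Real.pi * Complex.I * (Complex.exp (-(b : ℂ) * ((p + η * Complex.I : ℂ) - x) ^ 2)
          / nodal (points X) (p + η * Complex.I) - e (p + η * Complex.I)) := by
  set z : ℂ := p + η * Complex.I with hz
  have hone : (1 : ℝ) * 1 = 1 := by norm_num
  have hmone : (-1 : ℝ) * (-1) = 1 := by norm_num
  have hl := (tendsto_triInt_resolventGauss (x := x) hX hη hb hone).add
    (tendsto_triInt_resolventGauss (x := x) hX hη hb hmone)
  -- For large `R` the two triangles together wind once around each initial point and not at all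
  -- around `z`. Hence `hcyc` gives their exact value, independent of `R`, and the limit along the
  -- wedge inherits it.
  have hval : ∀ᶠ R : ℝ in atTop,
      triInt p (p + R * ((1 : ℝ) * dirM)) (p + R * ((1 : ℝ) * dirP)) (resolventGauss X x b z)
      + triInt p (p + R * ((-1 : ℝ) * dirM)) (p + R * ((-1 : ℝ) * dirP)) (resolventGauss X x b z)
      = 2 * Real.pi * Complex.I * (Complex.exp (-(b : ℂ) * (z - x) ^ 2)
          / nodal (points X) z - e z) := by
    filter_upwards [eventually_ge_atTop (2 * (∑ j, |X j - p| + 1))] with R hR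
    have hsum : 0 ≤ ∑ j, |X j - p| := Finset.sum_nonneg fun j _ => abs_nonneg _
    have hR0 : 0 < R := by linarith
    have h3 : 1 ≤ Real.sqrt 3 := Real.one_le_sqrt.mpr (by norm_num)
    have hXR : ∀ j, |X j - p| < R * (Real.sqrt 3 / 2) := by
      intro j
      have h2 : |X j - p| ≤ ∑ j, |X j - p| :=
        Finset.single_le_sum (f := fun j => |X j - p|) (fun j _ => abs_nonneg _)
          (Finset.mem_univ j)
      nlinarith
    have hslit := fun (c : ℝ) (hc : c * c = 1) (w : ℂ) hw =>
      sub_mem_slitPlane_of_mem_triSet (p := p) (w := w) hc hR0 hη hw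
    have hzK : ∀ c : ℝ, c * c = 1 → z ∉ triSet p (p + R * (c * dirM)) (p + R * (c * dirP)) := by
      intro c hc hzK
      have := Complex.slitPlane_ne_zero (hslit c hc z hzK)
      simp [z] at this
    have hI := IsCycle.sum (K := triSet p (p + R * ((1 : ℝ) * dirM)) (p + R * ((1 : ℝ) * dirP))
        ∪ triSet p (p + R * ((-1 : ℝ) * dirM)) (p + R * ((-1 : ℝ) * dirP))) Finset.univ
        (J := ![triInt p (p + R * ((1 : ℝ) * dirM)) (p + R * ((1 : ℝ) * dirP)),
          triInt p (p + R * ((-1 : ℝ) * dirM)) (p + R * ((-1 : ℝ) * dirP))]) ?_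
    · simp only [Fin.sum_univ_two, Matrix.cons_val_zero, Matrix.cons_val_one] at hI
      refine hcyc _ _ hI ?_ z ?_ ?_ ?_
      · intro a ha
        obtain ⟨j, rfl⟩ := mem_points.mp ha
        refine ⟨fun h => h.elim (notMem_triSet hone hR0 (hX j) (hXR j))
          (notMem_triSet hmone hR0 (hX j) (hXR j)), ?_⟩
        beta_reduce
        rcases lt_or_gt_of_ne (hX j) with h | h
        · rw [triInt_eq_zero_of_neg hone hR0 (by linarith),
            triInt_winding_affine hmone hR0 (by linarith), zero_add]
          have := neg_le_abs (X j - p)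
          linarith [hXR j]
        · rw [triInt_eq_zero_of_neg hmone hR0 (by linarith),
            triInt_winding_affine hone hR0 (by linarith), add_zero]
          have := le_abs_self (X j - p)
          linarith [hXR j]
      · exact fun h => h.elim (hzK 1 hone) (hzK (-1) hmone)
      · intro h
        obtain ⟨j, hj⟩ := mem_points.mp h
        have := congrArg Complex.im hj
        simp [z] at this
        exact hη this.symm
      · rw [triInt_one_div_eq_zero hone (hslit 1 hone),
          triInt_one_div_eq_zero hmone (hslit (-1) hmone), add_zero]
    · intro i _
      fin_cases i
      · exact (isCycle_triInt _ _ _).mono subset_union_left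
      · exact (isCycle_triInt _ _ _).mono subset_union_right
  have := tendsto_nhds_unique (hl.congr' hval) tendsto_const_nhds
  rw [← this, wedgeInt]
  push_cast
  simp only [one_mul, neg_mul]
  ring

end wedge

end

/-! ### Phase functions on the steep lines. -/

noncomputable section

/-- `ω` lies on one of the lines through the origin along which the phase functions are
monotone: `σ = -1` for the imaginary axis, `σ = 1` for the lines at angles `±π / 6`. -/
structure IsSteep (σ : ℝ) (ω : ℂ) : Prop where
  abs : |σ| = 1
  cube : (ω ^ 3).re = 0
  sq : ‖ω‖ ^ 2 / 2 ≤ σ * (ω ^ 2).re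
  fourth : σ * (ω ^ 4).re ≤ -(‖ω‖ ^ 4 / 2)
  im : ‖ω‖ ≤ 2 * |ω.im|

lemma IsSteep.mul_real {σ : ℝ} {ω : ℂ} (h : IsSteep σ ω) (b : ℝ) : IsSteep σ (b * ω) where
  abs := h.abs
  cube := by
    rw [mul_pow, ← Complex.ofReal_pow, Complex.re_ofReal_mul, h.cube, mul_zero]
  sq := by
    rw [mul_pow, ← Complex.ofReal_pow, Complex.re_ofReal_mul, norm_mul, mul_pow,
      Complex.norm_real, Real.norm_eq_abs, sq_abs]
    have := mul_le_mul_of_nonneg_left h.sq (sq_nonneg b)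
    linarith
  fourth := by
    rw [mul_pow, ← Complex.ofReal_pow, Complex.re_ofReal_mul, norm_mul, mul_pow,
      Complex.norm_real, Real.norm_eq_abs, show |b| ^ 4 = b ^ 4 from (by decide : Even 4).pow_abs b]
    have := mul_le_mul_of_nonneg_left h.fourth (by positivity : 0 ≤ b ^ 4)
    linarith
  im := by
    rw [Complex.im_ofReal_mul, norm_mul, abs_mul, Complex.norm_real, Real.norm_eq_abs]
    have := mul_le_mul_of_nonneg_left h.im (abs_nonneg b)
    linarith

lemma isSteep_I (r : ℝ) : IsSteep (-1) (r * Complex.I) := by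
  refine IsSteep.mul_real (⟨by simp, ?_, ?_, ?_, ?_⟩) r
  · simp [pow_succ]
  · simp
    norm_num
  · simp [Complex.I_pow_four]
    norm_num
  · simp

lemma isSteep_of_sq {d : ℂ} (hre : d.re ^ 2 = 3 / 4) (him : d.im ^ 2 = 1 / 4) : IsSteep 1 d := by
  have hn : ‖d‖ ^ 2 = 1 := by
    rw [Complex.sq_norm, Complex.normSq_apply]
    linarith
  have hn1 : ‖d‖ = 1 := by
    nlinarith [norm_nonneg d]
  refine ⟨by simp, ?_, ?_, ?_, ?_⟩
  · simp only [pow_succ, pow_zero, one_mul, Complex.mul_re, Complex.mul_im]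
    linear_combination d.re * (hre - 3 * him)
  · rw [hn, pow_two, Complex.mul_re]
    linarith
  · rw [hn1, show d ^ 4 = d ^ 2 * d ^ 2 by ring, Complex.mul_re, pow_two, Complex.mul_re,
      Complex.mul_im]
    nlinarith
  · rw [hn1]
    have : |d.im| = 1 / 2 := by
      rw [← Real.sqrt_sq_eq_abs, him, Real.sqrt_eq_iff_mul_self_eq] <;> norm_num
    rw [this]
    norm_num

section log

variable {u : ℂ}

lemma one_add_mem_slitPlane (hu : ‖u‖ ≤ 2 * |u.im|) : 1 + u ∈ Complex.slitPlane := by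
  rcases eq_or_ne u 0 with rfl | h0
  · simp
  · right
    have : 0 < ‖u‖ := norm_pos_iff.mpr h0
    have : 0 < |u.im| := by linarith
    simpa using abs_pos.mp this

/-- Lines through `0` at angle at least `π/6` to the real axis pass `-1` at distance at least `sin
(π/6)`. -/
lemma half_le_norm_one_add (hu : ‖u‖ ≤ 2 * |u.im|) : 1 / 2 ≤ ‖1 + u‖ := by
  have h1 : ‖1 + u‖ ^ 2 = (1 + u.re) ^ 2 + u.im ^ 2 := by
    rw [Complex.sq_norm, Complex.normSq_apply]
    simp
    ring
  have h2 : ‖u‖ ^ 2 = u.re ^ 2 + u.im ^ 2 := by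
    rw [Complex.sq_norm, Complex.normSq_apply]
    ring
  have h3 : ‖u‖ ^ 2 ≤ 4 * u.im ^ 2 := by
    rw [← sq_abs u.im]
    nlinarith [norm_nonneg u]
  have h4 : (1 / 2) ^ 2 ≤ ‖1 + u‖ ^ 2 := by
    rw [h1]
    nlinarith [sq_nonneg (u.re + 3 / 4)]
  exact le_of_sq_le_sq h4 (norm_nonneg _)

lemma norm_smul_le_im (hu : ‖u‖ ≤ 2 * |u.im|) (s : ℝ) : ‖s * u‖ ≤ 2 * |(s * u).im| := by
  rw [Complex.im_ofReal_mul, norm_mul, abs_mul, Complex.norm_real, Real.norm_eq_abs]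
  have := mul_le_mul_of_nonneg_left hu (abs_nonneg s)
  linarith

lemma hasDerivAt_log_one_add_mul (hu : ‖u‖ ≤ 2 * |u.im|) (s : ℝ) :
    HasDerivAt (fun s : ℝ => Complex.log (1 + s * u)) (u / (1 + s * u)) s := by
  have h1 : HasDerivAt (fun s : ℝ => 1 + (s : ℂ) * u) u s := by
    simpa using (((hasDerivAt_id s).ofReal_comp).mul_const u).const_add 1
  exact h1.clog_real (one_add_mem_slitPlane (norm_smul_le_im hu s))

/-- Taylor expansion of the logarithm, globally on a sector away from the negative axis. -/
lemma norm_log_one_add_sub_le (hu : ‖u‖ ≤ 2 * |u.im|) :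
    ‖Complex.log (1 + u) - (u - u ^ 2 / 2 + u ^ 3 / 3 - u ^ 4 / 4)‖ ≤ 2 * ‖u‖ ^ 5 := by
  set f : ℝ → ℂ := fun s => Complex.log (1 + s * u)
    - (s * u - (s * u) ^ 2 / 2 + (s * u) ^ 3 / 3 - (s * u) ^ 4 / 4) with hf
  have hne : ∀ s : ℝ, 1 + s * u ≠ 0 := fun s =>
    Complex.slitPlane_ne_zero (one_add_mem_slitPlane (norm_smul_le_im hu s))
  -- The remainder is differentiated along `s ↦ su`. Because `|1 + su| ≥ 1/2` holds on the whole
  -- sector, no smallness of `u` is required.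
  have hd : ∀ s : ℝ, HasDerivAt f (s ^ 4 * u ^ 5 / (1 + s * u)) s := by
    intro s
    have h0 : HasDerivAt (fun s : ℝ => (s : ℂ) * u) u s := by
      simpa using ((hasDerivAt_id s).ofReal_comp).mul_const u
    have h1 := (hasDerivAt_log_one_add_mul hu s).sub
      (((h0.sub ((h0.pow 2).div_const 2)).add ((h0.pow 3).div_const 3)).sub
        ((h0.pow 4).div_const 4))
    refine h1.congr_deriv ?_
    rw [eq_div_iff (hne s), sub_mul, div_mul_cancel₀ _ (hne s)]
    push_cast
    ring
  have := norm_image_sub_le_of_norm_deriv_le_segment_01' (f := f) (C := 2 * ‖u‖ ^ 5)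
    (fun s _ => (hd s).hasDerivWithinAt) ?_
  · simpa [hf] using this
  · intro s hs
    rw [norm_div, norm_mul, norm_pow, norm_pow, Complex.norm_real, Real.norm_of_nonneg hs.1]
    have h1 := half_le_norm_one_add (norm_smul_le_im hu s)
    rw [div_le_iff₀ (by linarith)]
    have h2 : s ^ 4 ≤ 1 := pow_le_one₀ hs.1 hs.2.le
    have h3 : 0 ≤ ‖u‖ ^ 5 := by positivity
    calc s ^ 4 * ‖u‖ ^ 5 ≤ 1 * ‖u‖ ^ 5 := by gcongr
      _ = 2 * ‖u‖ ^ 5 * (1 / 2) := by ring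
      _ ≤ _ := by gcongr

/-- Global descent along the steep lines. -/
lemma IsSteep.le_re_log {σ : ℝ} (h : IsSteep σ u) :
    ‖u‖ ^ 4 / (16 * (1 + ‖u‖ ^ 2)) ≤ σ * (Complex.log (1 + u) - u + u ^ 2 / 2).re := by
  set ρ := ‖u‖ with hρ
  -- The `16` collects the `4` from differentiating `s⁴`, the `1/2` in `IsSteep.sq` and the bound
  -- `|1+su|² ≤ 2(1+ρ²)`.
  set c : ℝ := ρ ^ 4 / (16 * (1 + ρ ^ 2)) with hc
  have hne : ∀ s : ℝ, 1 + s * u ≠ 0 := fun s =>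
    Complex.slitPlane_ne_zero (one_add_mem_slitPlane (norm_smul_le_im h.im s))
  have hd : ∀ s : ℝ, HasDerivAt (fun s : ℝ => σ * (Complex.log (1 + s * u) - s * u
      + (s * u) ^ 2 / 2).re - c * s ^ 4)
      (σ * ((s : ℂ) ^ 2 * u ^ 3 / (1 + s * u)).re - c * (4 * s ^ 3)) s := by
    intro s
    have h0 : HasDerivAt (fun s : ℝ => (s : ℂ) * u) u s := by
      simpa using ((hasDerivAt_id s).ofReal_comp).mul_const u
    have h1 := ((hasDerivAt_log_one_add_mul h.im s).sub h0).add ((h0.fun_pow 2).div_const 2)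
    have h2 : HasDerivAt (fun s : ℝ => (Complex.log (1 + s * u) - s * u + (s * u) ^ 2 / 2).re)
        ((s : ℂ) ^ 2 * u ^ 3 / (1 + s * u)).re s := by
      have h3 := (Complex.reCLM.hasFDerivAt.comp_hasDerivAt s h1)
      refine h3.congr_deriv ?_
      simp only [Complex.reCLM_apply]
      congr 1
      rw [eq_div_iff (hne s), add_mul, sub_mul, div_mul_cancel₀ _ (hne s)]
      push_cast
      ring
    have h4 : HasDerivAt (fun s : ℝ => c * s ^ 4) (c * (4 * s ^ 3)) s := by
      simpa using (hasDerivAt_pow 4 s).const_mul c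
    exact (h2.const_mul σ).sub h4
  have hmono : MonotoneOn (fun s : ℝ => σ * (Complex.log (1 + s * u) - s * u
      + (s * u) ^ 2 / 2).re - c * s ^ 4) (Icc 0 1) := by
    refine monotoneOn_of_deriv_nonneg (convex_Icc 0 1)
      (fun s _ => (hd s).continuousAt.continuousWithinAt)
      (fun s _ => (hd s).differentiableAt.differentiableWithinAt) fun s hs => ?_
    rw [interior_Icc] at hs
    rw [(hd s).deriv, sub_nonneg]
    have hN : 0 < Complex.normSq (1 + s * u) := Complex.normSq_pos.mpr (hne s)
    have hN2 : Complex.normSq (1 + s * u) ≤ 2 * (1 + ρ ^ 2) := by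
      rw [← Complex.sq_norm]
      have h1 : ‖1 + s * u‖ ≤ 1 + ρ := by
        refine (norm_add_le _ _).trans ?_
        rw [norm_one, norm_mul, Complex.norm_real, Real.norm_of_nonneg hs.1.le]
        have : s * ‖u‖ ≤ 1 * ρ := mul_le_mul_of_nonneg_right hs.2.le (norm_nonneg u)
        linarith
      nlinarith [norm_nonneg (1 + s * u), sq_nonneg (1 - ρ)]
    -- The numerator times the conjugate of `1 + su` is `s²(u³ + s|u|²u²)`, and `u³` has no real
    -- part. The sign is thus that of `Re (u²)`, the same for `u` and `-u`.
    have hre : ((s : ℂ) ^ 2 * u ^ 3 / (1 + s * u)).re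
        = s ^ 3 * ρ ^ 2 * (u ^ 2).re / Complex.normSq (1 + s * u) := by
      rw [mul_div_assoc, ← Complex.ofReal_pow, Complex.re_ofReal_mul, Complex.div_re]
      have hcube := h.cube
      have hsq : ρ ^ 2 = u.re ^ 2 + u.im ^ 2 := by
        rw [hρ, Complex.sq_norm, Complex.normSq_apply]
        ring
      have e : (u ^ 3).re * (1 + s * u).re + (u ^ 3).im * (1 + s * u).im
          = s * ρ ^ 2 * (u ^ 2).re := by
        rw [hsq, hcube]
        simp only [pow_succ, pow_zero, one_mul, Complex.mul_re, Complex.mul_im, Complex.add_im,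
          Complex.ofReal_re, Complex.ofReal_im, Complex.one_im] at hcube ⊢
        linear_combination (-(s * u.re)) * hcube
      rw [← add_div, e]
      ring
    rw [hre]
    have hsq := h.sq
    have hpos : 0 ≤ ρ := norm_nonneg u
    have hs0 := hs.1
    have e1 : σ * (s ^ 3 * ρ ^ 2 * (u ^ 2).re / Complex.normSq (1 + s * u))
        = s ^ 3 * ρ ^ 2 * (σ * (u ^ 2).re) / Complex.normSq (1 + s * u) := by ring
    rw [e1]
    calc c * (4 * s ^ 3) = s ^ 3 * ρ ^ 2 * (ρ ^ 2 / 2) / (2 * (1 + ρ ^ 2)) := by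
          rw [hc]; field_simp; ring
      _ ≤ s ^ 3 * ρ ^ 2 * (σ * (u ^ 2).re) / (2 * (1 + ρ ^ 2)) := by gcongr
      _ ≤ s ^ 3 * ρ ^ 2 * (σ * (u ^ 2).re) / Complex.normSq (1 + s * u) := by
          refine div_le_div_of_nonneg_left ?_ hN hN2
          exact mul_nonneg (by positivity) (le_trans (by positivity) hsq)
  have := hmono (left_mem_Icc.mpr zero_le_one) (right_mem_Icc.mpr zero_le_one) zero_le_one
  simp only [Complex.ofReal_zero, zero_mul, add_zero, Complex.log_one, sub_zero, Complex.ofReal_one,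
    one_mul, one_pow, mul_one] at this
  simpa using this

end log

/-- The phase function of the kernel in the local variable. -/
def phase {n : ℕ} (b : Fin n → ℝ) (c₂ c₁ c₀ : ℝ) (ζ : ℂ) : ℂ :=
  c₂ * ζ ^ 2 - c₁ * ζ + c₀ + ∑ j, Complex.log (1 + b j * ζ)

/-- The phase function of the Pearcey kernel. -/
def pearceyPhase (τ v : ℝ) (ζ : ℂ) : ℂ := -(ζ ^ 4 / 4) - τ * ζ ^ 2 / 2 - v * ζ

/-- The phase function with parameters `b, c₂, c₁, c₀` is `δ`-close to the Pearcey phase function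
with parameters `τ, v`. -/
structure PhaseClose {n : ℕ} (b : Fin n → ℝ) (c₂ c₁ c₀ τ v δ : ℝ) : Prop where
  c0 : |c₀| ≤ δ
  s1 : |∑ j, b j - c₁ + v| ≤ δ
  s2 : |c₂ - (∑ j, b j ^ 2) / 2 + τ / 2| ≤ δ
  s3 : |∑ j, b j ^ 3| ≤ δ
  s4 : |∑ j, b j ^ 4 - 1| ≤ δ
  s5 : ∑ j, |b j| ^ 5 ≤ δ

section phase

variable {n : ℕ} {b : Fin n → ℝ} {c₂ c₁ c₀ τ v δ : ℝ}

/-- Coefficients are compared up to degree four; the fifth absolute power sum controls the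
logarithmic remainders. -/
lemma PhaseClose.norm_sub_le (h : PhaseClose b c₂ c₁ c₀ τ v δ) {ζ : ℂ} (hζ : ‖ζ‖ ≤ 2 * |ζ.im|) :
    ‖phase b c₂ c₁ c₀ ζ - pearceyPhase τ v ζ‖ ≤ 2 * δ * (1 + ‖ζ‖) ^ 5 := by
  have hsum : ‖∑ j, (Complex.log (1 + b j * ζ)
      - (b j * ζ - (b j * ζ) ^ 2 / 2 + (b j * ζ) ^ 3 / 3 - (b j * ζ) ^ 4 / 4))‖
      ≤ 2 * δ * ‖ζ‖ ^ 5 := by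
    refine (norm_sum_le _ _).trans ?_
    calc _ ≤ ∑ j, 2 * (|b j| ^ 5 * ‖ζ‖ ^ 5) := by
          refine Finset.sum_le_sum fun j _ => ?_
          refine (norm_log_one_add_sub_le (norm_smul_le_im hζ (b j))).trans (le_of_eq ?_)
          rw [norm_mul, Complex.norm_real, Real.norm_eq_abs, mul_pow]
      _ = 2 * ((∑ j, |b j| ^ 5) * ‖ζ‖ ^ 5) := by rw [Finset.sum_mul, Finset.mul_sum]
      _ ≤ 2 * (δ * ‖ζ‖ ^ 5) := by gcongr; exact h.s5
      _ = _ := by ring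
  have heq : phase b c₂ c₁ c₀ ζ - pearceyPhase τ v ζ
      = ∑ j, (Complex.log (1 + b j * ζ)
        - (b j * ζ - (b j * ζ) ^ 2 / 2 + (b j * ζ) ^ 3 / 3 - (b j * ζ) ^ 4 / 4))
        + ((c₀ : ℝ) + ((∑ j, b j - c₁ + v : ℝ) : ℂ) * ζ
          + ((c₂ - (∑ j, b j ^ 2) / 2 + τ / 2 : ℝ) : ℂ) * ζ ^ 2
          + ((∑ j, b j ^ 3 : ℝ) : ℂ) * (ζ ^ 3 / 3)
          - ((∑ j, b j ^ 4 - 1 : ℝ) : ℂ) * (ζ ^ 4 / 4)) := by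
    simp only [phase, pearceyPhase, Finset.sum_sub_distrib, Finset.sum_add_distrib, mul_pow,
      ← Finset.sum_mul, ← Finset.sum_div]
    push_cast
    ring
  have hδ : 0 ≤ δ := (abs_nonneg _).trans h.c0
  have hx := norm_nonneg ζ
  have b0 : ‖((c₀ : ℝ) : ℂ)‖ ≤ δ := by
    rw [Complex.norm_real]; exact h.c0
  have b1 : ‖((∑ j, b j - c₁ + v : ℝ) : ℂ) * ζ‖ ≤ δ * ‖ζ‖ := by
    rw [norm_mul, Complex.norm_real]
    exact mul_le_mul_of_nonneg_right h.s1 hx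
  have b2 : ‖((c₂ - (∑ j, b j ^ 2) / 2 + τ / 2 : ℝ) : ℂ) * ζ ^ 2‖ ≤ δ * ‖ζ‖ ^ 2 := by
    rw [norm_mul, Complex.norm_real, norm_pow]
    exact mul_le_mul_of_nonneg_right h.s2 (by positivity)
  have b3 : ‖((∑ j, b j ^ 3 : ℝ) : ℂ) * (ζ ^ 3 / 3)‖ ≤ δ * (‖ζ‖ ^ 3 / 3) := by
    rw [norm_mul, Complex.norm_real, norm_div, norm_pow]
    simp only [RCLike.norm_ofNat]
    exact mul_le_mul_of_nonneg_right h.s3 (by positivity)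
  have b4 : ‖((∑ j, b j ^ 4 - 1 : ℝ) : ℂ) * (ζ ^ 4 / 4)‖ ≤ δ * (‖ζ‖ ^ 4 / 4) := by
    rw [norm_mul, Complex.norm_real, norm_div, norm_pow]
    simp only [RCLike.norm_ofNat]
    exact mul_le_mul_of_nonneg_right h.s4 (by positivity)
  rw [heq]
  refine (norm_add_le_of_le hsum (norm_sub_le_of_le (norm_add_le_of_le (norm_add_le_of_le
    (norm_add_le_of_le b0 b1) b2) b3) b4)).trans ?_
  have e : 2 * δ * (1 + ‖ζ‖) ^ 5 = 2 * δ + 10 * (δ * ‖ζ‖) + 20 * (δ * ‖ζ‖ ^ 2)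
      + 20 * (δ * ‖ζ‖ ^ 3) + 10 * (δ * ‖ζ‖ ^ 4) + 2 * δ * ‖ζ‖ ^ 5 := by ring
  rw [e]
  have p1 : 0 ≤ δ * ‖ζ‖ := by positivity
  have p2 : 0 ≤ δ * ‖ζ‖ ^ 2 := by positivity
  have p3 : 0 ≤ δ * ‖ζ‖ ^ 3 := by positivity
  have p4 : 0 ≤ δ * ‖ζ‖ ^ 4 := by positivity
  linarith

/-- The descent is quartic only up to `x ~ ε^{-1/2}` and quadratic beyond; for small `ε` it still
beats any prescribed multiple of `x²`. -/
lemma le_pow_four_div {x ε K : ℝ} (hε : 0 ≤ ε) (h : ε * K ≤ 1 / 2) :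
    K * x ^ 2 - K ^ 2 ≤ x ^ 4 / (1 + ε * x ^ 2) := by
  rw [le_div_iff₀ (by positivity)]
  have h1 : ε * K * x ^ 4 ≤ 1 / 2 * x ^ 4 := mul_le_mul_of_nonneg_right h (by positivity)
  have h2 : 0 ≤ ε * K ^ 2 * x ^ 2 := by positivity
  nlinarith [sq_nonneg (x ^ 2 - K), sq_nonneg K]

/-- Gaussian domination of the exponential of the phase function along the steep lines. -/
lemma PhaseClose.re_le (h : PhaseClose b c₂ c₁ c₀ τ v δ) (hδ : δ ≤ 1 / 2) {T M β : ℝ}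
    (hτ : |τ| ≤ T) (hv : |v| ≤ M) (hb : ∀ j, |b j| ≤ β)
    (hβ : β ^ 2 * (32 * (T / 2 + M + 3)) ≤ 1 / 2) {σ : ℝ} {ω : ℂ} (hω : IsSteep σ ω) :
    -σ * (phase b c₂ c₁ c₀ ω).re ≤ 32 * (T / 2 + M + 3) ^ 2 + M + 2 - ‖ω‖ ^ 2 := by
  set x := ‖ω‖ with hx
  have hx0 : 0 ≤ x := norm_nonneg ω
  have hT : 0 ≤ T := (abs_nonneg _).trans hτ
  have hM : 0 ≤ M := (abs_nonneg _).trans hv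
  -- The perturbation has quadratic growth at most `T/2 + M + 2`, so `K / 32` leaves a surplus of
  -- exactly `-‖ω‖²`.
  set K := 32 * (T / 2 + M + 3) with hK
  have hK0 : 0 ≤ K := by positivity
  have hlog : x ^ 4 / (1 + β ^ 2 * x ^ 2) / 32
      ≤ ∑ j, σ * (Complex.log (1 + b j * ω) - b j * ω + (b j * ω) ^ 2 / 2).re := by
    have hS : 1 / 2 ≤ ∑ j, b j ^ 4 := by
      have := (abs_le.mp h.s4).1
      linarith
    calc x ^ 4 / (1 + β ^ 2 * x ^ 2) / 32
        = (1 / 2) * (x ^ 4 / (16 * (1 + β ^ 2 * x ^ 2))) := by field_simp; ring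
      _ ≤ (∑ j, b j ^ 4) * (x ^ 4 / (16 * (1 + β ^ 2 * x ^ 2))) := by gcongr
      _ = ∑ j, b j ^ 4 * x ^ 4 / (16 * (1 + β ^ 2 * x ^ 2)) := by
          rw [Finset.sum_mul]
          exact Finset.sum_congr rfl fun j _ => by ring
      _ ≤ _ := by
          refine Finset.sum_le_sum fun j _ => le_trans ?_ (hω.mul_real (b j)).le_re_log
          have hn : ‖(b j : ℂ) * ω‖ = |b j| * x := by
            rw [norm_mul, Complex.norm_real, Real.norm_eq_abs]
          have h4 : |b j| ^ 4 = b j ^ 4 := (by decide : Even 4).pow_abs (b j)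
          rw [hn, mul_pow, mul_pow, h4]
          have : |b j| ^ 2 ≤ β ^ 2 := by
            have := hb j
            gcongr
          gcongr
  have hsplit : -σ * (phase b c₂ c₁ c₀ ω).re
      = -(∑ j, σ * (Complex.log (1 + b j * ω) - b j * ω + (b j * ω) ^ 2 / 2).re)
        + (-σ) * ((c₂ - (∑ j, b j ^ 2) / 2) * (ω ^ 2).re + (∑ j, b j - c₁) * ω.re + c₀) := by
    have e : phase b c₂ c₁ c₀ ω
        = ∑ j, (Complex.log (1 + b j * ω) - b j * ω + (b j * ω) ^ 2 / 2)
          + (((c₂ - (∑ j, b j ^ 2) / 2 : ℝ) : ℂ) * ω ^ 2 + ((∑ j, b j - c₁ : ℝ) : ℂ) * ω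
            + (c₀ : ℝ)) := by
      simp only [phase, Finset.sum_sub_distrib, Finset.sum_add_distrib, mul_pow,
        ← Finset.sum_mul, ← Finset.sum_div]
      push_cast
      ring
    rw [e, Complex.add_re, Complex.add_re, Complex.add_re, Complex.re_ofReal_mul,
      Complex.re_ofReal_mul, Complex.re_sum, Complex.ofReal_re, ← Finset.mul_sum]
    ring
  have hquad : (-σ) * ((c₂ - (∑ j, b j ^ 2) / 2) * (ω ^ 2).re + (∑ j, b j - c₁) * ω.re + c₀)
      ≤ (T / 2 + 1) * x ^ 2 + (M + 1) * x + 1 := by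
    refine (le_abs_self _).trans ?_
    rw [abs_mul, abs_neg, hω.abs, one_mul]
    have q2 : |c₂ - (∑ j, b j ^ 2) / 2| ≤ T / 2 + 1 := by
      have h1 := abs_sub (c₂ - (∑ j, b j ^ 2) / 2 + τ / 2) (τ / 2)
      rw [add_sub_cancel_right, abs_div τ, abs_two] at h1
      have := h.s2
      linarith
    have q1 : |∑ j, b j - c₁| ≤ M + 1 := by
      have h1 := abs_sub (∑ j, b j - c₁ + v) v
      rw [add_sub_cancel_right] at h1
      have := h.s1
      linarith
    have r2 : |(ω ^ 2).re| ≤ x ^ 2 := by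
      rw [hx, ← norm_pow]; exact Complex.abs_re_le_norm _
    have r1 : |ω.re| ≤ x := Complex.abs_re_le_norm _
    refine (abs_add_three _ _ _).trans ?_
    rw [abs_mul, abs_mul]
    have c0 := h.c0
    have := mul_le_mul q2 r2 (abs_nonneg _) (by positivity)
    have := mul_le_mul q1 r1 (abs_nonneg _) (by positivity)
    linarith
  have hmain := le_pow_four_div (x := x) (sq_nonneg β) hβ
  rw [hsplit]
  have hxx : (M + 1) * x ≤ (M + 1) * (1 + x ^ 2) := by
    gcongr
    nlinarith [sq_nonneg (x - 1)]
  have hKK : K ^ 2 / 32 = 32 * (T / 2 + M + 3) ^ 2 := by rw [hK]; ring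
  have hKx : K * x ^ 2 / 32 = (T / 2 + M + 3) * x ^ 2 := by rw [hK]; ring
  nlinarith

/-- The constant is deliberately that of `PhaseClose.re_le`, so that both phases share one majorant.
-/
lemma pearceyPhase_re_le {T M : ℝ} (hτ : |τ| ≤ T) (hv : |v| ≤ M) {σ : ℝ} {ω : ℂ}
    (hω : IsSteep σ ω) :
    -σ * (pearceyPhase τ v ω).re ≤ 32 * (T / 2 + M + 3) ^ 2 + M + 2 - ‖ω‖ ^ 2 := by
  set x := ‖ω‖ with hx
  have hx0 : 0 ≤ x := norm_nonneg ω
  have hT : 0 ≤ T := (abs_nonneg _).trans hτ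
  have hM : 0 ≤ M := (abs_nonneg _).trans hv
  have e : -σ * (pearceyPhase τ v ω).re
      = σ * (ω ^ 4).re / 4 + σ * (τ / 2 * (ω ^ 2).re + v * ω.re) := by
    have : pearceyPhase τ v ω = ((-(1 / 4) : ℝ) : ℂ) * ω ^ 4 + ((-(τ / 2) : ℝ) : ℂ) * ω ^ 2
        + ((-v : ℝ) : ℂ) * ω := by
      rw [pearceyPhase]; push_cast; ring
    rw [this, Complex.add_re, Complex.add_re, Complex.re_ofReal_mul, Complex.re_ofReal_mul,
      Complex.re_ofReal_mul]
    ring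
  have hq : σ * (τ / 2 * (ω ^ 2).re + v * ω.re) ≤ T / 2 * x ^ 2 + M * x := by
    refine (le_abs_self _).trans ?_
    rw [abs_mul, hω.abs, one_mul]
    have r2 : |(ω ^ 2).re| ≤ x ^ 2 := by
      rw [hx, ← norm_pow]; exact Complex.abs_re_le_norm _
    have r1 : |ω.re| ≤ x := Complex.abs_re_le_norm _
    refine (abs_add_le _ _).trans ?_
    rw [abs_mul, abs_mul, abs_div, abs_two]
    have := mul_le_mul (div_le_div_of_nonneg_right hτ (zero_le_two)) r2 (abs_nonneg _)
      (by positivity)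
    have := mul_le_mul hv r1 (abs_nonneg _) (by positivity)
    linarith
  rw [e]
  have h4 := hω.fourth
  have hxx : M * x ≤ M * (1 + x ^ 2) := by
    gcongr
    nlinarith [sq_nonneg (x - 1)]
  nlinarith [sq_nonneg (x ^ 2 - 4 * (T / 2 + M + 3)), sq_nonneg (T / 2 + M + 3)]

end phase

end

/-! ### Discrepancy and singular moments. -/

noncomputable section

/-- Layer cake formula: a discrepancy `D` on each superlevel set is integrated over levels in `(0,
B]`. Strict and non-strict levels are both offered because the monotonicity of `f` decides which are
half-open intervals. -/
lemma abs_integral_sub_le_of_layers {ν₁ ν₂ : Measure ℝ} [IsFiniteMeasure ν₁] [IsFiniteMeasure ν₂]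
    {f : ℝ → ℝ} (hf : Measurable f) (h0 : ∀ x, 0 ≤ f x) {B D : ℝ} (hB : 0 ≤ B)
    (hfB : ∀ x, f x ≤ B)
    (h : (∀ t, 0 < t → |ν₁.real {x | t < f x} - ν₂.real {x | t < f x}| ≤ D) ∨
      (∀ t, 0 < t → |ν₁.real {x | t ≤ f x} - ν₂.real {x | t ≤ f x}| ≤ D)) :
    |∫ x, f x ∂ν₁ - ∫ x, f x ∂ν₂| ≤ D * B := by
  have hint : ∀ ν : Measure ℝ, IsFiniteMeasure ν → Integrable f ν := fun ν _ =>
    Integrable.of_bound hf.aestronglyMeasurable B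
      (ae_of_all _ fun x => by rw [Real.norm_of_nonneg (h0 x)]; exact hfB x)
  have hfin : ∀ ν : Measure ℝ, IsFiniteMeasure ν → ∀ s, ν s ≠ ⊤ := fun ν _ s => measure_ne_top ν s
  have hlt : ∀ ν : Measure ℝ, IsFiniteMeasure ν →
      IntegrableOn (fun t => ν.real {x | t < f x}) (Ioc 0 B) := by
    intro ν hν
    have : AntitoneOn (fun t => ν.real {x | t < f x}) (Icc 0 B) := fun s _ t _ hst =>
      measureReal_mono (fun x hx => lt_of_le_of_lt hst hx) (hfin ν hν _)
    exact (this.integrableOn_isCompact isCompact_Icc).mono_set Ioc_subset_Icc_self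
  have hle : ∀ ν : Measure ℝ, IsFiniteMeasure ν →
      IntegrableOn (fun t => ν.real {x | t ≤ f x}) (Ioc 0 B) := by
    intro ν hν
    have : AntitoneOn (fun t => ν.real {x | t ≤ f x}) (Icc 0 B) := fun s _ t _ hst =>
      measureReal_mono (fun x hx => le_trans hst hx) (hfin ν hν _)
    exact (this.integrableOn_isCompact isCompact_Icc).mono_set Ioc_subset_Icc_self
  have elt : ∀ ν : Measure ℝ, IsFiniteMeasure ν →
      ∫ x, f x ∂ν = ∫ t in Ioc 0 B, ν.real {x | t < f x} := by
    intro ν hν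
    rw [(hint ν hν).integral_eq_integral_meas_lt (ae_of_all _ h0)]
    refine setIntegral_eq_of_subset_of_forall_sdiff_eq_zero measurableSet_Ioi Ioc_subset_Ioi_self
      fun t ht => ?_
    have : {x | t < f x} = ∅ := by
      ext x
      simp only [mem_ofPred_eq, mem_empty_iff_false, iff_false, not_lt]
      have : ¬ t ≤ B := fun h => ht.2 ⟨ht.1, h⟩
      linarith [hfB x]
    rw [this, measureReal_empty]
  have ele : ∀ ν : Measure ℝ, IsFiniteMeasure ν →
      ∫ x, f x ∂ν = ∫ t in Ioc 0 B, ν.real {x | t ≤ f x} := by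
    intro ν hν
    rw [(hint ν hν).integral_eq_integral_meas_le (ae_of_all _ h0)]
    refine setIntegral_eq_of_subset_of_forall_sdiff_eq_zero measurableSet_Ioi Ioc_subset_Ioi_self
      fun t ht => ?_
    have : {x | t ≤ f x} = ∅ := by
      ext x
      simp only [mem_ofPred_eq, mem_empty_iff_false, iff_false, not_le]
      have : ¬ t ≤ B := fun h => ht.2 ⟨ht.1, h⟩
      linarith [hfB x]
    rw [this, measureReal_empty]
  have hvol : volume (Ioc 0 B) < ⊤ := measure_Ioc_lt_top
  have hvr : volume.real (Ioc 0 B) = B := by simp [hB]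
  rcases h with h | h
  · rw [elt ν₁ inferInstance, elt ν₂ inferInstance,
      ← integral_sub (hlt ν₁ inferInstance) (hlt ν₂ inferInstance), ← Real.norm_eq_abs, ← hvr]
    simp only [hvr]
    have := norm_setIntegral_le_of_norm_le_const (C := D) hvol
      (f := fun t => ν₁.real {x | t < f x} - ν₂.real {x | t < f x}) fun t ht => h t ht.1
    rwa [hvr] at this
  · rw [ele ν₁ inferInstance, ele ν₂ inferInstance,
      ← integral_sub (hle ν₁ inferInstance) (hle ν₂ inferInstance), ← Real.norm_eq_abs, ← hvr]
    simp only [hvr]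
    have := norm_setIntegral_le_of_norm_le_const (C := D) hvol
      (f := fun t => ν₁.real {x | t ≤ f x} - ν₂.real {x | t ≤ f x}) fun t ht => h t ht.1
    rwa [hvr] at this

section empirical

variable {n : ℕ} {X : Fin n → ℝ}

lemma isProbabilityMeasure_empirical (hn : 0 < n) : IsProbabilityMeasure (empirical X) := by
  refine ⟨?_⟩
  have hn0 : (n : ENNReal) ≠ 0 := by exact_mod_cast hn.ne'
  simp [empirical, ENNReal.inv_mul_cancel hn0 (ENNReal.natCast_ne_top n)]

lemma integral_empirical (f : ℝ → ℝ) :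
    ∫ x, f x ∂(empirical X) = (n : ℝ)⁻¹ * ∑ j, f (X j) := by
  rw [empirical, integral_smul_measure, integral_finsetSum_measure]
  · simp
  · intro j _
    exact integrable_dirac (by simp)

end empirical

lemma abs_measureReal_Ioc_sub_le {ν₁ ν₂ : Measure ℝ} [IsFiniteMeasure ν₁] [IsFiniteMeasure ν₂]
    {D : ℝ} (h : ∀ x, |ν₁.real (Iic x) - ν₂.real (Iic x)| ≤ D) (a b : ℝ) :
    |ν₁.real (Ioc a b) - ν₂.real (Ioc a b)| ≤ 2 * D := by
  rcases le_total a b with hab | hab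
  · have e : ∀ ν : Measure ℝ, IsFiniteMeasure ν →
        ν.real (Ioc a b) = ν.real (Iic b) - ν.real (Iic a) := by
      intro ν _
      rw [← Iic_sdiff_Iic, measureReal_sdiff (Iic_subset_Iic.mpr hab) measurableSet_Iic]
    rw [e ν₁ inferInstance, e ν₂ inferInstance]
    have h1 := abs_le.mp (h a)
    have h2 := abs_le.mp (h b)
    rw [abs_le]
    constructor <;> linarith [h1.1, h1.2, h2.1, h2.2]
  · have := (abs_nonneg _).trans (h a)
    rw [Ioc_eq_empty hab.not_gt]
    simp
    linarith

/-- The part of `1 / |x - s| ^ k` to the left of `x`, at distance at least `g`. -/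
def leftPart (x g : ℝ) (k : ℕ) : ℝ → ℝ := (Iic (x - g)).indicator fun s => ((x - s) ^ k)⁻¹

/-- The part of `1 / |x - s| ^ k` to the right of `x`, at distance more than `g`. -/
def rightPart (x g : ℝ) (k : ℕ) : ℝ → ℝ := (Ioi (x + g)).indicator fun s => ((s - x) ^ k)⁻¹

section parts

variable {x g : ℝ} {k : ℕ}

lemma measurable_leftPart : Measurable (leftPart x g k) :=
  Measurable.indicator (by fun_prop) measurableSet_Iic

lemma measurable_rightPart : Measurable (rightPart x g k) :=
  Measurable.indicator (by fun_prop) measurableSet_Ioi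

lemma leftPart_nonneg (hg : 0 < g) (s : ℝ) : 0 ≤ leftPart x g k s := by
  refine indicator_nonneg (fun s hs => ?_) s
  have : 0 < x - s := by linarith [mem_Iic.mp hs]
  positivity

lemma rightPart_nonneg (hg : 0 < g) (s : ℝ) : 0 ≤ rightPart x g k s := by
  refine indicator_nonneg (fun s hs => ?_) s
  have : 0 < s - x := by linarith [mem_Ioi.mp hs]
  positivity

lemma leftPart_le (hg : 0 < g) (s : ℝ) : leftPart x g k s ≤ (g ^ k)⁻¹ := by
  refine indicator_apply_le' (fun hs => ?_) fun _ => by positivity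
  have : g ≤ x - s := by linarith [mem_Iic.mp hs]
  gcongr

lemma rightPart_le (hg : 0 < g) (s : ℝ) : rightPart x g k s ≤ (g ^ k)⁻¹ := by
  refine indicator_apply_le' (fun hs => ?_) fun _ => by positivity
  have : g ≤ s - x := by linarith [mem_Ioi.mp hs]
  gcongr

lemma exists_pow_eq_inv (hk : k ≠ 0) {t : ℝ} (ht : 0 < t) : ∃ L : ℝ, 0 < L ∧ L ^ k = t⁻¹ :=
  ⟨t⁻¹ ^ ((k : ℝ)⁻¹), by positivity, Real.rpow_inv_natCast_pow (by positivity) hk⟩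

/-- `leftPart` increases up to its included cut-off, so the strict superlevel sets are open on the
left and closed on the right, the form that distribution functions measure. -/
lemma exists_setOf_lt_leftPart (hg : 0 < g) (hk : k ≠ 0) {t : ℝ} (ht : 0 < t) :
    ∃ a b, {s | t < leftPart x g k s} = Ioc a b := by
  obtain ⟨L, hL, hLt⟩ := exists_pow_eq_inv hk ht
  refine ⟨x - L, x - g, ?_⟩
  ext s
  simp only [mem_ofPred_eq, mem_Ioc, leftPart, indicator_apply, mem_Iic]
  split_ifs with hs
  · have h0 : 0 < x - s := by linarith
    rw [lt_inv_comm₀ ht (by positivity), ← hLt, pow_lt_pow_iff_left₀ h0.le hL.le hk]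
    constructor
    · intro h; exact ⟨by linarith, hs⟩
    · intro h; linarith [h.1]
  · constructor
    · intro h; linarith
    · intro h; exact absurd h.2 hs

/-- `rightPart` decreases from its excluded cut-off, so here the non-strict superlevel sets have
that form. -/
lemma exists_setOf_le_rightPart (hg : 0 < g) (hk : k ≠ 0) {t : ℝ} (ht : 0 < t) :
    ∃ a b, {s | t ≤ rightPart x g k s} = Ioc a b := by
  obtain ⟨L, hL, hLt⟩ := exists_pow_eq_inv hk ht
  refine ⟨x + g, x + L, ?_⟩
  ext s
  simp only [mem_ofPred_eq, mem_Ioc, rightPart, indicator_apply, mem_Ioi]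
  split_ifs with hs
  · have h0 : 0 < s - x := by linarith
    rw [le_inv_comm₀ ht (by positivity), ← hLt, pow_le_pow_iff_left₀ h0.le hL.le hk]
    constructor
    · intro h; exact ⟨hs, by linarith⟩
    · intro h; linarith [h.2]
  · constructor
    · intro h; linarith
    · intro h; exact absurd h.1 hs

lemma one_div_eq_parts (hg : 0 < g) (s : ℝ) :
    1 / (x - s) ^ k = (Ioc (x - g) (x + g)).indicator (fun s => 1 / (x - s) ^ k) s
      + (leftPart x g k s + (-1) ^ k * rightPart x g k s) := by
  simp only [leftPart, rightPart, indicator_apply, mem_Ioc, mem_Iic, mem_Ioi]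
  rcases le_or_gt s (x - g) with h1 | h1
  · simp [h1, h1.not_gt, (by linarith : ¬ x + g < s)]
  · rcases le_or_gt s (x + g) with h2 | h2
    · simp [h1, h2, h1.not_ge, h2.not_gt]
    · simp only [h1.not_ge, h2.not_ge, h2, and_false, if_false, if_true, zero_add, one_div]
      rw [← neg_sub s x, neg_pow, mul_inv, ← inv_pow, inv_neg_one]

end parts

end

noncomputable section

lemma integrable_comp_abs {f : ℝ → ℝ} (hf : IntegrableOn f (Ioi 0)) :
    Integrable fun x => f |x| := by
  have hIoi : IntegrableOn (fun x => f |x|) (Ioi 0) :=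
    hf.congr_fun (fun x hx => by simp only [abs_of_pos (mem_Ioi.mp hx)]) measurableSet_Ioi
  have hIic : IntegrableOn (fun x => f |x|) (Iic 0) := by
    rw [← Measure.map_neg_eq_self (volume : Measure ℝ)]
    let m : MeasurableEmbedding fun x : ℝ => -x := (Homeomorph.neg ℝ).measurableEmbedding
    rw [m.integrableOn_map_iff]
    simp_rw [Function.comp_def, abs_neg, neg_preimage, neg_Iic, neg_zero]
    exact Iff.mpr integrableOn_Ici_iff_integrableOn_Ioi hIoi
  rw [← integrableOn_univ, ← Iic_union_Ioi (a := (0 : ℝ))]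
  exact hIic.union hIoi

lemma integral_indicator_abs_rpow {x g p : ℝ} (hg : 0 < g) (hp : -1 < p) :
    Integrable (fun s => (Iic g).indicator (fun t : ℝ => t ^ p) |s - x|) ∧
      ∫ s, (Iic g).indicator (fun t : ℝ => t ^ p) |s - x| = 2 * (g ^ (p + 1) / (p + 1)) := by
  have hset : Ioi 0 ∩ Iic g = Ioc 0 g := Ioi_inter_Iic
  have hint : IntegrableOn ((Iic g).indicator fun t : ℝ => t ^ p) (Ioi 0) := by
    rw [IntegrableOn, integrable_indicator_iff measurableSet_Iic, IntegrableOn,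
      Measure.restrict_restrict measurableSet_Iic, inter_comm, hset]
    exact (intervalIntegrable_iff_integrableOn_Ioc_of_le hg.le).mp
      (intervalIntegral.intervalIntegrable_rpow' hp)
  refine ⟨(integrable_comp_abs hint).comp_sub_right x, ?_⟩
  rw [integral_sub_right_eq_self (fun s => (Iic g).indicator (fun t : ℝ => t ^ p) |s|) x,
    integral_comp_abs, setIntegral_indicator measurableSet_Iic, hset,
    ← intervalIntegral.integral_of_le hg.le, integral_rpow (Or.inl hp), Real.zero_rpow (by linarith),
    sub_zero]

section density

variable {X : (n : ℕ) → Fin n → ℝ} {μ : Measure ℝ} {ψ : ℝ → ℝ} {xs κ : ℝ}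

lemma Assumption1.exists_density_le (h : Assumption1 X μ ψ xs κ) :
    ∃ C r₀ : ℝ, 0 < C ∧ 0 < r₀ ∧ ∀ s, s ≠ xs → |s - xs| ≤ r₀ → ψ s ≤ C * |s - xs| ^ κ := by
  obtain ⟨c, hc, hequiv⟩ := h.vanish
  obtain ⟨C, hC, hbd⟩ := hequiv.isBigO.exists_pos
  have := hbd.bound
  rw [eventually_nhdsWithin_iff, Metric.eventually_nhds_iff] at this
  obtain ⟨r, hr, hr'⟩ := this
  refine ⟨C * c, r / 2, by positivity, by positivity, fun s hs hsr => ?_⟩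
  have h1 := hr' (y := s) (by rw [Real.dist_eq]; linarith) hs
  rw [Real.norm_of_nonneg (h.nonneg s), Real.norm_of_nonneg (by positivity)] at h1
  linarith

/-- The singular moments of `μ` restricted to a small neighbourhood of the critical point. -/
lemma Assumption1.exists_moment_near_le (h : Assumption1 X μ ψ xs κ) :
    ∃ C r₀ : ℝ, 0 ≤ C ∧ 0 < r₀ ∧ ∀ k : ℕ, (k : ℝ) ≤ 4 → 3 < κ → ∀ g, 0 < g → g ≤ r₀ →
      IntegrableOn (fun s => 1 / (xs - s) ^ k) (Ioc (xs - g) (xs + g)) μ ∧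
      |∫ s in Ioc (xs - g) (xs + g), 1 / (xs - s) ^ k ∂μ| ≤ C / (κ - 3) * g ^ (κ - k + 1) := by
  obtain ⟨C, r₀, hC, hr₀, hψ⟩ := h.exists_density_le
  refine ⟨2 * C, r₀, by positivity, hr₀, fun k hk hκ g hg hgr => ?_⟩
  have hp : -1 < κ - k := by linarith
  obtain ⟨hHint, hHval⟩ := integral_indicator_abs_rpow (x := xs) hg hp
  set H : ℝ → ℝ := fun s => (Iic g).indicator (fun t : ℝ => t ^ (κ - k)) |s - xs| with hH
  have hH0 : ∀ s, 0 ≤ H s := fun s => by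
    simp only [hH, indicator_apply]
    split_ifs <;> positivity
  have hmeas : Measurable fun s : ℝ => 1 / (xs - s) ^ k := by fun_prop
  have hdens : Measurable fun s => ENNReal.ofReal (ψ s) := h.meas.ennreal_ofReal
  have hle : ∫⁻ s in Ioc (xs - g) (xs + g), ‖1 / (xs - s) ^ k‖ₑ ∂μ
      ≤ ENNReal.ofReal (C * (2 * (g ^ (κ - k + 1) / (κ - k + 1)))) := by
    rw [h.density, restrict_withDensity measurableSet_Ioc,
      lintegral_withDensity_eq_lintegral_mul _ hdens hmeas.enorm, ← hHval, ← integral_const_mul,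
      ofReal_integral_eq_lintegral_ofReal (hHint.const_mul C)
        (ae_of_all _ fun s => mul_nonneg hC.le (hH0 s))]
    refine le_trans (lintegral_mono_ae ?_) (setLIntegral_le_lintegral (Ioc (xs - g) (xs + g)) _)
    have hne : ∀ᵐ s ∂(volume.restrict (Ioc (xs - g) (xs + g))), s ≠ xs :=
      ae_restrict_of_ae (by simp [ae_iff])
    filter_upwards [hne, ae_restrict_mem measurableSet_Ioc] with s hs hsI
    have habs : |s - xs| ≤ g := by
      rw [abs_le]; constructor <;> linarith [hsI.1, hsI.2]
    have hpos : 0 < |s - xs| := abs_pos.mpr (sub_ne_zero.mpr hs)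
    rw [Pi.mul_apply, ← ofReal_norm, ← ENNReal.ofReal_mul (h.nonneg s)]
    refine ENNReal.ofReal_le_ofReal ?_
    have e : ‖1 / (xs - s) ^ k‖ = (|s - xs| ^ k)⁻¹ := by
      rw [norm_div, norm_one, norm_pow, Real.norm_eq_abs, abs_sub_comm, one_div]
    have e2 : H s = |s - xs| ^ κ * (|s - xs| ^ k)⁻¹ := by
      simp only [hH, indicator_apply, mem_Iic, habs, if_true]
      rw [Real.rpow_sub hpos, Real.rpow_natCast, div_eq_mul_inv]
    rw [e, e2, ← mul_assoc]
    exact mul_le_mul_of_nonneg_right (hψ s hs (habs.trans hgr)) (by positivity)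
  -- As `k ≤ 4`, one constant with denominator `κ - 3` serves all `k`.
  have hle2 : C * (2 * (g ^ (κ - k + 1) / (κ - k + 1))) ≤ 2 * C / (κ - 3) * g ^ (κ - k + 1) := by
    have : g ^ (κ - k + 1) / (κ - k + 1) ≤ g ^ (κ - k + 1) / (κ - 3) :=
      div_le_div_of_nonneg_left (by positivity) (by linarith) (by linarith)
    calc _ ≤ C * (2 * (g ^ (κ - k + 1) / (κ - 3))) := by gcongr
      _ = _ := by ring
  refine ⟨⟨hmeas.aestronglyMeasurable, hle.trans_lt ENNReal.ofReal_lt_top⟩, ?_⟩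
  rw [← Real.norm_eq_abs]
  refine le_trans ?_ hle2
  have hpos : 0 ≤ C * (2 * (g ^ (κ - k + 1) / (κ - k + 1))) := by
    have : 0 < κ - k + 1 := by linarith
    positivity
  refine (norm_integral_le_lintegral_norm _).trans (ENNReal.toReal_le_of_le_ofReal hpos ?_)
  simpa only [ofReal_norm] using hle

/-- The difference of singular moments at the critical point. -/
lemma exists_moment_sub_le (h : Assumption1 X μ ψ xs κ) (h2 : Assumption2 X μ) (hκ : 3 < κ) :
    ∃ (C r₀ : ℝ) (n₀ : ℕ), 0 ≤ C ∧ 0 < r₀ ∧ 0 < n₀ ∧ ∀ k : ℕ, 1 ≤ k → k ≤ 4 →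
      Integrable (fun s => 1 / (xs - s) ^ k) μ ∧
      ∀ g, 0 < g → g ≤ r₀ → ∀ n, n₀ ≤ n → (∀ j, X n j ∉ Icc (xs - g) (xs + g)) →
        |(n : ℝ)⁻¹ * ∑ j, 1 / (xs - X n j) ^ k - ∫ s, 1 / (xs - s) ^ k ∂μ|
          ≤ C * ((g ^ k)⁻¹ / n + g ^ (κ - k + 1)) := by
  obtain ⟨C, r₀, hC, hr₀, hnear⟩ := h.exists_moment_near_le
  obtain ⟨M, hM, n₀, hn₀, hF⟩ := h2
  have := h.prob
  have hLint : ∀ (ν : Measure ℝ) [IsFiniteMeasure ν] (g : ℝ), 0 < g → ∀ k,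
      Integrable (leftPart xs g k) ν := fun ν _ g hg k =>
    Integrable.of_bound measurable_leftPart.aestronglyMeasurable (g ^ k)⁻¹
      (ae_of_all _ fun s => by
        rw [Real.norm_of_nonneg (leftPart_nonneg hg s)]; exact leftPart_le hg s)
  have hRint : ∀ (ν : Measure ℝ) [IsFiniteMeasure ν] (g : ℝ), 0 < g → ∀ k,
      Integrable (rightPart xs g k) ν := fun ν _ g hg k =>
    Integrable.of_bound measurable_rightPart.aestronglyMeasurable (g ^ k)⁻¹
      (ae_of_all _ fun s => by
        rw [Real.norm_of_nonneg (rightPart_nonneg hg s)]; exact rightPart_le hg s)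
  -- Left and right parts each cost an interval discrepancy `2M/n`; the other term bounds the share
  -- of `μ` inside the window, where the empirical measure has no mass.
  refine ⟨4 * M + C / (κ - 3), r₀, n₀, ?_, hr₀, hn₀, fun k hk1 hk4 => ?_⟩
  · have : 0 < κ - 3 := by linarith
    positivity
  have hkR : (k : ℝ) ≤ 4 := by exact_mod_cast hk4
  have hk0 : k ≠ 0 := by omega
  have hind : ∀ g, 0 < g → g ≤ r₀ →
      Integrable ((Ioc (xs - g) (xs + g)).indicator fun s => 1 / (xs - s) ^ k) μ :=
    fun g hg hgr => (integrable_indicator_iff measurableSet_Ioc).mpr (hnear k hkR hκ g hg hgr).1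
  have hrest : ∀ g, 0 < g →
      Integrable (fun s => leftPart xs g k s + (-1) ^ k * rightPart xs g k s) μ := fun g hg =>
    (hLint μ g hg k).add ((hRint μ g hg k).const_mul _)
  refine ⟨?_, fun g hg hgr n hn hgap => ?_⟩
  · have h1 := (hind r₀ hr₀ le_rfl).add (hrest r₀ hr₀)
    refine h1.congr (ae_of_all _ fun s => ?_)
    exact (one_div_eq_parts hr₀ s).symm
  have hnpos : 0 < n := hn₀.trans_le hn
  have hpe := isProbabilityMeasure_empirical (X := X n) hnpos
  have hIoc := abs_measureReal_Ioc_sub_le (hF n hn)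
  have hL := abs_integral_sub_le_of_layers (ν₁ := empirical (X n)) (ν₂ := μ) (D := 2 * (M / n))
    (measurable_leftPart (x := xs) (g := g) (k := k)) (leftPart_nonneg hg) (by positivity)
    (leftPart_le hg) (Or.inl fun t ht => by
      obtain ⟨a, b, hab⟩ := exists_setOf_lt_leftPart (x := xs) hg hk0 ht
      rw [hab]; exact hIoc a b)
  have hR := abs_integral_sub_le_of_layers (ν₁ := empirical (X n)) (ν₂ := μ) (D := 2 * (M / n))
    (measurable_rightPart (x := xs) (g := g) (k := k)) (rightPart_nonneg hg) (by positivity)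
    (rightPart_le hg) (Or.inr fun t ht => by
      obtain ⟨a, b, hab⟩ := exists_setOf_le_rightPart (x := xs) hg hk0 ht
      rw [hab]; exact hIoc a b)
  have hμ : ∫ s, 1 / (xs - s) ^ k ∂μ = ∫ s in Ioc (xs - g) (xs + g), 1 / (xs - s) ^ k ∂μ
      + (∫ s, leftPart xs g k s ∂μ + (-1) ^ k * ∫ s, rightPart xs g k s ∂μ) := by
    rw [integral_congr_ae (ae_of_all _ (one_div_eq_parts (x := xs) (k := k) hg)),
      integral_add (hind g hg hgr) (hrest g hg), integral_indicator measurableSet_Ioc,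
      integral_add (hLint μ g hg k) ((hRint μ g hg k).const_mul _), integral_const_mul]
  have hn' : (n : ℝ)⁻¹ * ∑ j, 1 / (xs - X n j) ^ k
      = ∫ s, leftPart xs g k s ∂(empirical (X n))
        + (-1) ^ k * ∫ s, rightPart xs g k s ∂(empirical (X n)) := by
    rw [integral_empirical, integral_empirical, mul_left_comm, ← mul_add]
    congr 1
    rw [Finset.mul_sum, ← Finset.sum_add_distrib]
    refine Finset.sum_congr rfl fun j _ => ?_
    rw [one_div_eq_parts hg (X n j), indicator_of_notMem, zero_add]
    exact fun hj => hgap j (Ioc_subset_Icc_self hj)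
  rw [hn', hμ]
  have hA := (hnear k hkR hκ g hg hgr).2
  set l₁ := ∫ s, leftPart xs g k s ∂(empirical (X n))
  set l₂ := ∫ s, leftPart xs g k s ∂μ
  set q₁ := ∫ s, rightPart xs g k s ∂(empirical (X n))
  set q₂ := ∫ s, rightPart xs g k s ∂μ
  set A := ∫ s in Ioc (xs - g) (xs + g), 1 / (xs - s) ^ k ∂μ
  have e : l₁ + (-1) ^ k * q₁ - (A + (l₂ + (-1) ^ k * q₂))
      = (l₁ - l₂) + (-1) ^ k * (q₁ - q₂) - A := by ring
  have hsgn : |(-1 : ℝ) ^ k * (q₁ - q₂)| = |q₁ - q₂| := by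
    rw [abs_mul, abs_pow, abs_neg, abs_one, one_pow, one_mul]
  rw [e]
  have t1 := abs_sub ((l₁ - l₂) + (-1) ^ k * (q₁ - q₂)) A
  have t2 := abs_add_le (l₁ - l₂) ((-1) ^ k * (q₁ - q₂))
  have hκ3 : 0 < κ - 3 := by linarith
  have p1 : 0 ≤ C / (κ - 3) * ((g ^ k)⁻¹ / n) := by positivity
  have p2 : 0 ≤ 4 * M * g ^ (κ - k + 1) := by positivity
  have e3 : (4 * M + C / (κ - 3)) * ((g ^ k)⁻¹ / n + g ^ (κ - k + 1))
      = 2 * (2 * (M / n) * (g ^ k)⁻¹) + C / (κ - 3) * g ^ (κ - k + 1)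
        + C / (κ - 3) * ((g ^ k)⁻¹ / n) + 4 * M * g ^ (κ - k + 1) := by ring
  rw [e3]
  linarith

/-- The integrand is positive off `xs`, which `μ` does not charge since it has a density. -/
lemma integral_inv_pow_pos (h : Assumption1 X μ ψ xs κ) {k : ℕ} (hk : Even k)
    (hint : Integrable (fun s => 1 / (xs - s) ^ k) μ) : 0 < ∫ s, 1 / (xs - s) ^ k ∂μ := by
  have := h.prob
  have h0 : ∀ s, 0 ≤ 1 / (xs - s) ^ k := fun s => one_div_nonneg.mpr (hk.pow_nonneg _)
  rw [integral_pos_iff_support_of_nonneg h0 hint]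
  have hsub : {xs}ᶜ ⊆ Function.support fun s => 1 / (xs - s) ^ k := by
    intro s hs
    exact one_div_ne_zero (pow_ne_zero _ (sub_ne_zero.mpr (Ne.symm hs)))
  have hxs : μ {xs} = 0 := by
    rw [h.density]
    exact withDensity_absolutelyContinuous _ _ (by simp)
  refine lt_of_lt_of_le ?_ (measure_mono hsub)
  rw [prob_compl_eq_one_sub (measurableSet_singleton xs), hxs]
  simp

end density

end

/-! ### Asymptotics of the parameters. -/

noncomputable section

section parameters

variable (μ : Measure ℝ) (xs : ℝ)

/-- The local scale `c₃ t_cr n^{-1/4}` around the critical point. -/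
def scale (n : ℕ) : ℝ := c3 μ xs * tcr μ xs * (n : ℝ) ^ (-(1 / 4 : ℝ))

/-- The inverse positions of the initial points in the local variable. -/
def locPts {n : ℕ} (X : Fin n → ℝ) (j : Fin n) : ℝ := scale μ xs n / (xs - X j)

/-- The rescaled space variable. -/
def locSpace (n : ℕ) (v : ℝ) : ℝ := v / (c3 μ xs * (n : ℝ) ^ ((3 : ℝ) / 4))

/-- The quadratic coefficient of the phase function. -/
def coef2 (n : ℕ) (t : ℝ) : ℝ := n * scale μ xs n ^ 2 / (2 * t)

/-- The linear coefficient of the phase function. -/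
def coef1 (n : ℕ) (t v : ℝ) : ℝ :=
  n * scale μ xs n * (stieltjesD μ 0 xs + locSpace μ xs n v / t)

/-- The constant coefficient of the phase function. -/
def coef0 (n : ℕ) (t v : ℝ) : ℝ := n * locSpace μ xs n v ^ 2 / (2 * t)

end parameters

/-- The exponent of the error term. -/
def rate (κ : ℝ) : ℝ := (κ - 3) / (4 * (κ + 1))

/-- This is the exponent of the ratio between the local scale `n^{-1/4}` and the gap `n^{-1/(κ+1)}`.
-/
lemma rate_eq {κ : ℝ} (hκ : 3 < κ) : -rate κ = -(1 / 4) + 1 / (κ + 1) := by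
  have : κ + 1 ≠ 0 := by linarith
  rw [rate]
  field_simp
  ring

lemma rate_pos {κ : ℝ} (hκ : 3 < κ) : 0 < rate κ := by
  rw [rate]
  have : 0 < κ - 3 := by linarith
  have : 0 < κ + 1 := by linarith
  positivity

lemma rate_lt {κ : ℝ} (hκ : 3 < κ) : rate κ < 1 / 4 := by
  have := rate_eq hκ
  have : 0 < 1 / (κ + 1) := by
    have : 0 < κ + 1 := by linarith
    positivity
  linarith

section asymptotics

variable {X : (n : ℕ) → Fin n → ℝ} {μ : Measure ℝ} {ψ : ℝ → ℝ} {xs κ : ℝ}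

/-- Positivity of the constants of the critical point. -/
structure CritPos (μ : Measure ℝ) (xs : ℝ) : Prop where
  tcr : 0 < tcr μ xs
  c3 : 0 < c3 μ xs
  m2 : ∫ s, 1 / (xs - s) ^ 2 ∂μ = (NIBM.tcr μ xs)⁻¹
  m4 : (NIBM.c3 μ xs * NIBM.tcr μ xs) ^ 4 * ∫ s, 1 / (xs - s) ^ 4 ∂μ = 1

/-- Finiteness of the fourth moment rests on `κ > 3`. Since `-G₃` is six times that moment, `c₃` is
the constant that normalises the quartic coefficient. -/
lemma critPos (h : Assumption1 X μ ψ xs κ) (h2 : Assumption2 X μ) (hκ : 3 < κ) :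
    CritPos μ xs := by
  obtain ⟨C, r₀, n₀, -, -, -, hk⟩ := exists_moment_sub_le h h2 hκ
  have hm2 := integral_inv_pow_pos h (by decide : Even 2) (hk 2 (by norm_num) (by norm_num)).1
  have hm4 := integral_inv_pow_pos h (by decide : Even 4) (hk 4 (by norm_num) (by norm_num)).1
  have ht : 0 < tcr μ xs := inv_pos.mpr hm2
  have hG3 : 6 / -stieltjesD μ 3 xs = (∫ s, 1 / (xs - s) ^ 4 ∂μ)⁻¹ := by
    rw [stieltjesD]
    norm_num [Nat.factorial]
    field_simp
  have hc : 0 < c3 μ xs := by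
    rw [c3, hG3]
    positivity
  refine ⟨ht, hc, by rw [tcr, inv_inv], ?_⟩
  rw [c3, hG3, one_div, mul_right_comm, inv_mul_cancel₀ ht.ne', one_mul, ← Real.rpow_natCast,
    ← Real.rpow_mul (by positivity)]
  norm_num
  exact inv_mul_cancel₀ (by simpa using hm4.ne')

lemma tendsto_natCast_rpow_neg {p : ℝ} (hp : 0 < p) :
    Tendsto (fun n : ℕ => (n : ℝ) ^ (-p)) atTop (𝓝 0) :=
  (tendsto_rpow_neg_atTop hp).comp tendsto_natCast_atTop_atTop

/-- Control of the power sums of the rescaled inverse positions. -/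
lemma exists_power_sum_bounds (h : Assumption1 X μ ψ xs κ) (h2 : Assumption2 X μ)
    (h3 : Assumption3 X xs κ) (hκ : 3 < κ) :
    ∃ C : ℝ, 0 < C ∧ ∀ᶠ n : ℕ in atTop, (∀ j, X n j ≠ xs) ∧
      (∀ j, |locPts μ xs (X n) j| ≤ C * (n : ℝ) ^ (-rate κ)) ∧
      ∀ k, 1 ≤ k → k ≤ 4 →
        |∑ j, locPts μ xs (X n) j ^ k - n * scale μ xs n ^ k * ∫ s, 1 / (xs - s) ^ k ∂μ|
          ≤ C * (n : ℝ) ^ (-rate κ) := by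
  have hpos := critPos h h2 hκ
  obtain ⟨C, r₀, n₁, hC, hr₀, -, hmom⟩ := exists_moment_sub_le h h2 hκ
  obtain ⟨m, hm, n₂, hgap⟩ := h3
  set A : ℝ := c3 μ xs * tcr μ xs / m with hA
  have hApos : 0 < A := div_pos (mul_pos hpos.c3 hpos.tcr) hm
  have hκ1 : 0 < κ + 1 := by linarith
  refine ⟨A * (1 + C * (1 + m ^ (κ + 1))), by positivity, ?_⟩
  have hg0 : Tendsto (fun n : ℕ => m * (n : ℝ) ^ (-(1 / (κ + 1)))) atTop (𝓝 0) := by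
    simpa using (tendsto_natCast_rpow_neg (p := 1 / (κ + 1)) (by positivity)).const_mul m
  have hθ0 : Tendsto (fun n : ℕ => A * (n : ℝ) ^ (-rate κ)) atTop (𝓝 0) := by
    simpa using (tendsto_natCast_rpow_neg (rate_pos hκ)).const_mul A
  filter_upwards [eventually_ge_atTop n₁, eventually_ge_atTop n₂, eventually_gt_atTop 0,
    hg0.eventually_le_const hr₀, hθ0.eventually_le_const zero_lt_one] with n hn1 hn2 hn hgr hθ1
  have hnR : (0 : ℝ) < n := by exact_mod_cast hn
  set g : ℝ := m * (n : ℝ) ^ (-(1 / (κ + 1))) with hg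
  have hgpos : 0 < g := by positivity
  set lam := scale μ xs n with hlam
  set θ : ℝ := A * (n : ℝ) ^ (-rate κ) with hθ
  have hθpos : 0 < θ := by positivity
  have hlampos : 0 < lam := by
    have := hpos.c3
    have := hpos.tcr
    rw [hlam, scale]
    positivity
  -- The local scale is the gap `g` times a vanishing `θ`, while `n g^{κ+1}` is constant. So `n λ^k`
  -- times either moment error is a multiple of `θ^k ≤ θ`, for every `k` alike.
  have hlamg : lam = θ * g := by
    rw [hlam, hθ, hg, scale, hA, rate_eq hκ, mul_mul_mul_comm, ← Real.rpow_add hnR,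
      show -(1 / 4) + 1 / (κ + 1) + -(1 / (κ + 1)) = -(1 / 4 : ℝ) by ring,
      div_mul_cancel₀ _ hm.ne']
  have hng : (n : ℝ) * g ^ (κ + 1) = m ^ (κ + 1) := by
    rw [hg, Real.mul_rpow hm.le (by positivity), ← Real.rpow_mul hnR.le,
      show -(1 / (κ + 1)) * (κ + 1) = -1 by field_simp, Real.rpow_neg_one]
    field_simp
  have hgj := hgap n hn2
  have hfar : ∀ j, g ≤ |xs - X n j| := by
    intro j
    by_contra! hlt
    rw [abs_lt] at hlt
    exact hgj j ⟨by linarith [hlt.2], by linarith [hlt.1]⟩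
  have hrhs : A * (1 + C * (1 + m ^ (κ + 1))) * (n : ℝ) ^ (-rate κ)
      = θ * (1 + C * (1 + m ^ (κ + 1))) := by rw [hθ]; ring
  rw [hrhs]
  have hone : θ ≤ θ * (1 + C * (1 + m ^ (κ + 1))) :=
    le_mul_of_one_le_right hθpos.le (by
      have : 0 ≤ C * (1 + m ^ (κ + 1)) := by positivity
      linarith)
  refine ⟨fun j hj => ?_, fun j => ?_, fun k hk1 hk4 => ?_⟩
  · have := hfar j
    rw [hj, sub_self, abs_zero] at this
    linarith
  · refine le_trans ?_ hone
    rw [locPts, abs_div, ← hlam, abs_of_pos hlampos, hlamg]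
    rw [div_le_iff₀ (hgpos.trans_le (hfar j))]
    exact mul_le_mul_of_nonneg_left (hfar j) hθpos.le
  · have hb := (hmom k hk1 hk4).2 g hgpos hgr n hn1 hgj
    have e : ∑ j, locPts μ xs (X n) j ^ k - n * lam ^ k * ∫ s, 1 / (xs - s) ^ k ∂μ
        = n * lam ^ k * ((n : ℝ)⁻¹ * ∑ j, 1 / (xs - X n j) ^ k - ∫ s, 1 / (xs - s) ^ k ∂μ) := by
      have : ∑ j, locPts μ xs (X n) j ^ k = lam ^ k * ∑ j, 1 / (xs - X n j) ^ k := by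
        rw [Finset.mul_sum]
        exact Finset.sum_congr rfl fun j _ => by rw [locPts, div_pow, ← hlam]; ring
      rw [this]
      field_simp
    have hgk : g ^ (κ - k + 1) = g ^ (κ + 1) * (g ^ k)⁻¹ := by
      rw [show κ - k + 1 = κ + 1 - k by ring, Real.rpow_sub hgpos, Real.rpow_natCast,
        div_eq_mul_inv]
    have hgk0 : g ^ k ≠ 0 := by positivity
    rw [e, abs_mul, abs_of_pos (by positivity : 0 < n * lam ^ k)]
    calc n * lam ^ k * |(n : ℝ)⁻¹ * ∑ j, 1 / (xs - X n j) ^ k - ∫ s, 1 / (xs - s) ^ k ∂μ|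
        ≤ n * lam ^ k * (C * ((g ^ k)⁻¹ / n + g ^ (κ - k + 1))) := by gcongr
      _ = C * (θ ^ k * (g ^ k * (g ^ k)⁻¹) * (n / n)
            + θ ^ k * (g ^ k * (g ^ k)⁻¹) * (n * g ^ (κ + 1))) := by
          rw [hgk, hlamg, mul_pow]
          ring
      _ = θ ^ k * (C * (1 + m ^ (κ + 1))) := by
          rw [mul_inv_cancel₀ hgk0, div_self hnR.ne', hng]
          ring
      _ ≤ θ * (C * (1 + m ^ (κ + 1))) := by
          gcongr
          exact pow_le_of_le_one hθpos.le hθ1 (by omega)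
      _ ≤ _ := by
          gcongr
          linarith

/-- The fourth root of `n`, and the powers of `n` in terms of it. -/
lemma natCast_rpow_quarters {n : ℕ} :
    ∃ q : ℝ, 0 ≤ q ∧ (0 < n → 0 < q) ∧ (n : ℝ) = q ^ 4 ∧ (n : ℝ) ^ (-(1 / 4 : ℝ)) = q⁻¹ ∧
      (n : ℝ) ^ ((1 : ℝ) / 2) = q ^ 2 ∧ (n : ℝ) ^ ((3 : ℝ) / 4) = q ^ 3 := by
  have hn : (0 : ℝ) ≤ n := n.cast_nonneg
  refine ⟨(n : ℝ) ^ (1 / 4 : ℝ), by positivity, fun h => by positivity, ?_, ?_, ?_, ?_⟩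
  · rw [← Real.rpow_natCast, ← Real.rpow_mul hn]; norm_num
  · rw [Real.rpow_neg hn]
  · rw [← Real.rpow_natCast, ← Real.rpow_mul hn]; norm_num
  · rw [← Real.rpow_natCast, ← Real.rpow_mul hn]; norm_num

/-- For the prefactor `t_cr / √(st)` that survives the rescaling. -/
lemma abs_div_sqrt_sub_one_le {t₀ y₁ y₂ δ : ℝ} (ht : 0 < t₀) (h1 : |y₁| ≤ δ) (h2 : |y₂| ≤ δ)
    (hδ : δ ≤ 1 / 2) :
    |t₀ / Real.sqrt (t₀ * (1 + y₁) * (t₀ * (1 + y₂))) - 1| ≤ 6 * δ := by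
  have b1 := abs_le.mp (h1.trans hδ)
  have b2 := abs_le.mp (h2.trans hδ)
  have hδ0 : 0 ≤ δ := (abs_nonneg _).trans h1
  set w : ℝ := Real.sqrt ((1 + y₁) * (1 + y₂)) with hw
  have hprod : 1 / 4 ≤ (1 + y₁) * (1 + y₂) := by nlinarith [b1.1, b2.1]
  have hw2 : w ^ 2 = (1 + y₁) * (1 + y₂) := Real.sq_sqrt (by linarith)
  have hwhalf : 1 / 2 ≤ w := Real.le_sqrt_of_sq_le (by linarith)
  have e : t₀ / Real.sqrt (t₀ * (1 + y₁) * (t₀ * (1 + y₂))) - 1 = (1 - w) / w := by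
    rw [show t₀ * (1 + y₁) * (t₀ * (1 + y₂)) = t₀ ^ 2 * ((1 + y₁) * (1 + y₂)) by ring,
      Real.sqrt_mul (by positivity), Real.sqrt_sq ht.le, ← hw]
    have : w ≠ 0 := by linarith
    field_simp
  rw [e, abs_div, abs_of_pos (by linarith : 0 < w), div_le_iff₀ (by linarith)]
  have hw1 : |1 - w| ≤ |1 - w ^ 2| := by
    rw [show 1 - w ^ 2 = (1 - w) * (1 + w) by ring, abs_mul]
    refine le_mul_of_one_le_right (abs_nonneg _) ?_
    rw [abs_of_pos (by linarith)]
    linarith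
  have hw3 : |1 - w ^ 2| ≤ 3 * δ := by
    rw [hw2, show 1 - (1 + y₁) * (1 + y₂) = -(y₁ + y₂ + y₁ * y₂) by ring, abs_neg]
    refine (abs_add_three _ _ _).trans ?_
    rw [abs_mul]
    have : |y₁| * |y₂| ≤ δ * (1 / 2) := mul_le_mul h1 (h2.trans hδ) (abs_nonneg _) hδ0
    linarith
  nlinarith

set_option maxHeartbeats 400000 in
/-- The phase functions are close to those of the Pearcey kernel, uniformly in the parameters. -/
theorem exists_phaseClose (h : Assumption1 X μ ψ xs κ) (h2 : Assumption2 X μ)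
    (h3 : Assumption3 X xs κ) (hG : stieltjesD μ 2 xs = 0) (hκ : 3 < κ) {T M : ℝ} (hT : 0 ≤ T) :
    ∃ C : ℝ, 0 < C ∧ ∀ᶠ n : ℕ in atTop, 0 < n ∧ (∀ j, X n j ≠ xs) ∧
      (∀ j, |locPts μ xs (X n) j| ≤ C * (n : ℝ) ^ (-rate κ)) ∧
      (∀ τ, |τ| ≤ T → 0 < tP μ xs n τ ∧ ∀ v, |v| ≤ M →
        PhaseClose (locPts μ xs (X n)) (coef2 μ xs n (tP μ xs n τ)) (coef1 μ xs n (tP μ xs n τ) v)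
          (coef0 μ xs n (tP μ xs n τ) v) τ v (C * (n : ℝ) ^ (-rate κ))) ∧
      ∀ τ₁ τ₂, |τ₁| ≤ T → |τ₂| ≤ T →
        |tcr μ xs / Real.sqrt (tP μ xs n τ₁ * tP μ xs n τ₂) - 1| ≤ C * (n : ℝ) ^ (-rate κ) := by
  have hpos := critPos h h2 hκ
  have ht := hpos.tcr
  have hc := hpos.c3
  obtain ⟨C, hC, hev⟩ := exists_power_sum_bounds h h2 h3 hκ
  set a : ℝ := c3 μ xs with ha
  set t₀ : ℝ := tcr μ xs with ht₀
  -- `B n^{-1/2}` bounds the relative deviation of `tP` from the critical time.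
  set B : ℝ := T / (a ^ 2 * t₀) with hB
  have hB0 : 0 ≤ B := by positivity
  refine ⟨2 * C + M ^ 2 / (a ^ 2 * t₀) + 2 * B * (|M| + T) + 12 * B, by positivity, ?_⟩
  have hrate0 := rate_pos hκ
  have hsmall : Tendsto (fun n : ℕ => B * (n : ℝ) ^ (-(1 / 2 : ℝ))) atTop (𝓝 0) := by
    simpa using (tendsto_natCast_rpow_neg (p := 1 / 2) (by norm_num)).const_mul B
  have hCsmall : Tendsto (fun n : ℕ => C * (n : ℝ) ^ (-rate κ)) atTop (𝓝 0) := by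
    simpa using (tendsto_natCast_rpow_neg hrate0).const_mul C
  filter_upwards [hev, eventually_gt_atTop 0,
    hsmall.eventually_le_const (by norm_num : (0 : ℝ) < 1 / 2),
    hCsmall.eventually_le_const zero_lt_one] with n hn hn0 hBn hCn
  obtain ⟨hne, hloc, hsum⟩ := hn
  obtain ⟨q, -, hq, hn4, hnq, hn2, hn3⟩ := natCast_rpow_quarters (n := n)
  have hq0 := hq hn0
  have hn1R : (1 : ℝ) ≤ n := by exact_mod_cast hn0
  set ρ : ℝ := (n : ℝ) ^ (-rate κ) with hρ
  have hρ0 : 0 < ρ := by positivity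
  have hnhalf : (n : ℝ) ^ (-(1 / 2 : ℝ)) = (q ^ 2)⁻¹ := by
    rw [Real.rpow_neg (by positivity), hn2]
  have hqρ : (q ^ 2)⁻¹ ≤ ρ := by
    rw [← hnhalf, hρ]
    exact Real.rpow_le_rpow_of_exponent_le hn1R (by linarith [rate_lt hκ])
  rw [hnhalf] at hBn
  have hscale : scale μ xs n = a * t₀ / q := by rw [scale, hnq]; rfl
  have hbig : ∀ D, D ≤ 2 * C + M ^ 2 / (a ^ 2 * t₀) + 2 * B * (|M| + T) + 12 * B →
      D * ρ ≤ (2 * C + M ^ 2 / (a ^ 2 * t₀) + 2 * B * (|M| + T) + 12 * B) * ρ := fun D hD => by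
    gcongr
  have hM0 : 0 ≤ M ^ 2 / (a ^ 2 * t₀) := by positivity
  have hBM : 0 ≤ B * |M| := by positivity
  have hBT : 0 ≤ B * T := by positivity
  have htP : ∀ τ, tP μ xs n τ = t₀ * (1 + τ / (a ^ 2 * t₀) * (q ^ 2)⁻¹) := by
    intro τ
    rw [tP, hn2, ← ha, ← ht₀]
    field_simp
  have hτB : ∀ τ, |τ| ≤ T → |τ / (a ^ 2 * t₀) * (q ^ 2)⁻¹| ≤ B * (q ^ 2)⁻¹ := by
    intro τ hτ
    rw [abs_mul, abs_div, abs_of_pos (by positivity : 0 < a ^ 2 * t₀),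
      abs_of_pos (by positivity : 0 < (q ^ 2)⁻¹), hB]
    gcongr
  have hinv : ∀ y : ℝ, |y| ≤ B * (q ^ 2)⁻¹ → |1 - 1 / (1 + y)| ≤ 2 * B * (q ^ 2)⁻¹ := by
    intro y hy
    have hy1 : |y| ≤ 1 / 2 := hy.trans hBn
    have hy2 : 1 / 2 ≤ 1 + y := by linarith [(abs_le.mp hy1).1]
    have e : 1 - 1 / (1 + y) = y / (1 + y) := by field_simp; ring
    rw [e, abs_div, abs_of_pos (by linarith : 0 < 1 + y), div_le_iff₀ (by linarith)]
    have : 0 ≤ B * (q ^ 2)⁻¹ := by positivity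
    nlinarith
  refine ⟨hn0, hne, fun j => (hloc j).trans (hbig C (by linarith)), fun τ hτ => ?_,
    fun τ₁ τ₂ hτ₁ hτ₂ => ?_⟩
  · set y : ℝ := τ / (a ^ 2 * t₀) * (q ^ 2)⁻¹ with hy
    have hyB := hτB τ hτ
    have hy1 := hyB.trans hBn
    have hy2 : 1 / 2 ≤ 1 + y := by linarith [(abs_le.mp hy1).1]
    have hy0 : 0 < 1 + y := by linarith
    have htpos : 0 < tP μ xs n τ := by rw [htP]; positivity
    refine ⟨htpos, fun v hv => ?_⟩
    have hvM : |v| ≤ |M| := hv.trans (le_abs_self M)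
    have hiy := hinv y hyB
    have hS4 := hsum 4 (by norm_num) le_rfl
    have hS4' : |∑ j, locPts μ xs (X n) j ^ 4 - 1| ≤ C * ρ := by
      have e : (n : ℝ) * scale μ xs n ^ 4 * ∫ s, 1 / (xs - s) ^ 4 ∂μ = 1 := by
        have e2 : q ^ 4 * ((a * t₀) ^ 4 / q ^ 4) = (a * t₀) ^ 4 := by field_simp
        rw [hscale, div_pow, hn4, e2]
        exact hpos.m4
      rwa [e] at hS4
    refine ⟨?_, ?_, ?_, ?_, ?_, ?_⟩
    · have e : coef0 μ xs n (tP μ xs n τ) v = v ^ 2 / (a ^ 2 * t₀) * (1 / (2 * (1 + y))) *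
          (q ^ 2)⁻¹ := by
        rw [coef0, locSpace, htP, ← hy, hn3, hn4, ← ha]
        field_simp
      rw [e, abs_of_nonneg (by positivity)]
      have h1 : 1 / (2 * (1 + y)) ≤ 1 := by
        rw [div_le_one (by positivity)]; linarith
      have h2 : v ^ 2 ≤ M ^ 2 := sq_le_sq' (by linarith [(abs_le.mp hv).1])
        ((le_abs_self v).trans hv)
      calc v ^ 2 / (a ^ 2 * t₀) * (1 / (2 * (1 + y))) * (q ^ 2)⁻¹
          ≤ M ^ 2 / (a ^ 2 * t₀) * 1 * ρ := by gcongr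
        _ ≤ _ := by rw [mul_one]; exact hbig _ (by linarith)
    -- The `G₀` term of `coef1` cancels the first power sum; the rest is `v / (1 + y)`, where `1 +
    -- y` is the ratio of `tP` to `t_cr`.
    · have e : ∑ j, locPts μ xs (X n) j - coef1 μ xs n (tP μ xs n τ) v + v
          = (∑ j, locPts μ xs (X n) j ^ 1 - n * scale μ xs n ^ 1 * ∫ s, 1 / (xs - s) ^ 1 ∂μ)
            + v * (1 - 1 / (1 + y)) := by
        have e1 : stieltjesD μ 0 xs = ∫ s, 1 / (xs - s) ^ 1 ∂μ := by simp [stieltjesD]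
        have e2 : coef1 μ xs n (tP μ xs n τ) v
            = n * scale μ xs n * stieltjesD μ 0 xs + v * (1 / (1 + y)) := by
          rw [coef1, mul_add, locSpace, htP, ← hy, hn3, hscale, ← ha]
          congr 1
          rw [hn4]
          field_simp
        rw [e2, e1]
        simp only [pow_one]
        ring
      rw [e]
      refine (abs_add_le _ _).trans ?_
      have h1 := hsum 1 le_rfl (by norm_num)
      have h2 : |v * (1 - 1 / (1 + y))| ≤ |M| * (2 * B * ρ) := by
        rw [abs_mul]
        gcongr
        exact hiy.trans (by gcongr)
      calc _ ≤ C * ρ + |M| * (2 * B * ρ) := add_le_add h1 h2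
        _ = (C + 2 * B * |M|) * ρ := by ring
        _ ≤ _ := hbig _ (by linarith)
    -- By definition of `t_cr` the quadratic terms cancel to leading order; the time shift leaves
    -- `-τ/2`.
    · have e : coef2 μ xs n (tP μ xs n τ) - (∑ j, locPts μ xs (X n) j ^ 2) / 2 + τ / 2
          = -(∑ j, locPts μ xs (X n) j ^ 2 - n * scale μ xs n ^ 2 * ∫ s, 1 / (xs - s) ^ 2 ∂μ) / 2
            + τ / 2 * (1 - 1 / (1 + y)) := by
        have e2 : coef2 μ xs n (tP μ xs n τ)
            = n * scale μ xs n ^ 2 * t₀⁻¹ / 2 - τ / 2 * (1 / (1 + y)) := by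
          have hyq : τ = y * (a ^ 2 * t₀ * q ^ 2) := by
            rw [hy]; field_simp
          rw [coef2, htP, ← hy, hscale, hyq, hn4]
          field_simp
          ring
        rw [e2, hpos.m2, ← ht₀]
        ring
      rw [e]
      refine (abs_add_le _ _).trans ?_
      have h1 := hsum 2 (by norm_num) (by norm_num)
      have h2 : |τ / 2 * (1 - 1 / (1 + y))| ≤ T * (2 * B * ρ) := by
        rw [abs_mul]
        have : |τ / 2| ≤ T := by
          rw [abs_div, abs_two]; linarith [abs_nonneg τ]
        gcongr
        exact hiy.trans (by gcongr)
      have h3 : |-(∑ j, locPts μ xs (X n) j ^ 2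
          - n * scale μ xs n ^ 2 * ∫ s, 1 / (xs - s) ^ 2 ∂μ) / 2| ≤ C * ρ := by
        rw [abs_div, abs_neg, abs_two]
        have : 0 ≤ C * ρ := by positivity
        linarith
      calc _ ≤ C * ρ + T * (2 * B * ρ) := add_le_add h3 h2
        _ = (C + 2 * B * T) * ρ := by ring
        _ ≤ _ := hbig _ (by linarith)
    -- Here `G₂ = 0` is essential: `n λ³` still grows like `n^{1/4}`.
    · have e : ∫ s, 1 / (xs - s) ^ 3 ∂μ = 0 := by
        rw [stieltjesD] at hG
        simpa [Nat.factorial] using hG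
      have := hsum 3 (by norm_num) (by norm_num)
      rw [e, mul_zero, sub_zero] at this
      exact this.trans (hbig C (by linarith))
    · exact hS4'.trans (hbig C (by linarith))
    -- The fifth powers are bounded by the largest `|b_j|` times the bounded fourth power sum.
    · have h4 : ∑ j, locPts μ xs (X n) j ^ 4 ≤ 2 := by
        have := (abs_le.mp hS4').2
        linarith
      calc ∑ j, |locPts μ xs (X n) j| ^ 5 ≤ ∑ j, C * ρ * locPts μ xs (X n) j ^ 4 := by
            refine Finset.sum_le_sum fun j _ => ?_
            rw [pow_succ', (by decide : Even 4).pow_abs]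
            exact mul_le_mul_of_nonneg_right (hloc j) (by positivity)
        _ = C * ρ * ∑ j, locPts μ xs (X n) j ^ 4 := by rw [Finset.mul_sum]
        _ ≤ C * ρ * 2 := by gcongr
        _ = 2 * C * ρ := by ring
        _ ≤ _ := hbig _ (by linarith)
  · rw [htP, htP]
    refine (abs_div_sqrt_sub_one_le ht (hτB τ₁ hτ₁) (hτB τ₂ hτ₂) hBn).trans ?_
    calc 6 * (B * (q ^ 2)⁻¹) ≤ 6 * (B * ρ) := by gcongr
      _ = 6 * B * ρ := by ring
      _ ≤ _ := hbig _ (by linarith)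

end asymptotics

end

/-! ### Rotating the Pearcey contour onto the wedge. -/

noncomputable section

lemma rayInt_ofReal_mul {k : ℝ} (hk : 0 < k) (a : ℂ) (f : ℂ → ℂ) :
    rayInt (k * a) f = rayInt a f := by
  have h := integral_comp_mul_left_Ioi' (fun r : ℝ => f (r * a) * a) 0 hk
  rw [mul_zero] at h
  rw [rayInt, rayInt, ← h, ← integral_smul]
  refine integral_congr_ae (ae_of_all _ fun r => ?_)
  simp only [Complex.real_smul]
  push_cast
  ring_nf

lemma IsCycle.div_sub_eq_zero {I : (ℂ → ℂ) → ℂ} {K : Set ℂ} (hI : IsCycle I K) {z : ℂ}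
    (hz : z ∉ K) (h : I (fun w => 1 / (w - z)) = 0) {E : ℂ → ℂ} (hE : Differentiable ℂ E) :
    I (fun w => E w / (z - w)) = 0 := by
  have hne : ∀ w ∈ K, w - z ≠ 0 := fun w hw h => hz (by rwa [← sub_eq_zero.mp h])
  have hd := differentiable_dslope hE z
  have h1 : I (fun w => E w / (z - w))
      = I (fun w => (-E z) * (1 / (w - z)) + (-1) * dslope E z w) := by
    refine hI.congr _ _ fun w hw => ?_
    have := hne w hw
    rw [eq_add_mul_dslope E z w, ← neg_sub w z]
    field_simp
    ring
  rw [h1, hI.add, hI.smul, hI.smul, h, hI.entire hd, mul_zero, mul_zero, add_zero]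
  · exact continuousOn_const.mul (continuousOn_const.div (by fun_prop) hne)
  · exact continuousOn_const.mul hd.continuous.continuousOn

lemma re_nonneg_of_mem_triSet {a b w : ℂ} {c R : ℝ} (hR : 0 < R) (ha : c * a.re = 1)
    (hb : c * b.re = 1) (hw : w ∈ triSet 0 (0 + R * a) (0 + R * b)) : w = 0 ∨ 0 < c * w.re := by
  have key : ∀ r : ℝ, c * (r * (R * a.re)) = r * R := fun r => by linear_combination r * R * ha
  have key' : ∀ r : ℝ, c * (r * (R * b.re)) = r * R := fun r => by linear_combination r * R * hb
  rcases hw with (⟨r, hr, rfl⟩ | ⟨r, hr, rfl⟩) | ⟨r, hr, rfl⟩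
  · rcases eq_or_lt_of_le hr.1 with rfl | hr0
    · simp [seg]
    · right
      simp [seg, key]
      positivity
  · right
    have : c * (seg (0 + R * a) (0 + R * b) r).re = R := by
      simp [seg]
      linear_combination (R - r * R) * ha + r * R * hb
    rw [this]
    exact hR
  · rcases eq_or_lt_of_le hr.2 with rfl | hr1
    · simp [seg]
    · right
      have : c * (seg (0 + R * b) 0 r).re = (1 - r) * R := by
        simp [seg]
        linear_combination (R - r * R) * hb
      rw [this]
      exact mul_pos (by linarith) hR

/-- A ray integral with a Cauchy factor can be rotated within a sector of Gaussian decay. -/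
lemma rayInt_rotate {E : ℂ → ℂ} (hE : Differentiable ℂ E) {a b : ℂ} {c η : ℝ} (hη : η ≠ 0)
    (ha : c * a.re = 1) (hb : c * b.re = 1) {C β : ℝ} (hβ : 0 < β)
    (hbd : ∀ R ≥ (1 : ℝ), ∀ σ ∈ Icc (0 : ℝ) 1,
      ‖E (R * (a + σ * (b - a)))‖ ≤ C * Real.exp (-β * R ^ 2)) :
    rayInt a (fun ω => E ω / (η * Complex.I - ω)) = rayInt b (fun ω => E ω / (η * Complex.I - ω)) := by
  have hc : c ≠ 0 := left_ne_zero_of_mul (ha ▸ one_ne_zero)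
  have hcont : ∀ d : ℂ, c * d.re = 1 → ContinuousOn
      (fun r : ℝ => E (0 + r * d) / (η * Complex.I - (0 + r * d))) (Ici 0) := by
    intro d hd
    have := hE.continuous
    refine ContinuousOn.div (by fun_prop) (by fun_prop) fun r hr h => ?_
    have him := congrArg Complex.im h
    have hre := congrArg Complex.re h
    have hd0 : d.re ≠ 0 := right_ne_zero_of_mul (hd ▸ one_ne_zero)
    rcases eq_or_ne r 0 with rfl | hr0
    · simp [hη] at him
    · simp [hr0, hd0] at hre
  have hl := tendsto_triInt (f := fun ω => E ω / (η * Complex.I - ω)) (p := 0) (a := a) (b := b)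
    (C := |c| * C) (R₀ := 1) (hcont a ha) (hcont b hb) hβ ?_
  · have hz : ∀ᶠ R : ℝ in atTop, triInt 0 (0 + R * a) (0 + R * b)
        (fun ω => E ω / (η * Complex.I - ω)) = 0 := by
      filter_upwards [eventually_gt_atTop 0] with R hR
      have hmem : ∀ w ∈ triSet 0 (0 + R * a) (0 + R * b),
          c * (w - η * Complex.I) ∈ Complex.slitPlane := by
        intro w hw
        rcases re_nonneg_of_mem_triSet hR ha hb hw with rfl | h
        · right
          simp [hη, hc]
        · left
          simpa using h
      have hcy := isCycle_triInt 0 (0 + R * a) (0 + R * b)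
      have hzK : (η * Complex.I : ℂ) ∉ triSet 0 (0 + R * a) (0 + R * b) := by
        intro h
        have := Complex.slitPlane_ne_zero (hmem _ h)
        simp at this
      refine hcy.div_sub_eq_zero hzK ?_ hE
      refine hcy.one_div_eq_zero_of_slitPlane ?_
      rcases lt_or_gt_of_ne hc with h | h
      · right
        intro w hw
        have h1 := hmem w hw
        rw [show (c : ℂ) * (w - η * Complex.I) = ((-c : ℝ) : ℂ) * (η * Complex.I - w) by
          push_cast; ring] at h1
        simp only [Complex.mem_slitPlane_iff, Complex.re_ofReal_mul, Complex.im_ofReal_mul] at h1 ⊢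
        exact h1.imp (fun h2 => pos_of_mul_pos_right h2 (by linarith)) right_ne_zero_of_mul
      · left
        intro w hw
        have h1 := hmem w hw
        simp only [Complex.mem_slitPlane_iff, Complex.re_ofReal_mul, Complex.im_ofReal_mul] at h1 ⊢
        exact h1.imp (fun h2 => pos_of_mul_pos_right h2 h.le) right_ne_zero_of_mul
    have := tendsto_nhds_unique (hl.congr' hz) tendsto_const_nhds
    simpa [sub_eq_zero] using this
  · intro R hR σ hσ
    rw [zero_add, norm_div]
    -- Both directions are normalised by `c * re = 1`, so points of the segment at parameter `R`
    -- share one real part and stay away from the pole on the imaginary axis.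
    have h1 : 1 ≤ |c| * ‖(η * Complex.I - R * (a + σ * (b - a)) : ℂ)‖ := by
      have h2 := Complex.abs_re_le_norm (η * Complex.I - R * (a + σ * (b - a)) : ℂ)
      have h3 : c * (η * Complex.I - R * (a + σ * (b - a)) : ℂ).re = -R := by
        simp
        linear_combination (R - R * σ) * ha + R * σ * hb
      calc (1 : ℝ) ≤ R := hR
        _ ≤ |c * (η * Complex.I - R * (a + σ * (b - a)) : ℂ).re| := by
          rw [h3, abs_neg]; exact le_abs_self R
        _ ≤ _ := by
          rw [abs_mul]; gcongr
    have hc0 : 0 < |c| := abs_pos.mpr hc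
    have h4 : 0 < ‖(η * Complex.I - R * (a + σ * (b - a)) : ℂ)‖ :=
      pos_of_mul_pos_right (by linarith) hc0.le
    rw [div_le_iff₀ h4]
    have h5 := hbd R hR σ hσ
    have h6 := mul_le_mul_of_nonneg_left h1 ((norm_nonneg _).trans h5)
    linarith

/-- `|y|` is the tangent of an angle between `π/6` and `π/4`. There `Re (1+iy)⁴ = 1 - 6y² + y⁴ ≤
-8/9`, with equality at `y² = 1/3`, and the quartic decay absorbs the lower terms. -/
lemma norm_exp_neg_pearceyPhase_le {τ u R y : ℝ} (hy : 1 / 3 ≤ y ^ 2) (hy' : y ^ 2 ≤ 1) {c : ℝ}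
    (hc : c * c = 1) :
    ‖Complex.exp (-pearceyPhase τ u (R * (c * (1 + y * Complex.I))))‖
      ≤ Real.exp (9 / 2 * (2 + |τ| + |u|) ^ 2 + |u|) * Real.exp (-1 * R ^ 2) := by
  rw [Complex.norm_exp, ← Real.exp_add]
  refine Real.exp_le_exp.mpr ?_
  have hc1 : |c| = 1 := by
    rcases mul_self_eq_one_iff.mp hc with rfl | rfl <;> simp
  have e : (-pearceyPhase τ u (R * (c * (1 + y * Complex.I)))).re
      = R ^ 4 * (1 - 6 * y ^ 2 + (y ^ 2) ^ 2) / 4 + τ / 2 * (R ^ 2 * (1 - y ^ 2)) + u * c * R := by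
    have h1 : -pearceyPhase τ u (R * (c * (1 + y * Complex.I)))
        = ((R ^ 4 / 4 : ℝ) : ℂ) * (1 + y * Complex.I) ^ 4
          + ((τ / 2 * R ^ 2 : ℝ) : ℂ) * (1 + y * Complex.I) ^ 2
          + ((u * c * R : ℝ) : ℂ) * (1 + y * Complex.I) := by
      have hcC : (c : ℂ) * c = 1 := by exact_mod_cast hc
      rw [pearceyPhase]
      push_cast
      linear_combination ((R : ℂ) ^ 4 / 4 * (1 + y * Complex.I) ^ 4 * (c ^ 2 + 1)
        + τ / 2 * R ^ 2 * (1 + y * Complex.I) ^ 2) * hcC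
    rw [h1]
    simp only [Complex.add_re, Complex.re_ofReal_mul]
    simp [pow_succ]
    ring
  rw [e]
  have h4 : R ^ 4 * (1 - 6 * y ^ 2 + (y ^ 2) ^ 2) ≤ R ^ 4 * (-(8 / 9)) := by
    refine mul_le_mul_of_nonneg_left ?_ (by positivity)
    nlinarith
  have h2 : τ / 2 * (R ^ 2 * (1 - y ^ 2)) ≤ |τ| * R ^ 2 := by
    have h3 : 0 ≤ R ^ 2 * (1 - y ^ 2) := mul_nonneg (sq_nonneg R) (by linarith)
    have h5 : R ^ 2 * (1 - y ^ 2) ≤ R ^ 2 := by nlinarith [sq_nonneg R, sq_nonneg y]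
    have := le_abs_self τ
    have := abs_nonneg τ
    nlinarith
  have h1 : u * c * R ≤ |u| * (1 + R ^ 2) := by
    refine (le_abs_self _).trans ?_
    rw [abs_mul, abs_mul, hc1, mul_one]
    refine mul_le_mul_of_nonneg_left ?_ (abs_nonneg u)
    rw [← sq_abs R]
    nlinarith [sq_nonneg (|R| - 1)]
  nlinarith [sq_nonneg (R ^ 2 - 9 / 4 * (2 + |τ| + |u|)), abs_nonneg τ, abs_nonneg u]

/-- The Pearcey contour may be replaced by the wedge contour. -/
lemma pearceyContourInt_eq_wedgeInt (τ u : ℝ) {η : ℝ} (hη : η ≠ 0) :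
    pearceyContourInt (fun ω => Complex.exp (-pearceyPhase τ u ω) / (η * Complex.I - ω))
      = wedgeInt (fun ω => Complex.exp (-pearceyPhase τ u ω) / (η * Complex.I - ω)) := by
  have hE : Differentiable ℂ fun ω => Complex.exp (-pearceyPhase τ u ω) := by
    unfold pearceyPhase
    fun_prop
  have h3 : 0 < Real.sqrt 3 := by positivity
  have h3sq : Real.sqrt 3 * Real.sqrt 3 = 3 := Real.mul_self_sqrt (by norm_num)
  have h31 : 1 ≤ Real.sqrt 3 := Real.one_le_sqrt.mpr (by norm_num)
  have h2 : 0 < Real.sqrt 2 / 2 := by positivity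
  -- The signs `c` and `e` enumerate the four rays; the slope moves from `e` to `e / √3`.
  have hrot : ∀ c e : ℝ, c * c = 1 → e * e = 1 →
      rayInt (c * (1 + e * Complex.I)) (fun ω => Complex.exp (-pearceyPhase τ u ω) / (η * Complex.I - ω))
      = rayInt (c * (1 + (e / Real.sqrt 3 : ℝ) * Complex.I))
        (fun ω => Complex.exp (-pearceyPhase τ u ω) / (η * Complex.I - ω)) := by
    intro c e hc he
    refine rayInt_rotate (c := c) (C := Real.exp (9 / 2 * (2 + |τ| + |u|) ^ 2 + |u|)) hE hη
      (by simpa using hc) (by simpa using hc) one_pos fun R _ σ hσ => ?_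
    have e1 : (c * (1 + e * Complex.I) + σ * (c * (1 + (e / Real.sqrt 3 : ℝ) * Complex.I)
        - c * (1 + e * Complex.I)) : ℂ)
        = c * (1 + ((e * (1 - σ * (1 - 1 / Real.sqrt 3)) : ℝ) : ℂ) * Complex.I) := by
      push_cast
      ring
    rw [e1]
    have hq : (1 / Real.sqrt 3) ^ 2 = 1 / 3 := by
      rw [div_pow, one_pow, pow_two, h3sq]
    have hq1 : 1 / Real.sqrt 3 ≤ 1 := by rw [div_le_one h3]; exact h31
    have hq0 : 0 < 1 / Real.sqrt 3 := by positivity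
    have hy : (e * (1 - σ * (1 - 1 / Real.sqrt 3))) ^ 2 = (1 - σ * (1 - 1 / Real.sqrt 3)) ^ 2 := by
      rw [mul_pow, pow_two e, he, one_mul]
    have hl : 1 / Real.sqrt 3 ≤ 1 - σ * (1 - 1 / Real.sqrt 3) := by nlinarith [hσ.1, hσ.2]
    have hr : 1 - σ * (1 - 1 / Real.sqrt 3) ≤ 1 := by nlinarith [hσ.1, hσ.2]
    refine norm_exp_neg_pearceyPhase_le ?_ ?_ hc
    · rw [hy, ← hq]
      gcongr
    · rw [hy]
      exact pow_le_one₀ (by linarith) hr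
  have d1 : Complex.exp ((Real.pi : ℂ) / 4 * Complex.I)
      = (Real.sqrt 2 / 2 : ℝ) * ((1 : ℝ) * (1 + (1 : ℝ) * Complex.I)) := by
    rw [show (Real.pi : ℂ) / 4 = ((Real.pi / 4 : ℝ) : ℂ) by push_cast; ring, Complex.exp_mul_I,
      ← Complex.ofReal_cos, ← Complex.ofReal_sin, Real.cos_pi_div_four, Real.sin_pi_div_four]
    push_cast
    ring
  have d2 : Complex.exp (-((Real.pi : ℂ) / 4 * Complex.I))
      = (Real.sqrt 2 / 2 : ℝ) * ((1 : ℝ) * (1 + (-1 : ℝ) * Complex.I)) := by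
    rw [show -((Real.pi : ℂ) / 4 * Complex.I) = ((-(Real.pi / 4) : ℝ) : ℂ) * Complex.I by
        push_cast; ring, Complex.exp_mul_I, ← Complex.ofReal_cos, ← Complex.ofReal_sin,
      Real.cos_neg, Real.sin_neg, Real.cos_pi_div_four, Real.sin_pi_div_four]
    push_cast
    ring
  have d3 : dirP = (Real.sqrt 3 / 2 : ℝ) * ((1 : ℝ) * (1 + ((1 : ℝ) / Real.sqrt 3 : ℝ) * Complex.I)) := by
    apply Complex.ext
    · simp
    · simp; field_simp; rw [pow_two, h3sq]
  have d4 : dirM = (Real.sqrt 3 / 2 : ℝ) * ((1 : ℝ) * (1 + ((-1 : ℝ) / Real.sqrt 3 : ℝ) * Complex.I)) := by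
    apply Complex.ext
    · simp
    · simp; field_simp
  have hneg : ∀ k e : ℝ, -((k : ℂ) * ((1 : ℝ) * (1 + e * Complex.I)))
      = k * ((-1 : ℝ) * (1 + e * Complex.I)) := by
    intro k e
    push_cast
    ring
  have h3' : 0 < Real.sqrt 3 / 2 := by positivity
  rw [pearceyContourInt, wedgeInt, d1, d2, d3, d4, hneg, hneg, hneg, hneg]
  simp only [rayInt_ofReal_mul h2, rayInt_ofReal_mul h3']
  rw [hrot 1 1, hrot 1 (-1), hrot (-1) 1, hrot (-1) (-1)] <;> norm_num

end

/-! ### Exact change to local variables. -/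

noncomputable section

lemma isSteep_dirP (r : ℝ) : IsSteep 1 (r * dirP) :=
  (isSteep_of_sq (by rw [dirP_re, div_pow, Real.sq_sqrt] <;> norm_num)
    (by rw [dirP_im]; norm_num)).mul_real r

lemma isSteep_dirM (r : ℝ) : IsSteep 1 (r * dirM) :=
  (isSteep_of_sq (by rw [dirM_re, div_pow, Real.sq_sqrt] <;> norm_num)
    (by rw [dirM_im]; norm_num)).mul_real r

lemma isSteep_neg_dirP (r : ℝ) : IsSteep 1 (r * -dirP) := by
  simpa using isSteep_dirP (-r)

lemma isSteep_neg_dirM (r : ℝ) : IsSteep 1 (r * -dirM) := by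
  simpa using isSteep_dirM (-r)

lemma rayInt_congr {d : ℂ} {f g : ℂ → ℂ} (h : ∀ r : ℝ, 0 < r → f (r * d) = g (r * d)) :
    rayInt d f = rayInt d g :=
  setIntegral_congr_fun measurableSet_Ioi fun r hr => by simp only [h r hr]

lemma wedgeInt_congr {f g : ℂ → ℂ} (h : ∀ ω, IsSteep 1 ω → f ω = g ω) :
    wedgeInt f = wedgeInt g := by
  rw [wedgeInt, rayInt_congr fun r _ => h _ (isSteep_dirP r),
    rayInt_congr fun r _ => h _ (isSteep_dirM r), rayInt_congr fun r _ => h _ (isSteep_neg_dirP r),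
    rayInt_congr fun r _ => h _ (isSteep_neg_dirM r), wedgeInt]

lemma rayInt_const_mul (d c : ℂ) (f : ℂ → ℂ) :
    rayInt d (fun ω => c * f ω) = c * rayInt d f := by
  simp only [rayInt, mul_assoc, integral_const_mul]

lemma wedgeInt_const_mul (c : ℂ) (f : ℂ → ℂ) :
    wedgeInt (fun ω => c * f ω) = c * wedgeInt f := by
  simp only [wedgeInt, rayInt_const_mul]
  ring

lemma lineInt_const_mul (x : ℝ) (c : ℂ) (f : ℂ → ℂ) :
    lineInt x (fun ω => c * f ω) = c * lineInt x f := by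
  simp only [lineInt, mul_assoc, integral_const_mul]

lemma rayInt_scale {k : ℝ} (hk : 0 < k) (d : ℂ) (f : ℂ → ℂ) :
    rayInt d f = k * rayInt d (fun ω => f (k * ω)) := by
  rw [← rayInt_ofReal_mul hk, rayInt, rayInt, ← integral_const_mul]
  refine integral_congr_ae (ae_of_all _ fun r => ?_)
  simp only
  rw [mul_left_comm (r : ℂ)]
  ring

lemma wedgeInt_scale {k : ℝ} (hk : 0 < k) (f : ℂ → ℂ) :
    wedgeInt f = k * wedgeInt (fun ω => f (k * ω)) := by
  rw [wedgeInt, rayInt_scale hk dirM, rayInt_scale hk (-dirM), rayInt_scale hk dirP,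
    rayInt_scale hk (-dirP), wedgeInt]
  ring

lemma lineInt_scale {k : ℝ} (hk : 0 < k) (x : ℝ) (f : ℂ → ℂ) :
    lineInt x f = k * lineInt 0 (fun ζ => f (x + k * ζ)) := by
  have h := Measure.integral_comp_mul_left
    (fun r : ℝ => f ((x : ℂ) + (r : ℂ) * Complex.I) * Complex.I) k
  rw [abs_of_pos (inv_pos.mpr hk), Complex.real_smul] at h
  have h2 : lineInt 0 (fun ζ => f (x + k * ζ))
      = ∫ r : ℝ, f ((x : ℂ) + ((k * r : ℝ) : ℂ) * Complex.I) * Complex.I := by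
    refine integral_congr_ae (ae_of_all _ fun r => ?_)
    simp only
    push_cast
    ring_nf
  rw [h2, h, lineInt, ← mul_assoc, ← Complex.ofReal_mul, mul_inv_cancel₀ hk.ne',
    Complex.ofReal_one, one_mul]

/-- The null point `η = 0` is left out because there the line meets the vertex of the wedge. -/
lemma lineInt_congr {x : ℝ} {f g : ℂ → ℂ}
    (h : ∀ η : ℝ, η ≠ 0 → f (x + η * Complex.I) = g (x + η * Complex.I)) :
    lineInt x f = lineInt x g := by
  refine integral_congr_ae ?_
  filter_upwards [compl_mem_ae_iff.mpr (measure_singleton (0 : ℝ))] with r hr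
  simp only [h r hr]

/-- The double integral over the imaginary axis and the wedge contour with phase functions
`A` and `B`. -/
def saddleInt (A B : ℂ → ℂ) : ℂ :=
  lineInt 0 (fun ζ => wedgeInt (fun ω => Complex.exp (A ζ - B ω) / (ζ - ω)))

lemma saddleInt_pearcey (τ₁ τ₂ u v : ℝ) :
    lineInt 0 (fun ζ => pearceyContourInt (fun ω =>
      Complex.exp (-(ζ ^ 4 / 4) - (τ₂ : ℂ) * ζ ^ 2 / 2 - (v : ℂ) * ζ
        + ω ^ 4 / 4 + (τ₁ : ℂ) * ω ^ 2 / 2 + (u : ℂ) * ω) / (ζ - ω)))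
      = saddleInt (pearceyPhase τ₂ v) (pearceyPhase τ₁ u) := by
  have key : ∀ ζ ω : ℂ, Complex.exp (-(ζ ^ 4 / 4) - (τ₂ : ℂ) * ζ ^ 2 / 2 - (v : ℂ) * ζ
        + ω ^ 4 / 4 + (τ₁ : ℂ) * ω ^ 2 / 2 + (u : ℂ) * ω) / (ζ - ω)
      = Complex.exp (pearceyPhase τ₂ v ζ) * (Complex.exp (-pearceyPhase τ₁ u ω) / (ζ - ω)) := by
    intro ζ ω
    rw [mul_div_assoc', ← Complex.exp_add]
    simp only [pearceyPhase]
    ring_nf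
  have key2 : ∀ ζ ω : ℂ, Complex.exp (pearceyPhase τ₂ v ζ - pearceyPhase τ₁ u ω) / (ζ - ω)
      = Complex.exp (pearceyPhase τ₂ v ζ) * (Complex.exp (-pearceyPhase τ₁ u ω) / (ζ - ω)) := by
    intro ζ ω
    rw [mul_div_assoc', ← Complex.exp_add, sub_eq_add_neg]
  refine lineInt_congr fun η hη => ?_
  simp only [key, key2, wedgeInt_const_mul, Complex.ofReal_zero, zero_add]
  rw [← pearceyContourInt_eq_wedgeInt τ₁ u hη]
  simp only [pearceyContourInt, rayInt_const_mul]
  ring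

section localization

variable {n : ℕ} {X : Fin n → ℝ} {μ : Measure ℝ} {xs : ℝ}

/-- In the local variable the saddle-point exponential becomes the exponential of the phase. -/
lemma exp_mul_nodal_eq (hX : ∀ j, X j ≠ xs) {t v : ℝ} (ht : t ≠ 0) {ζ : ℂ}
    (hζ : ‖ζ‖ ≤ 2 * |ζ.im|) :
    Complex.exp ((n / (2 * t) : ℝ)
        * (xs + scale μ xs n * ζ - (xs + t * stieltjesD μ 0 xs + locSpace μ xs n v : ℝ)) ^ 2)
      * nodal (points X) (xs + scale μ xs n * ζ)
      * Complex.exp (gauge μ xs n t (xs + t * stieltjesD μ 0 xs + locSpace μ xs n v) : ℝ)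
    = Complex.exp (phase (locPts μ xs X) (coef2 μ xs n t) (coef1 μ xs n t v) (coef0 μ xs n t v) ζ)
      * ((∏ j, (xs - X j : ℂ)) * Complex.exp (-(n * stieltjesD μ 0 xs * xs))) := by
  have hprod : nodal (points X) (xs + scale μ xs n * ζ)
      = (∏ j, (xs - X j : ℂ)) * Complex.exp (∑ j, Complex.log (1 + locPts μ xs X j * ζ)) := by
    rw [nodal_points, Complex.exp_sum, ← Finset.prod_mul_distrib]
    refine Finset.prod_congr rfl fun j _ => ?_
    rw [Complex.exp_log
      (Complex.slitPlane_ne_zero (one_add_mem_slitPlane (norm_smul_le_im hζ _)))]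
    have : (xs - X j : ℂ) ≠ 0 := by
      rw [sub_ne_zero]
      exact_mod_cast (hX j).symm
    rw [locPts]
    push_cast
    field_simp
    ring
  have htC : (t : ℂ) ≠ 0 := by exact_mod_cast ht
  rw [hprod, phase, Complex.exp_add]
  have e : ∀ a b c d f g : ℂ, Complex.exp a * Complex.exp b = Complex.exp c * Complex.exp d →
      Complex.exp a * (f * g) * Complex.exp b = Complex.exp c * g * (f * Complex.exp d) := by
    intro a b c d f g h
    linear_combination f * g * h
  refine e _ _ _ _ _ _ ?_
  rw [← Complex.exp_add, ← Complex.exp_add]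
  -- On expanding the square, the gauge cancels everything constant in `ζ` except `coef0` and `-n G₀
  -- x*`. The latter depends on neither time nor position and drops out of the quotient of the `z`
  -- and `w` factors.
  congr 1
  rw [coef2, coef1, coef0, gauge]
  push_cast
  field_simp
  ring

/-- Exact local form of the main term of the kernel. -/
lemma lineInt_curveInt_eq_saddleInt (hn : 0 < n) (hpos : CritPos μ xs) (hX : ∀ j, X j ≠ xs)
    {s t u v : ℝ} (hs : 0 < s) (ht : 0 < t) {x₀ : ℝ} {m : ℕ} {γ : Fin m → ℝ → ℂ}
    (hγ : Admissible X x₀ γ) {x y : ℝ}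
    (hx : x = xs + s * stieltjesD μ 0 xs + locSpace μ xs n u)
    (hy : y = xs + t * stieltjesD μ 0 xs + locSpace μ xs n v) :
    lineInt x₀ (fun z => ∑ i, curveInt (γ i) (fun w =>
      Complex.exp
        ((n : ℂ) / (2 * (t : ℂ)) * ((z - (y : ℂ)) ^ 2 + 2 * (t : ℂ) * logPotential X z)
          - (n : ℂ) / (2 * (s : ℂ)) * ((w - (x : ℂ)) ^ 2 + 2 * (s : ℂ) * logPotential X w))
        / (z - w))) * Complex.exp (gauge μ xs n t y - gauge μ xs n s x : ℝ)
    = scale μ xs n * saddleInt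
        (phase (locPts μ xs X) (coef2 μ xs n t) (coef1 μ xs n t v) (coef0 μ xs n t v))
        (phase (locPts μ xs X) (coef2 μ xs n s) (coef1 μ xs n s u) (coef0 μ xs n s u)) := by
  have hnR : (0 : ℝ) < n := by exact_mod_cast hn
  have hlam : 0 < scale μ xs n := by
    have := hpos.c3
    have := hpos.tcr
    rw [scale]
    positivity
  have hlamC : (scale μ xs n : ℂ) ≠ 0 := by exact_mod_cast hlam.ne'
  obtain ⟨e, hcyc, hmain⟩ := exists_doubleIntegral_eq hn X hs ht x y
  -- The function `e` links the admissible contour with the wedge, as both evaluate to the same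
  -- residue expression. `dz` and `dw` each bring a factor `λ`, and `1/(z-w)` takes one away.
  rw [hmain x₀ m γ hγ xs, lineInt_scale hlam, saddleInt, mul_assoc, mul_comm (lineInt _ _),
    ← lineInt_const_mul]
  congr 1
  refine lineInt_congr fun η hη => ?_
  set lam := scale μ xs n with hlam_def
  set ζ : ℂ := (0 : ℝ) + η * Complex.I with hζ
  have hζst : IsSteep (-1) ζ := by
    rw [hζ, Complex.ofReal_zero, zero_add]
    exact isSteep_I η
  have hz : (xs : ℂ) + lam * ζ = xs + ((lam * η : ℝ) : ℂ) * Complex.I := by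
    rw [hζ]; push_cast; ring
  have hη' : lam * η ≠ 0 := mul_ne_zero hlam.ne' hη
  have hw := wedgeInt_resolventGauss (p := xs) (x := x) (b := (n / (2 * s) : ℝ)) (η := lam * η) hX
    (by positivity) hη' hcyc
  have hnz : nodal (points X) (xs + lam * ζ) ≠ 0 := by
    refine nodal_ne_zero fun h => ?_
    obtain ⟨j, hj⟩ := mem_points.mp h
    have := congrArg Complex.im hj
    rw [hz] at this
    simp at this
    exact hη'.elim (by simpa using this)
  rw [← hz, wedgeInt_scale hlam] at hw
  have e1 : ∀ A E P w : ℂ, P ≠ 0 → 2 * Real.pi * Complex.I * (A * (E - P * w))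
      = A * P * (2 * Real.pi * Complex.I * (E / P - w)) := by
    intro A E P w hP
    field_simp
  rw [e1 _ _ _ _ hnz, ← hw, ← mul_assoc, ← mul_assoc, ← wedgeInt_const_mul]
  refine wedgeInt_congr fun ω hω => ?_
  have h1 := exp_mul_nodal_eq (μ := μ) (v := v) hX ht.ne' hζst.im
  have h2 := exp_mul_nodal_eq (μ := μ) (v := u) hX hs.ne' hω.im
  rw [← hx, ← hlam_def] at h2
  rw [← hy, ← hlam_def] at h1
  set D : ℂ := (∏ j, (xs - X j : ℂ)) * Complex.exp (-(n * stieltjesD μ 0 xs * xs)) with hD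
  have hD0 : D ≠ 0 := by
    refine mul_ne_zero (Finset.prod_ne_zero_iff.mpr fun j _ => ?_) (Complex.exp_ne_zero _)
    rw [sub_ne_zero]
    exact_mod_cast (hX j).symm
  have hlhs : resolventGauss X x (n / (2 * s)) (xs + lam * ζ) (xs + lam * ω)
      = Complex.exp (gauge μ xs n s x : ℝ) / (lam * (ζ - ω)) *
        (Complex.exp ((n / (2 * s) : ℝ) * (xs + lam * ω - x) ^ 2) *
          nodal (points X) (xs + lam * ω) * Complex.exp (gauge μ xs n s x : ℝ))⁻¹ := by
    rw [resolventGauss, neg_mul, Complex.exp_neg,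
      show (xs + lam * ζ - (xs + lam * ω) : ℂ) = lam * (ζ - ω) by ring]
    have := Complex.exp_ne_zero (gauge μ xs n s x : ℝ)
    rw [mul_inv, mul_inv, div_mul_eq_mul_div, mul_comm (Complex.exp (gauge μ xs n s x : ℝ)),
      mul_assoc (_ * _) _ (Complex.exp _), inv_mul_cancel₀ this, mul_one, ← div_eq_mul_inv, div_div]
  rw [hlhs, h2, Complex.exp_sub]
  have h3 : Complex.exp (gauge μ xs n t y - gauge μ xs n s x : ℝ)
      = Complex.exp (gauge μ xs n t y : ℝ) * (Complex.exp (gauge μ xs n s x : ℝ))⁻¹ := by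
    rw [← Complex.exp_neg, ← Complex.exp_add]
    push_cast
    ring_nf
  rw [h3]
  have h4 := Complex.exp_ne_zero (gauge μ xs n s x : ℝ)
  have e2 : ∀ G H A P L B Z : ℂ, G ≠ 0 → L ≠ 0 →
      H * G⁻¹ * (A * P) * L * (G / (L * Z) * (B * D)⁻¹) = (A * P * H) * D⁻¹ / B / Z := by
    intro G H A P L B Z hG hL
    rw [mul_inv, div_eq_mul_inv, mul_inv]
    field_simp
  rw [e2 _ _ _ _ _ _ _ h4 hlamC, h1, mul_assoc, mul_inv_cancel₀ hD0, mul_one]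

/-- The centres `xP` drift with velocity `G₀` in time; completing the square, the gauge removes
exactly this drift, so no error arises here. -/
lemma exp_gaussian_eq (hn : 0 < n) (hpos : CritPos μ xs) {τ₁ τ₂ u v : ℝ} (hτ : τ₂ < τ₁) :
    1 / (c3 μ xs * (n : ℝ) ^ ((3 : ℝ) / 4)) *
      (Real.sqrt n / Real.sqrt (2 * Real.pi * (tP μ xs n τ₁ - tP μ xs n τ₂)) *
        Real.exp (-((n : ℝ) / (2 * (tP μ xs n τ₁ - tP μ xs n τ₂)) *
          ((xP μ xs n τ₁ + locSpace μ xs n u) - (xP μ xs n τ₂ + locSpace μ xs n v)) ^ 2))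
        * Real.exp (gauge μ xs n (tP μ xs n τ₂) (xP μ xs n τ₂ + locSpace μ xs n v)
          - gauge μ xs n (tP μ xs n τ₁) (xP μ xs n τ₁ + locSpace μ xs n u)))
    = 1 / Real.sqrt (2 * Real.pi * (τ₁ - τ₂)) *
        Real.exp (-((u - v) ^ 2 / (2 * (τ₁ - τ₂)))) := by
  obtain ⟨q, -, hq, hn4, -, hn2, hn3⟩ := natCast_rpow_quarters (n := n)
  have hq0 := hq hn
  have hc := hpos.c3
  have hd : 0 < τ₁ - τ₂ := sub_pos.mpr hτ
  have hsub : tP μ xs n τ₁ - tP μ xs n τ₂ = (τ₁ - τ₂) / (c3 μ xs * q) ^ 2 := by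
    rw [tP, tP, hn2]
    field_simp
    ring
  have hsqrt : Real.sqrt (2 * Real.pi * (tP μ xs n τ₁ - tP μ xs n τ₂))
      = Real.sqrt (2 * Real.pi * (τ₁ - τ₂)) / (c3 μ xs * q) := by
    rw [hsub, mul_div_assoc', Real.sqrt_div' _ (by positivity), Real.sqrt_sq (by positivity)]
  have hsn : Real.sqrt n = q ^ 2 := by
    rw [hn4, show q ^ 4 = (q ^ 2) ^ 2 by ring, Real.sqrt_sq (by positivity)]
  have h0 : 0 < Real.sqrt (2 * Real.pi * (τ₁ - τ₂)) := by positivity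
  rw [hsqrt, mul_assoc (Real.sqrt n / _), ← Real.exp_add, ← mul_assoc]
  congr 1
  · rw [hsn, hn3]
    field_simp
  · congr 1
    have hx : (xP μ xs n τ₁ + locSpace μ xs n u) - (xP μ xs n τ₂ + locSpace μ xs n v)
        = (tP μ xs n τ₁ - tP μ xs n τ₂) * stieltjesD μ 0 xs + (u - v) / (c3 μ xs * q ^ 3) := by
      rw [xP, xP, locSpace, locSpace, hn3]
      ring
    have hg : gauge μ xs n (tP μ xs n τ₂) (xP μ xs n τ₂ + locSpace μ xs n v)
          - gauge μ xs n (tP μ xs n τ₁) (xP μ xs n τ₁ + locSpace μ xs n u)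
        = n * stieltjesD μ 0 xs * ((xP μ xs n τ₁ + locSpace μ xs n u)
          - (xP μ xs n τ₂ + locSpace μ xs n v))
          - n * stieltjesD μ 0 xs ^ 2 * (tP μ xs n τ₁ - tP μ xs n τ₂) / 2 := by
      rw [gauge, gauge]
      ring
    rw [hg, hx, hsub, hn4]
    field_simp
    ring

/-- Exact local form of the rescaled kernel. -/
theorem conjKernel_eq_saddleInt (hn : 0 < n) (hpos : CritPos μ xs) (hX : ∀ j, X j ≠ xs)
    {τ₁ τ₂ u v : ℝ} (hs : 0 < tP μ xs n τ₁) (ht : 0 < tP μ xs n τ₂) {x₀ : ℝ} {m : ℕ}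
    {γ : Fin m → ℝ → ℂ} (hγ : Admissible X x₀ γ) :
    1 / ((c3 μ xs * (n : ℝ) ^ ((3 : ℝ) / 4) : ℝ) : ℂ) *
        conjKernel μ xs X x₀ γ (tP μ xs n τ₁) (tP μ xs n τ₂)
          (xP μ xs n τ₁ + u / (c3 μ xs * (n : ℝ) ^ ((3 : ℝ) / 4)))
          (xP μ xs n τ₂ + v / (c3 μ xs * (n : ℝ) ^ ((3 : ℝ) / 4)))
      - pearceyKernel τ₁ τ₂ u v
    = 1 / (2 * (Real.pi : ℂ) * Complex.I) ^ 2 *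
      ((tcr μ xs / Real.sqrt (tP μ xs n τ₁ * tP μ xs n τ₂) : ℝ) *
        saddleInt
          (phase (locPts μ xs X) (coef2 μ xs n (tP μ xs n τ₂)) (coef1 μ xs n (tP μ xs n τ₂) v)
            (coef0 μ xs n (tP μ xs n τ₂) v))
          (phase (locPts μ xs X) (coef2 μ xs n (tP μ xs n τ₁)) (coef1 μ xs n (tP μ xs n τ₁) u)
            (coef0 μ xs n (tP μ xs n τ₁) u))
        - saddleInt (pearceyPhase τ₂ v) (pearceyPhase τ₁ u)) := by
  have hlocu : u / (c3 μ xs * (n : ℝ) ^ ((3 : ℝ) / 4)) = locSpace μ xs n u := rfl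
  have hlocv : v / (c3 μ xs * (n : ℝ) ^ ((3 : ℝ) / 4)) = locSpace μ xs n v := rfl
  have hmain := lineInt_curveInt_eq_saddleInt (u := u) (v := v) hn hpos hX hs ht hγ
    (x := xP μ xs n τ₁ + locSpace μ xs n u) (y := xP μ xs n τ₂ + locSpace μ xs n v) rfl rfl
  obtain ⟨q, -, hq, hn4, hn1, hn2, hn3⟩ := natCast_rpow_quarters (n := n)
  have hq0 := hq hn
  have hc := hpos.c3
  have hq0C : (q : ℂ) ≠ 0 := by exact_mod_cast hq0.ne'
  have hcC : (c3 μ xs : ℂ) ≠ 0 := by exact_mod_cast hc.ne'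
  have hiff : tP μ xs n τ₂ < tP μ xs n τ₁ ↔ τ₂ < τ₁ := by
    rw [tP, tP, hn2, add_lt_add_iff_left, div_lt_div_iff_of_pos_right (by positivity)]
  have hn4C : (n : ℂ) = (q : ℂ) ^ 4 := by exact_mod_cast hn4
  rw [hlocu, hlocv, conjKernel, kernel, sub_mul, mul_assoc (_ / _), Complex.ofReal_exp, hmain,
    pearceyKernel, saddleInt_pearcey,
    mul_sub (1 / ((c3 μ xs * (n : ℝ) ^ ((3 : ℝ) / 4) : ℝ) : ℂ))]
  have hgauss : (1 / ((c3 μ xs * (n : ℝ) ^ ((3 : ℝ) / 4) : ℝ) : ℂ)) *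
      ((if tP μ xs n τ₂ < tP μ xs n τ₁ then
        ((Real.sqrt n / Real.sqrt (2 * Real.pi * (tP μ xs n τ₁ - tP μ xs n τ₂)) *
          Real.exp (-((n : ℝ) / (2 * (tP μ xs n τ₁ - tP μ xs n τ₂)) *
            ((xP μ xs n τ₁ + locSpace μ xs n u) - (xP μ xs n τ₂ + locSpace μ xs n v)) ^ 2)) : ℝ) : ℂ)
        else 0) *
        Complex.exp ((gauge μ xs n (tP μ xs n τ₂) (xP μ xs n τ₂ + locSpace μ xs n v)
          - gauge μ xs n (tP μ xs n τ₁) (xP μ xs n τ₁ + locSpace μ xs n u) : ℝ) : ℂ))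
      = if τ₂ < τ₁ then ((1 / Real.sqrt (2 * Real.pi * (τ₁ - τ₂)) *
        Real.exp (-((u - v) ^ 2 / (2 * (τ₁ - τ₂)))) : ℝ) : ℂ) else 0 := by
    by_cases h : τ₂ < τ₁
    · rw [if_pos (hiff.mpr h), if_pos h, ← exp_gaussian_eq hn hpos h]
      push_cast
      ring
    · rw [if_neg (hiff.not.mpr h), if_neg h]
      simp
  rw [hgauss]
  -- The powers of `n` cancel: `n λ / (c₃ n^{3/4}) = t_cr`.
  have hscale : (scale μ xs n : ℂ) = c3 μ xs * tcr μ xs / q := by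
    rw [scale, hn1]; push_cast; ring
  rw [hscale, hn3, hn4C]
  push_cast
  field_simp
  ring

end localization

end

/-! ### Stability of the double integral. -/

noncomputable section

/-- Mean value inequality on the convex half-plane `Re ≤ m`, where the derivative is at most `exp
m`. -/
lemma norm_exp_sub_exp_le {a b : ℂ} {m : ℝ} (ha : a.re ≤ m) (hb : b.re ≤ m) :
    ‖Complex.exp a - Complex.exp b‖ ≤ Real.exp m * ‖a - b‖ := by
  refine (convex_halfSpace_re_le m).norm_image_sub_le_of_norm_hasDerivWithin_le
    (f := Complex.exp) (f' := Complex.exp) (fun x _ => (Complex.hasDerivAt_exp x).hasDerivWithinAt)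
    (fun x hx => ?_) hb ha
  rw [Complex.norm_exp]
  exact Real.exp_le_exp.mpr hx

/-- The majorant of the one-dimensional sections of the double integrals. -/
def decay (x : ℝ) : ℝ := (1 + x) ^ 5 * (x ^ (-(1 / 2) : ℝ) * Real.exp (-1 * x ^ 2))

lemma decay_nonneg {x : ℝ} (hx : 0 ≤ x) : 0 ≤ decay x := by
  unfold decay
  positivity

lemma integrableOn_decay : IntegrableOn decay (Ioi 0) := by
  have h1 := integrableOn_rpow_mul_exp_neg_mul_sq one_pos (s := -(1 / 2)) (by norm_num)
  have h2 := integrableOn_rpow_mul_exp_neg_mul_sq one_pos (s := 9 / 2) (by norm_num)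
  refine ((h1.add h2).const_mul (2 ^ 4)).mono' ?_ ?_
  · refine Measurable.aestronglyMeasurable ?_
    unfold decay
    fun_prop
  · filter_upwards [ae_restrict_mem measurableSet_Ioi] with x hx
    have hx0 : (0 : ℝ) < x := hx
    rw [Real.norm_of_nonneg (decay_nonneg hx0.le), decay]
    have h3 := add_pow_le zero_le_one hx0.le 5
    have h4 : x ^ (9 / 2 : ℝ) = x ^ 5 * x ^ (-(1 / 2) : ℝ) := by
      rw [← Real.rpow_natCast, ← Real.rpow_add hx0]
      norm_num
    have h5 : 0 ≤ x ^ (-(1 / 2) : ℝ) * Real.exp (-1 * x ^ 2) := by positivity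
    refine (mul_le_mul_of_nonneg_right h3 h5).trans (le_of_eq ?_)
    simp only [Pi.add_apply, h4]
    ring

lemma integrable_decay_abs : Integrable fun r : ℝ => decay |r| :=
  integrable_comp_abs integrableOn_decay

/-- The rays make an angle of at least `π/3` with the imaginary axis, so `|ri - ρd|² ≥ r² + ρ² -
|r|ρ ≥ |r|ρ`. The singularity at the crossing is thus below a product of integrable functions of one
variable. -/
lemma one_div_norm_sub_le {d : ℂ} (hre : d.re ^ 2 = 3 / 4) (him : d.im ^ 2 = 1 / 4) {r ρ : ℝ}
    (hr : r ≠ 0) (hρ : 0 < ρ) :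
    ‖(r * Complex.I - ρ * d : ℂ)‖⁻¹ ≤ |r| ^ (-(1 / 2) : ℝ) * ρ ^ (-(1 / 2) : ℝ) := by
  have hr0 : 0 < |r| := abs_pos.mpr hr
  have hmul : 0 < |r| * ρ := mul_pos hr0 hρ
  rw [← Real.mul_rpow hr0.le hρ.le, Real.rpow_neg hmul.le, ← Real.sqrt_eq_rpow]
  refine inv_anti₀ (Real.sqrt_pos.mpr hmul) ((Real.sqrt_le_left (norm_nonneg _)).mpr ?_)
  rw [Complex.sq_norm, Complex.normSq_apply]
  simp only [Complex.sub_re, Complex.sub_im, Complex.re_ofReal_mul, Complex.im_ofReal_mul,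
    Complex.I_re, Complex.I_im, mul_zero, mul_one, zero_sub]
  have h1 : |d.im| = 1 / 2 := by
    rw [← Real.sqrt_sq_eq_abs, him, Real.sqrt_eq_iff_mul_self_eq] <;> norm_num
  have h2 : r * d.im ≤ |r| * (1 / 2) := by
    rw [← h1, ← abs_mul]
    exact le_abs_self _
  have h3 : ρ * (r * d.im) ≤ ρ * (|r| * (1 / 2)) := mul_le_mul_of_nonneg_left h2 hρ.le
  have h4 : r ^ 2 = |r| ^ 2 := (sq_abs r).symm
  have e : -(ρ * d.re) * -(ρ * d.re) + (r - ρ * d.im) * (r - ρ * d.im)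
      = ρ ^ 2 + |r| ^ 2 - 2 * (ρ * (r * d.im)) := by
    linear_combination ρ ^ 2 * hre + ρ ^ 2 * him + h4
  rw [e]
  nlinarith [sq_nonneg (|r| - ρ)]

/-- Gaussian descent of the exponential of the phase functions along the contours. -/
structure Descends (A B : ℂ → ℂ) (C : ℝ) : Prop where
  measA : Measurable A
  measB : Measurable B
  leA : ∀ r : ℝ, (A (r * Complex.I)).re ≤ C - r ^ 2
  leB : ∀ ω, IsSteep 1 ω → -(B ω).re ≤ C - ‖ω‖ ^ 2

/-- The integral over one ray of the wedge contour. -/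
def sectionInt (A B : ℂ → ℂ) (d : ℂ) (r : ℝ) : ℂ :=
  rayInt d (fun ω => Complex.exp (A (r * Complex.I) - B ω) / (r * Complex.I - ω))

section descent

variable {A B A' B' : ℂ → ℂ} {C δ : ℝ} {d : ℂ}

lemma norm_dir (hre : d.re ^ 2 = 3 / 4) (him : d.im ^ 2 = 1 / 4) : ‖d‖ = 1 := by
  have hn : ‖d‖ ^ 2 = 1 := by
    rw [Complex.sq_norm, Complex.normSq_apply]
    linarith
  nlinarith [norm_nonneg d]

lemma Descends.re_sub_le (h : Descends A B C) (hre : d.re ^ 2 = 3 / 4) (him : d.im ^ 2 = 1 / 4)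
    (r ρ : ℝ) : (A (r * Complex.I) - B (ρ * d)).re ≤ 2 * C + (-1 * |r| ^ 2 + -1 * ρ ^ 2) := by
  have h1 := h.leA r
  have h2 := h.leB _ ((isSteep_of_sq hre him).mul_real ρ)
  rw [norm_mul, norm_dir hre him, Complex.norm_real, mul_one, Real.norm_eq_abs, sq_abs] at h2
  rw [Complex.sub_re, sq_abs]
  linarith

lemma one_le_one_add_pow {x : ℝ} (hx : 0 ≤ x) : 1 ≤ (1 + x) ^ 5 :=
  one_le_pow₀ (by linarith)

lemma norm_div_le_decay (hre : d.re ^ 2 = 3 / 4) (him : d.im ^ 2 = 1 / 4) {r ρ : ℝ}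
    (hr : r ≠ 0) (hρ : 0 < ρ) {z : ℂ} {Q : ℝ} (hQ : 0 ≤ Q)
    (hz : ‖z‖ ≤ Q * ((1 + |r|) ^ 5 * (1 + ρ) ^ 5) * Real.exp (-1 * |r| ^ 2 + -1 * ρ ^ 2)) :
    ‖z / (r * Complex.I - ρ * d)‖ ≤ Q * decay |r| * decay ρ := by
  rw [norm_div, div_eq_mul_inv]
  refine (mul_le_mul hz (one_div_norm_sub_le hre him hr hρ) (by positivity)
    (by positivity)).trans (le_of_eq ?_)
  rw [Real.exp_add, decay, decay]
  ring

lemma Descends.norm_integrand_le (h : Descends A B C) (hre : d.re ^ 2 = 3 / 4)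
    (him : d.im ^ 2 = 1 / 4) {r ρ : ℝ} (hr : r ≠ 0) (hρ : 0 < ρ) :
    ‖Complex.exp (A (r * Complex.I) - B (ρ * d)) / (r * Complex.I - ρ * d)‖
      ≤ Real.exp (2 * C) * decay |r| * decay ρ := by
  refine norm_div_le_decay hre him hr hρ (Real.exp_pos _).le ?_
  rw [Complex.norm_exp]
  refine (Real.exp_le_exp.mpr (h.re_sub_le hre him r ρ)).trans ?_
  rw [Real.exp_add]
  refine mul_le_mul_of_nonneg_right ?_ (Real.exp_pos _).le
  exact le_mul_of_one_le_right (Real.exp_pos _).le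
    (one_le_mul_of_one_le_of_one_le (one_le_one_add_pow (abs_nonneg r)) (one_le_one_add_pow hρ.le))

lemma Descends.measurable_integrand (h : Descends A B C) (d : ℂ) :
    Measurable fun p : ℝ × ℝ =>
      Complex.exp (A (p.1 * Complex.I) - B (p.2 * d)) / (p.1 * Complex.I - p.2 * d) := by
  have hA : Measurable fun p : ℝ × ℝ => A (p.1 * Complex.I) :=
    h.measA.comp (by fun_prop)
  have hB : Measurable fun p : ℝ × ℝ => B (p.2 * d) := h.measB.comp (by fun_prop)
  exact (Complex.measurable_exp.comp (hA.sub hB)).div (by fun_prop)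

lemma Descends.integrableOn (h : Descends A B C) (hre : d.re ^ 2 = 3 / 4)
    (him : d.im ^ 2 = 1 / 4) {r : ℝ} (hr : r ≠ 0) :
    IntegrableOn (fun ρ : ℝ =>
      Complex.exp (A (r * Complex.I) - B (ρ * d)) / (r * Complex.I - ρ * d)) (Ioi 0) := by
  refine (integrableOn_decay.const_mul (Real.exp (2 * C) * decay |r|)).mono' ?_ ?_
  · exact ((h.measurable_integrand d).comp measurable_prodMk_left).aestronglyMeasurable
  · filter_upwards [ae_restrict_mem measurableSet_Ioi] with ρ hρ
    exact h.norm_integrand_le hre him hr hρ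

lemma norm_rayInt_le (hre : d.re ^ 2 = 3 / 4) (him : d.im ^ 2 = 1 / 4) {f : ℂ → ℂ} {Q : ℝ}
    (hf : ∀ ρ : ℝ, 0 < ρ → ‖f (ρ * d)‖ ≤ Q * decay ρ) :
    ‖rayInt d f‖ ≤ Q * ∫ ρ in Ioi 0, decay ρ := by
  rw [← integral_const_mul]
  refine norm_integral_le_of_norm_le (integrableOn_decay.const_mul Q) ?_
  filter_upwards [ae_restrict_mem measurableSet_Ioi] with ρ hρ
  rw [norm_mul, norm_dir hre him, mul_one]
  exact hf ρ hρ

lemma Descends.norm_sectionInt_le (h : Descends A B C) (hre : d.re ^ 2 = 3 / 4)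
    (him : d.im ^ 2 = 1 / 4) {r : ℝ} (hr : r ≠ 0) :
    ‖sectionInt A B d r‖ ≤ Real.exp (2 * C) * decay |r| * ∫ ρ in Ioi 0, decay ρ :=
  norm_rayInt_le hre him fun _ hρ => h.norm_integrand_le hre him hr hρ

lemma Descends.integrable_sectionInt (h : Descends A B C) (hre : d.re ^ 2 = 3 / 4)
    (him : d.im ^ 2 = 1 / 4) : Integrable (sectionInt A B d) := by
  refine ((integrable_decay_abs.const_mul (Real.exp (2 * C))).mul_const
    (∫ ρ in Ioi 0, decay ρ)).mono' ?_ ?_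
  · exact ((h.measurable_integrand d).mul_const d).stronglyMeasurable.integral_prod_right'
      |>.aestronglyMeasurable
  · filter_upwards [compl_mem_ae_iff.mpr (measure_singleton (0 : ℝ))] with r hr
    exact h.norm_sectionInt_le hre him hr

/-- Of the `3δ`, two come from the differences of the phases and one from `k`. Four rays then give
the constant `12`. -/
lemma Descends.norm_sectionInt_sub_le (h : Descends A B C) (h' : Descends A' B' C)
    (hre : d.re ^ 2 = 3 / 4) (him : d.im ^ 2 = 1 / 4)
    (hA : ∀ r : ℝ, ‖A (r * Complex.I) - A' (r * Complex.I)‖ ≤ δ * (1 + |r|) ^ 5)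
    (hB : ∀ ω, IsSteep 1 ω → ‖B ω - B' ω‖ ≤ δ * (1 + ‖ω‖) ^ 5) {k : ℂ} (hk : ‖k - 1‖ ≤ δ)
    {r : ℝ} (hr : r ≠ 0) :
    ‖k * sectionInt A B d r - sectionInt A' B' d r‖
      ≤ 3 * δ * Real.exp (2 * C) * decay |r| * ∫ ρ in Ioi 0, decay ρ := by
  have hδ : 0 ≤ δ := (norm_nonneg _).trans hk
  have hsub : k * sectionInt A B d r - sectionInt A' B' d r
      = rayInt d (fun ω => k * (Complex.exp (A (r * Complex.I) - B ω) / (r * Complex.I - ω))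
        - Complex.exp (A' (r * Complex.I) - B' ω) / (r * Complex.I - ω)) := by
    rw [sectionInt, sectionInt, ← rayInt_const_mul]
    simp only [rayInt, sub_mul]
    exact (integral_sub (((h.integrableOn hre him hr).const_mul k).mul_const d)
      ((h'.integrableOn hre him hr).mul_const d)).symm
  rw [hsub]
  refine norm_rayInt_le hre him fun ρ hρ => ?_
  rw [mul_div_assoc', ← sub_div]
  refine norm_div_le_decay hre him hr hρ (by positivity) ?_
  set a := A (r * Complex.I) - B (ρ * d) with ha
  set b := A' (r * Complex.I) - B' (ρ * d) with hb
  set E : ℝ := 2 * C + (-1 * |r| ^ 2 + -1 * ρ ^ 2) with hE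
  have hra : a.re ≤ E := h.re_sub_le hre him r ρ
  have hrb : b.re ≤ E := h'.re_sub_le hre him r ρ
  have h1r := one_le_one_add_pow (abs_nonneg r)
  have h1ρ := one_le_one_add_pow hρ.le
  have hab : ‖a - b‖ ≤ 2 * δ * ((1 + |r|) ^ 5 * (1 + ρ) ^ 5) := by
    have e : a - b = (A (r * Complex.I) - A' (r * Complex.I)) - (B (ρ * d) - B' (ρ * d)) := by
      rw [ha, hb]; ring
    have hBρ := hB _ ((isSteep_of_sq hre him).mul_real ρ)
    rw [norm_mul, norm_dir hre him, Complex.norm_real, mul_one, Real.norm_of_nonneg hρ.le] at hBρ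
    rw [e]
    refine (norm_sub_le_of_le (hA r) hBρ).trans ?_
    have h2 : (1 + |r|) ^ 5 ≤ (1 + |r|) ^ 5 * (1 + ρ) ^ 5 :=
      le_mul_of_one_le_right (by positivity) h1ρ
    have h3 : (1 + ρ) ^ 5 ≤ (1 + |r|) ^ 5 * (1 + ρ) ^ 5 :=
      le_mul_of_one_le_left (by positivity) h1r
    have := mul_le_mul_of_nonneg_left (add_le_add h2 h3) hδ
    linarith
  have hka : ‖(k - 1) * Complex.exp a‖ ≤ δ * ((1 + |r|) ^ 5 * (1 + ρ) ^ 5) * Real.exp E := by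
    rw [norm_mul, Complex.norm_exp]
    refine mul_le_mul (hk.trans (le_mul_of_one_le_right hδ
      (one_le_mul_of_one_le_of_one_le h1r h1ρ))) (Real.exp_le_exp.mpr hra) (Real.exp_pos _).le
      (by positivity)
  have hexp : ‖Complex.exp a - Complex.exp b‖
      ≤ Real.exp E * (2 * δ * ((1 + |r|) ^ 5 * (1 + ρ) ^ 5)) :=
    (norm_exp_sub_exp_le hra hrb).trans (mul_le_mul_of_nonneg_left hab (Real.exp_pos _).le)
  rw [show k * Complex.exp a - Complex.exp b
    = (k - 1) * Complex.exp a + (Complex.exp a - Complex.exp b) by ring]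
  refine (norm_add_le_of_le hka hexp).trans (le_of_eq ?_)
  rw [hE, Real.exp_add (2 * C)]
  ring

lemma Descends.saddleInt_eq (h : Descends A B C) :
    saddleInt A B = ((∫ r, sectionInt A B dirM r) + (∫ r, sectionInt A B (-dirM) r)
      - (∫ r, sectionInt A B dirP r) - ∫ r, sectionInt A B (-dirP) r) * Complex.I := by
  have hP : dirP.re ^ 2 = 3 / 4 ∧ dirP.im ^ 2 = 1 / 4 := by
    rw [dirP_re, dirP_im, div_pow, Real.sq_sqrt] <;> norm_num
  have hM : dirM.re ^ 2 = 3 / 4 ∧ dirM.im ^ 2 = 1 / 4 := by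
    rw [dirM_re, dirM_im, div_pow, Real.sq_sqrt] <;> norm_num
  have i1 := h.integrable_sectionInt hM.1 hM.2
  have i2 := h.integrable_sectionInt (d := -dirM) (by simpa using hM.1) (by simpa using hM.2)
  have i3 := h.integrable_sectionInt hP.1 hP.2
  have i4 := h.integrable_sectionInt (d := -dirP) (by simpa using hP.1) (by simpa using hP.2)
  rw [← integral_add' i1 i2, ← integral_sub' (i1.add i2) i3, ← integral_sub' ((i1.add i2).sub i3) i4,
    ← integral_mul_const, saddleInt, lineInt]
  refine integral_congr_ae (ae_of_all _ fun r => ?_)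
  simp [wedgeInt, sectionInt]

/-- Stability of the double integral under perturbation of the phase functions. -/
theorem Descends.norm_saddleInt_sub_le (h : Descends A B C) (h' : Descends A' B' C)
    (hA : ∀ r : ℝ, ‖A (r * Complex.I) - A' (r * Complex.I)‖ ≤ δ * (1 + |r|) ^ 5)
    (hB : ∀ ω, IsSteep 1 ω → ‖B ω - B' ω‖ ≤ δ * (1 + ‖ω‖) ^ 5) {k : ℂ} (hk : ‖k - 1‖ ≤ δ) :
    ‖k * saddleInt A B - saddleInt A' B'‖
      ≤ 12 * Real.exp (2 * C) * (∫ r : ℝ, decay |r|) * (∫ ρ in Ioi 0, decay ρ) * δ := by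
  have key : ∀ d : ℂ, d.re ^ 2 = 3 / 4 → d.im ^ 2 = 1 / 4 →
      ‖k * (∫ r, sectionInt A B d r) - ∫ r, sectionInt A' B' d r‖
        ≤ 3 * δ * Real.exp (2 * C) * (∫ r : ℝ, decay |r|) * ∫ ρ in Ioi 0, decay ρ := by
    intro d hre him
    rw [← integral_const_mul, ← integral_sub ((h.integrable_sectionInt hre him).const_mul k)
      (h'.integrable_sectionInt hre him),
      ← integral_const_mul (3 * δ * Real.exp (2 * C)) fun r : ℝ => decay |r|, ← integral_mul_const]
    refine norm_integral_le_of_norm_le ((integrable_decay_abs.const_mul _).mul_const _) ?_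
    filter_upwards [compl_mem_ae_iff.mpr (measure_singleton (0 : ℝ))] with r hr
    exact h.norm_sectionInt_sub_le h' hre him hA hB hk hr
  have hP : dirP.re ^ 2 = 3 / 4 ∧ dirP.im ^ 2 = 1 / 4 := by
    rw [dirP_re, dirP_im, div_pow, Real.sq_sqrt] <;> norm_num
  have hM : dirM.re ^ 2 = 3 / 4 ∧ dirM.im ^ 2 = 1 / 4 := by
    rw [dirM_re, dirM_im, div_pow, Real.sq_sqrt] <;> norm_num
  have k1 := key dirM hM.1 hM.2
  have k2 := key (-dirM) (by simpa using hM.1) (by simpa using hM.2)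
  have k3 := key dirP hP.1 hP.2
  have k4 := key (-dirP) (by simpa using hP.1) (by simpa using hP.2)
  rw [h.saddleInt_eq, h'.saddleInt_eq]
  have e : ∀ a b c d a' b' c' d' : ℂ, k * ((a + b - c - d) * Complex.I)
      - (a' + b' - c' - d') * Complex.I
      = ((k * a - a') + (k * b - b') - (k * c - c') - (k * d - d')) * Complex.I := by
    intros
    ring
  rw [e, norm_mul, Complex.norm_I, mul_one]
  refine (norm_sub_le_of_le (norm_sub_le_of_le (norm_add_le_of_le k1 k2) k3) k4).trans
    (le_of_eq ?_)
  ring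

lemma measurable_phase {n : ℕ} (b : Fin n → ℝ) (c₂ c₁ c₀ : ℝ) : Measurable (phase b c₂ c₁ c₀) := by
  unfold phase
  fun_prop

lemma measurable_pearceyPhase (τ v : ℝ) : Measurable (pearceyPhase τ v) := by
  unfold pearceyPhase
  fun_prop

end descent

end

end NIBM

/-! ### The main theorem. -/

theorem theorem1p6 (X : (n : ℕ) → Fin n → ℝ) (μ : MeasureTheory.Measure ℝ) (ψ : ℝ → ℝ)
    (xs κ : ℝ) (h1 : NIBM.Assumption1 X μ ψ xs κ) (h2 : NIBM.Assumption2 X μ)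
    (h3 : NIBM.Assumption3 X xs κ) (hG : NIBM.stieltjesD μ 2 xs = 0) (hκ : 3 < κ)
    (ε : ℝ) (hε : 0 < ε) (hε' : ε < min ((κ - 3) / (8 * (κ + 1))) (1 / 24))
    (T : Set ℝ) (hT : IsCompact T) (M : ℝ) (hM : 0 < M) :
    ∃ (C : ℝ) (N : ℕ), ∀ n : ℕ, N ≤ n →
      ∀ τ₁ ∈ T, ∀ τ₂ ∈ T, ∀ u ∈ Set.Icc (-M) M, ∀ v ∈ Set.Icc (-M) M,
      ∀ (x₀ : ℝ) (m : ℕ) (γ : Fin m → ℝ → ℂ), NIBM.Admissible (X n) x₀ γ →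
        ‖1 / ((NIBM.c3 μ xs * (n : ℝ) ^ ((3 : ℝ) / 4) : ℝ) : ℂ) *
            NIBM.conjKernel μ xs (X n) x₀ γ (NIBM.tP μ xs n τ₁) (NIBM.tP μ xs n τ₂)
              (NIBM.xP μ xs n τ₁ + u / (NIBM.c3 μ xs * (n : ℝ) ^ ((3 : ℝ) / 4)))
              (NIBM.xP μ xs n τ₂ + v / (NIBM.c3 μ xs * (n : ℝ) ^ ((3 : ℝ) / 4)))
          - NIBM.pearceyKernel τ₁ τ₂ u v‖ ≤ C * (n : ℝ) ^ (-ε) := by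
  obtain ⟨T₀, hT₀, hTb⟩ : ∃ T₀ : ℝ, 0 ≤ T₀ ∧ ∀ τ ∈ T, |τ| ≤ T₀ := by
    obtain ⟨R, hR⟩ := hT.isBounded.exists_norm_le
    exact ⟨max R 0, le_max_right _ _, fun τ hτ => (hR τ hτ).trans (le_max_left _ _)⟩
  have hpos := NIBM.critPos h1 h2 hκ
  obtain ⟨C, hC, hev⟩ := NIBM.exists_phaseClose h1 h2 h3 hG hκ (T := T₀) (M := M) hT₀
  set K : ℝ := 32 * (T₀ / 2 + M + 3) with hK
  set L : ℝ := 32 * (T₀ / 2 + M + 3) ^ 2 + M + 2 with hL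
  set J : ℝ := 12 * Real.exp (2 * L) * (∫ r : ℝ, NIBM.decay |r|) * ∫ ρ in Ioi 0, NIBM.decay ρ
    with hJ
  have hJ0 : 0 ≤ J := by
    have i1 : 0 ≤ ∫ r : ℝ, NIBM.decay |r| :=
      integral_nonneg fun r => NIBM.decay_nonneg (abs_nonneg r)
    have i2 : 0 ≤ ∫ ρ in Ioi 0, NIBM.decay ρ :=
      setIntegral_nonneg measurableSet_Ioi fun ρ hρ => NIBM.decay_nonneg (le_of_lt hρ)
    positivity
  have hlim : Tendsto (fun n : ℕ => C * (n : ℝ) ^ (-NIBM.rate κ)) atTop (𝓝 0) := by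
    simpa using (NIBM.tendsto_natCast_rpow_neg (NIBM.rate_pos hκ)).const_mul C
  have hlim2 : Tendsto (fun n : ℕ => (C * (n : ℝ) ^ (-NIBM.rate κ)) ^ 2 * K) atTop (𝓝 0) := by
    simpa using (hlim.pow 2).mul_const K
  obtain ⟨N, hN⟩ := eventually_atTop.mp (hev.and ((hlim.eventually_le_const one_half_pos).and
    (hlim2.eventually_le_const one_half_pos)))
  refine ⟨1 / (2 * Real.pi) ^ 2 * (J * (2 * C)), N, fun n hn τ₁ hτ₁ τ₂ hτ₂ u hu v hv x₀ m γ hγ => ?_⟩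
  obtain ⟨⟨hn0, hX, hloc, hclose, hratio⟩, hδ, hβ⟩ := hN n hn
  set δ : ℝ := C * (n : ℝ) ^ (-NIBM.rate κ) with hδdef
  have hu' : |u| ≤ M := abs_le.mpr hu
  have hv' : |v| ≤ M := abs_le.mpr hv
  obtain ⟨hs, hs'⟩ := hclose τ₁ (hTb τ₁ hτ₁)
  obtain ⟨ht, ht'⟩ := hclose τ₂ (hTb τ₂ hτ₂)
  have hcs := hs' u hu'
  have hct := ht' v hv'
  have hnI : ∀ r : ℝ, ‖(r * Complex.I : ℂ)‖ = |r| := fun r => by simp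
  have hd : NIBM.Descends
      (NIBM.phase (NIBM.locPts μ xs (X n)) (NIBM.coef2 μ xs n (NIBM.tP μ xs n τ₂))
        (NIBM.coef1 μ xs n (NIBM.tP μ xs n τ₂) v) (NIBM.coef0 μ xs n (NIBM.tP μ xs n τ₂) v))
      (NIBM.phase (NIBM.locPts μ xs (X n)) (NIBM.coef2 μ xs n (NIBM.tP μ xs n τ₁))
        (NIBM.coef1 μ xs n (NIBM.tP μ xs n τ₁) u) (NIBM.coef0 μ xs n (NIBM.tP μ xs n τ₁) u)) L := by
    refine ⟨NIBM.measurable_phase _ _ _ _, NIBM.measurable_phase _ _ _ _, fun r => ?_,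
      fun ω hω => ?_⟩
    · have := hct.re_le hδ (hTb τ₂ hτ₂) hv' hloc hβ (NIBM.isSteep_I r)
      rwa [neg_neg, one_mul, hnI, sq_abs] at this
    · have := hcs.re_le hδ (hTb τ₁ hτ₁) hu' hloc hβ hω
      rwa [neg_one_mul] at this
  have hd' : NIBM.Descends (NIBM.pearceyPhase τ₂ v) (NIBM.pearceyPhase τ₁ u) L := by
    refine ⟨NIBM.measurable_pearceyPhase _ _, NIBM.measurable_pearceyPhase _ _, fun r => ?_,
      fun ω hω => ?_⟩
    · have := NIBM.pearceyPhase_re_le (hTb τ₂ hτ₂) hv' (NIBM.isSteep_I r)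
      rwa [neg_neg, one_mul, hnI, sq_abs] at this
    · have := NIBM.pearceyPhase_re_le (hTb τ₁ hτ₁) hu' hω
      rwa [neg_one_mul] at this
  have hk : ‖((NIBM.tcr μ xs / Real.sqrt (NIBM.tP μ xs n τ₁ * NIBM.tP μ xs n τ₂) : ℝ) : ℂ) - 1‖
      ≤ 2 * δ := by
    have hr := hratio τ₁ τ₂ (hTb τ₁ hτ₁) (hTb τ₂ hτ₂)
    rw [← Complex.ofReal_one, ← Complex.ofReal_sub, Complex.norm_real, Real.norm_eq_abs]
    have := (abs_nonneg _).trans hr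
    linarith
  -- The doubling matches the factor `2` in `PhaseClose.norm_sub_le`.
  have hfin := hd.norm_saddleInt_sub_le hd' (δ := 2 * δ)
    (fun r => by simpa only [hnI] using hct.norm_sub_le (NIBM.isSteep_I r).im)
    (fun ω hω => hcs.norm_sub_le hω.im) hk
  rw [NIBM.conjKernel_eq_saddleInt hn0 hpos hX hs ht hγ, norm_mul]
  have hpi : ‖1 / (2 * (Real.pi : ℂ) * Complex.I) ^ 2‖ = 1 / (2 * Real.pi) ^ 2 := by
    rw [norm_div, norm_pow, norm_mul, Complex.norm_I, norm_mul, Complex.norm_real,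
      Real.norm_of_nonneg Real.pi_pos.le]
    simp
  have hn1 : (1 : ℝ) ≤ n := by exact_mod_cast hn0
  -- The bound `(κ-3)/(8(κ+1))` on `ε` is half of `rate κ`.
  have hrate : (n : ℝ) ^ (-NIBM.rate κ) ≤ (n : ℝ) ^ (-ε) := by
    refine Real.rpow_le_rpow_of_exponent_le hn1 (neg_le_neg ?_)
    have h4 : ε < (κ - 3) / (8 * (κ + 1)) := hε'.trans_le (min_le_left _ _)
    have h5 : (κ - 3) / (8 * (κ + 1)) = NIBM.rate κ / 2 := by
      have : κ + 1 ≠ 0 := by linarith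
      rw [NIBM.rate]
      field_simp
      ring
    have := NIBM.rate_pos hκ
    linarith
  rw [hpi]
  calc _ ≤ 1 / (2 * Real.pi) ^ 2 * (J * (2 * δ)) := by gcongr
    _ = 1 / (2 * Real.pi) ^ 2 * (J * (2 * C)) * (n : ℝ) ^ (-NIBM.rate κ) := by rw [hδdef]; ring
    _ ≤ _ := by gcongr
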